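/- Fix an integer $k>0$; residues and indices of generators are taken modulo $k+1$, and a partition is drawn with rows numbered from bottom to top, so that the cell $(i,j)$ in row $i$ and column $j$ has residue $j-i \bmod (k+1)$. A partition $\lambda$ is $k$-bounded if $\lambda_1\le k$. A $(k+1)$-core is a partition none of whose cells has hook length $k+1$. The map sending a $(k+1)$-core $\gamma$ to the sequence whose $i$-th term is the number of cells of hook length at most $k$ in row $i$ of $\gamma$ is a bijection onto the $k$-bounded partitions; $\mathfrak c$ denotes its inverse. Let $\tilde S_{k+1}=\langle s_0,\dots,s_k\rangle$ be the affine Weyl group of type $A$, with $s_i^2=1$, $s_is_{i+1}s_i=s_{i+1}s_is_{i+1}$ (for $k\ge 2$; when $k=1$ there is no relation besides $s_i^2=1$) and $s_is_j=s_js_i$ for distinct $i,j$ that are not cyclically adjacent, and let $\ell$ be its length function. Grassmannian elements are the minimal length representatives of the cosets $w\langle s_1,\dots,s_k\rangle$. The map sending a Grassmannian $w$ with reduced word $i_\ell\cdots i_1$ to $\mathfrak s_{i_\ell}\cdots\mathfrak s_{i_1}\emptyset$, where $\mathfrak s_i$ adds to a shape all its addable corners of residue $i$, is a bijection from Grassmannian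 elements to $(k+1)$-cores; $w_\lambda$ denotes the element sent to $\mathfrak c(\lambda)$. The affine nil Hecke algebra $K$ is the associative unital $\mathbb Z$-algebra with generators $A_0,\dots,A_k$ and relations $A_i^2=-A_i$, $A_iA_{i+1}A_i=A_{i+1}A_iA_{i+1}$ (for $k\ge2$), and $A_iA_j=A_jA_i$ for distinct $i,j$ that are not cyclically adjacent. It has the $\mathbb Z$-basis $(A_w)_{w\in\tilde S_{k+1}}$, where $A_w=A_{i_1}\cdots A_{i_\ell}$ for any reduced word $i_1\cdots i_\ell$ of $w$. An element $w=s_{i_1}\cdots s_{i_r}$ is cyclically decreasing if the $i_1,\dots,i_r$ can be chosen distinct and such that $j$ precedes $j-1$ whenever both occur. Put $h_r=\sum A_w$, over the cyclically decreasing $w$ with $\ell(w)=r$. The affine stable Grothendieck polynomial of $w\in\tilde S_{k+1}$ is $$G^{(k)}_w(x_1,x_2,\dots)=\sum_\alpha \langle h_{\alpha_\ell}\cdots h_{\alpha_2}h_{\alpha_1},A_w\rangle\,x^\alpha ,$$ where $\alpha=(\alpha_1,\alpha_2,\dots)$ runs over the sequences of nonnegative integers with finitely many nonzero terms, $\ell$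 is such that $\alpha_x=0$ for $x>\ell$, and $\langle\,\cdot\,,A_w\rangle$ is the coefficient of $A_w$ in the basis above. A standard affine set-valued tableau of degree $n$ is a filling $T$ of the cells of a partition by nonempty subsets of $\{1,\dots,n\}$ such that, for each $1\le x\le n$, the cells containing a letter $\le x$ form a $(k+1)$-core, and the cells containing $x$ are exactly all the removable corners of this core of some residue, there being at least one. For $\alpha$ as above with all $\alpha_x\le k$ and $|\alpha|=\sum_x\alpha_x$, let $\mathcal A_{\alpha,x}=\{\alpha_1+\dots+\alpha_{x-1}+1,\dots,\alpha_1+\dots+\alpha_x\}$. An affine set-valued tableau of weight $\alpha$ is a standard affine set-valued tableau of degree $|\alpha|$ such that for each $x\geq 1$: (1) the word obtained by reading the lowest occurrence of each letter of $\mathcal A_{\alpha,x}$, rows from top to bottom, each row from left to right, and letters in one cell in decreasing order, is increasing; (2) the cells containing letters of $\mathcal A_{\alpha,x}$ have exactly $\alpha_x$ distinct residues; (3) these cells form a horizontal strip (at most one in each column). Let $\mathcal T^k(\lambda)$ be the set of affine set-valued tableaux $T$ of shape $\mathfrak c(\lambda)$ of any weight, each taken together with its weight $w(T)$. Then, for every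 $k$-bounded partition $\lambda$, $$G^{(k)}_{w_\lambda}=\sum_{T\in\mathcal T^k(\lambda)}(-1)^{|\lambda|+|w(T)|}\,x^{w(T)} .$$ -/

import Mathlib

namespace AffineGroth

theorem end_mul_apply {α : Type*} (f g : Function.End α) (x : α) : (f * g) x = f (g x) := rfl

theorem end_one_apply {α : Type*} (x : α) : (1 : Function.End α) x = x := rfl

section Exchange

variable {B W : Type*} [Group W] {M : CoxeterMatrix B} (cs : CoxeterSystem M W)

/-- The action of a simple reflection on `W × ZMod 2` used for the exchange property. -/
noncomputable def flip (i : B) : Function.End (W × ZMod 2) := by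
  classical
  exact fun p => (cs.simple i * p.1 * cs.simple i, p.2 + if p.1 = cs.simple i then 1 else 0)

theorem simple_conj_pow (i j : B) (m : ℕ) :
    cs.simple j * (cs.simple i * cs.simple j) ^ m
      = (cs.simple j * cs.simple i) ^ m * cs.simple j := by
  induction m with
  | zero => simp
  | succ m ih => rw [pow_succ', pow_succ']; simp only [mul_assoc]; rw [ih]

theorem inv_pow_simple (i j : B) (m : ℕ) :
    ((cs.simple i * cs.simple j) ^ m)⁻¹ = (cs.simple j * cs.simple i) ^ m := by
  rw [← inv_pow]; simp

open Classical in
theorem flip_pow (i j : B) (m : ℕ) (t : W) (z : ZMod 2) :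
    ((flip cs i * flip cs j) ^ m) (t, z)
      = ((cs.simple i * cs.simple j) ^ m * t * (cs.simple j * cs.simple i) ^ m,
        z + ∑ l ∈ Finset.range (2 * m),
          if t = (cs.simple j * cs.simple i) ^ l * cs.simple j then 1 else 0) := by
  induction m with
  | zero => simp [end_one_apply]
  | succ m ih =>
    rw [pow_succ', end_mul_apply, ih, end_mul_apply, show 2 * (m + 1) = 2 * m + 1 + 1 by ring,
      Finset.sum_range_succ, Finset.sum_range_succ]
    have hb : (cs.simple j * cs.simple i) ^ m = ((cs.simple i * cs.simple j) ^ m)⁻¹ :=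
      (inv_pow_simple cs i j m).symm
    have hc := simple_conj_pow cs i j m
    have e1 : (cs.simple i * cs.simple j) ^ m * t * (cs.simple j * cs.simple i) ^ m = cs.simple j
        ↔ t = (cs.simple j * cs.simple i) ^ (2 * m) * cs.simple j := by
      rw [two_mul, pow_add, mul_assoc ((cs.simple j * cs.simple i) ^ m), ← hc, hb]
      generalize (cs.simple i * cs.simple j) ^ m = a
      constructor
      · intro h; rw [← h]; group
      · intro h; rw [h]; group
    have e2 : cs.simple j * ((cs.simple i * cs.simple j) ^ m * t
          * (cs.simple j * cs.simple i) ^ m) * cs.simple j = cs.simple i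
        ↔ t = (cs.simple j * cs.simple i) ^ (2 * m + 1) * cs.simple j := by
      rw [show 2 * m + 1 = m + (1 + m) by ring, pow_add, pow_add, pow_one, mul_assoc
        ((cs.simple j * cs.simple i) ^ m), mul_assoc (cs.simple j * cs.simple i), ← hc, hb]
      generalize (cs.simple i * cs.simple j) ^ m = a
      constructor
      · intro h
        rw [← h]
        simp [mul_assoc]
      · intro h; rw [h]; simp [mul_assoc]
    simp only [flip, e1, e2]
    refine Prod.ext ?_ ?_
    · simp only [pow_succ', pow_succ (cs.simple j * cs.simple i), mul_assoc]
    · simp only [add_assoc]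

theorem flip_liftable : M.IsLiftable (flip cs) := by
  classical
  intro i j
  funext p
  obtain ⟨t, z⟩ := p
  rw [flip_pow]
  have h1 := cs.simple_mul_simple_pow i j
  have h2 := cs.simple_mul_simple_pow j i
  rw [M.symmetric] at h2
  rw [h1, h2, two_mul, Finset.sum_range_add]
  simp only [pow_add, h2, one_mul, mul_one]
  rw [CharTwo.add_self_eq_zero]
  simp [end_one_apply]

/-- The resulting action of the whole group. -/
noncomputable def flipHom : W →* Function.End (W × ZMod 2) := cs.lift ⟨flip cs, flip_liftable cs⟩

open Classical in
theorem flipHom_wordProd (ω : List B) (t : W) (z : ZMod 2) :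
    flipHom cs (cs.wordProd ω) (t, z)
      = (cs.wordProd ω * t * (cs.wordProd ω)⁻¹, z + ((cs.rightInvSeq ω).count t : ℕ)) := by
  induction ω with
  | nil => simp [end_one_apply, CoxeterSystem.wordProd, CoxeterSystem.rightInvSeq]
  | cons i ω ih =>
    rw [cs.wordProd_cons, map_mul, end_mul_apply, ih]
    have : flipHom cs (cs.simple i) = flip cs i := cs.lift_apply_simple (flip_liftable cs) i
    rw [this]
    simp only [flip]
    refine Prod.ext ?_ ?_
    · simp [mul_assoc]
    · simp only [CoxeterSystem.rightInvSeq, List.count_cons, beq_iff_eq]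
      have e : (cs.wordProd ω * t * (cs.wordProd ω)⁻¹ = cs.simple i)
          ↔ (cs.wordProd ω)⁻¹ * cs.simple i * cs.wordProd ω = t := by
        constructor
        · intro h; rw [← h]; group
        · intro h; rw [← h]; group
      rw [add_assoc]
      by_cases h : (cs.wordProd ω)⁻¹ * cs.simple i * cs.wordProd ω = t
      · rw [if_pos (e.2 h), if_pos h]; push_cast; rfl
      · rw [if_neg (fun h' => h (e.1 h')), if_neg h]; push_cast; rfl

theorem mem_rightInvSeq_of_isRightDescent {ω : List B} {i : B}
    (hi : cs.IsRightDescent (cs.wordProd ω) i) : cs.simple i ∈ cs.rightInvSeq ω := by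
  classical
  by_contra hmem
  obtain ⟨τ, hτ, hw⟩ := cs.exists_isReduced (cs.wordProd ω * cs.simple i)
  have hprod : cs.wordProd (τ.concat i) = cs.wordProd ω := by
    rw [cs.wordProd_concat, ← hw]; simp
  have hred : cs.IsReduced (τ.concat i) := by
    have h1 := cs.isRightDescent_iff.1 hi
    rw [CoxeterSystem.IsReduced, hprod, ← h1, hw, hτ.eq]; simp
  have hnd := hred.nodup_rightInvSeq
  have hin : cs.simple i ∈ cs.rightInvSeq (τ.concat i) := by
    rw [cs.rightInvSeq_concat]; simp
  have h1 := flipHom_wordProd cs ω (cs.simple i) 0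
  have h2 := flipHom_wordProd cs (τ.concat i) (cs.simple i) 0
  rw [hprod, h1, List.count_eq_zero_of_not_mem hmem, List.count_eq_one_of_mem hnd hin] at h2
  have := (Prod.ext_iff.1 h2).2
  simp at this

/-- The exchange property. -/
theorem exchange {ω : List B} {i : B} (hi : cs.IsRightDescent (cs.wordProd ω) i) :
    ∃ j < ω.length, cs.wordProd ω * cs.simple i = cs.wordProd (ω.eraseIdx j) := by
  obtain ⟨j, hj, h⟩ := List.mem_iff_getElem.1 (mem_rightInvSeq_of_isRightDescent cs hi)
  rw [cs.length_rightInvSeq] at hj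
  refine ⟨j, hj, ?_⟩
  rw [← cs.wordProd_mul_getD_rightInvSeq ω j, List.getD_eq_getElem _ _ (by simpa using hj), h]

/-- If left multiplication by `s i` and right multiplication by `s j` both increase the length of
`w` but together they do not, then they agree on `w`. -/
theorem simple_mul_eq_mul_simple {w : W} {i j : B} (hi : ¬ cs.IsLeftDescent w i)
    (hj : ¬ cs.IsRightDescent w j)
    (h : cs.IsRightDescent (cs.simple i * w) j) :
    cs.simple i * w = w * cs.simple j := by
  obtain ⟨ω, hω, rfl⟩ := cs.exists_isReduced w
  rw [← cs.wordProd_cons] at h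
  obtain ⟨l, hl, he⟩ := exchange cs h
  cases l with
  | zero =>
    rw [cs.wordProd_cons] at he
    simp only [List.eraseIdx_zero, List.tail_cons] at he
    calc _ = (cs.simple i * cs.wordProd ω * cs.simple j) * cs.simple j := by simp
      _ = _ := by rw [he]
  | succ l =>
    exfalso
    simp only [List.eraseIdx_cons_succ, cs.wordProd_cons, mul_assoc] at he
    have he' := mul_left_cancel he
    apply hj
    rw [CoxeterSystem.IsRightDescent, he', hω.eq]
    refine (cs.length_wordProd_le _).trans_lt ?_
    simp only [List.length_cons] at hl
    rw [List.length_eraseIdx_of_lt (by omega)]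
    omega

/-- Exchange for a product with a distinguished final part `τ`. -/
theorem exchange_suffix (u : W) (τ : List B) {j : B}
    (h : cs.IsRightDescent (u * cs.wordProd τ) j) :
    (∃ l < τ.length, u * cs.wordProd τ * cs.simple j = u * cs.wordProd (τ.eraseIdx l)) ∨
      ∃ v, cs.length v < cs.length u ∧ u * cs.wordProd τ * cs.simple j = v * cs.wordProd τ := by
  obtain ⟨ν, hν, rfl⟩ := cs.exists_isReduced u
  rw [← cs.wordProd_append] at h
  obtain ⟨l, hl, he⟩ := exchange cs h
  rw [cs.wordProd_append] at he
  by_cases hlt : l < ν.length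
  · refine Or.inr ⟨cs.wordProd (ν.eraseIdx l), ?_, ?_⟩
    · rw [hν.eq]
      refine (cs.length_wordProd_le _).trans_lt ?_
      rw [List.length_eraseIdx_of_lt hlt]
      omega
    · rw [he, List.eraseIdx_append_of_lt_length hlt, cs.wordProd_append]
  · refine Or.inl ⟨l - ν.length, ?_, ?_⟩
    · rw [List.length_append] at hl; omega
    · rw [he, List.eraseIdx_append_of_length_le (by omega), cs.wordProd_append]

theorem two_descents_comm {w : W} {i j : B} (hi : cs.IsRightDescent w i)
    (hj : cs.IsRightDescent w j) (hne : cs.simple i ≠ cs.simple j) :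
    ∃ v, w = v * cs.simple i * cs.simple j ∧ cs.length w = cs.length v + 2 := by
  have h : cs.IsRightDescent (w * cs.simple i * cs.wordProd [i]) j := by
    simpa [CoxeterSystem.wordProd] using hj
  rcases exchange_suffix cs _ _ h with ⟨l, hl, he⟩ | ⟨v, hv, he⟩
  · exfalso
    have : l = 0 := by simpa using hl
    subst this
    simp [CoxeterSystem.wordProd] at he
    exact hne he.symm
  · simp [CoxeterSystem.wordProd] at he
    refine ⟨v, by rw [← he]; simp, ?_⟩
    have h1 := cs.isRightDescent_iff.1 hi
    have h2 := cs.length_mul_le v (cs.simple i)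
    rw [← he, cs.length_simple] at h2
    have h3 := cs.isRightDescent_iff.1 hj
    omega

theorem two_descents_braid {w : W} {i j : B} (hi : cs.IsRightDescent w i)
    (hj : cs.IsRightDescent w j) (hne : cs.simple i ≠ cs.simple j)
    (hnc : cs.simple i * cs.simple j ≠ cs.simple j * cs.simple i) :
    ∃ v, w = v * cs.simple i * cs.simple j * cs.simple i ∧ cs.length w = cs.length v + 3 := by
  obtain ⟨v, hw, hl⟩ := two_descents_comm cs hi hj hne
  have h : cs.IsRightDescent (v * cs.wordProd [i, j]) i := by
    simpa [CoxeterSystem.wordProd, ← mul_assoc, ← hw] using hi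
  rcases exchange_suffix cs _ _ h with ⟨l, hl, he⟩ | ⟨v', hv, he⟩
  · exfalso
    have : l = 0 ∨ l = 1 := by simp at hl; omega
    rcases this with rfl | rfl
    · simp [CoxeterSystem.wordProd, mul_assoc] at he
      apply hnc
      calc _ = (cs.simple i * (cs.simple j * cs.simple i)) * cs.simple i := by simp [mul_assoc]
        _ = _ := by rw [he]
    · simp [CoxeterSystem.wordProd, mul_assoc] at he
      apply hne
      calc cs.simple i = cs.simple j * (cs.simple j * cs.simple i) := by simp
        _ = _ := by rw [he]; simp
  · refine ⟨v', ?_, ?_⟩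
    · simp [CoxeterSystem.wordProd, ← mul_assoc] at he
      rw [← he, hw]; simp
    · have h1 := cs.isRightDescent_iff.1 hi
      have h2 := cs.length_mul_le v' (cs.wordProd [i, j])
      have h3 := cs.length_wordProd_le [i, j]
      rw [← he] at h2
      simp [CoxeterSystem.wordProd, ← mul_assoc, ← hw] at h2 h3
      omega

theorem simple_comm_of_eq_two {i j : B} (h : M i j = 2) :
    cs.simple i * cs.simple j = cs.simple j * cs.simple i := by
  have := cs.simple_mul_simple_pow i j
  rw [h, pow_two] at this
  calc _ = (cs.simple i * cs.simple j * (cs.simple i * cs.simple j))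
        * (cs.simple j * cs.simple i) := by simp [mul_assoc]
    _ = _ := by rw [this, one_mul]

theorem simple_braid_of_eq_three {i j : B} (h : M i j = 3) :
    cs.simple i * cs.simple j * cs.simple i = cs.simple j * cs.simple i * cs.simple j := by
  have := cs.simple_mul_simple_pow i j
  rw [h, pow_succ, pow_two] at this
  calc _ = (cs.simple i * cs.simple j * (cs.simple i * cs.simple j)
        * (cs.simple i * cs.simple j))
        * (cs.simple j * cs.simple i * cs.simple j) := by simp [mul_assoc]
    _ = _ := by rw [this, one_mul]

/-- Two reduced words of the same element have the same image under any assignment that respects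
the braid relations of order two and three, provided that no element has two descents whose
product has any other order. -/
theorem prod_eq_of_isReduced {N : Type*} [Monoid N] (f : B → N)
    (h2 : ∀ i j, i ≠ j → M i j = 2 → f i * f j = f j * f i)
    (h3 : ∀ i j, i ≠ j → M i j = 3 → f i * f j * f i = f j * f i * f j)
    (hne : ∀ i j, i ≠ j → cs.simple i ≠ cs.simple j)
    (hnc : ∀ i j, M i j = 3 → cs.simple i * cs.simple j ≠ cs.simple j * cs.simple i)
    (hM : ∀ i j, i ≠ j → M i j = 2 ∨ M i j = 3 ∨
      ∀ w, cs.IsRightDescent w i → ¬ cs.IsRightDescent w j)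
    (n : ℕ) : ∀ ω ω' : List B, ω.length = n → cs.IsReduced ω → cs.IsReduced ω' →
      cs.wordProd ω = cs.wordProd ω' → (ω.map f).prod = (ω'.map f).prod := by
  induction n with
  | zero =>
    intro ω ω' hl hr hr' he
    have : ω'.length = 0 := by rw [← hr'.eq, ← he, hr.eq, hl]
    rw [List.length_eq_zero_iff.1 hl, List.length_eq_zero_iff.1 this]
  | succ n ih =>
    intro ω ω' hl hr hr' he
    have hl' : ω'.length = n + 1 := by rw [← hr'.eq, ← he, hr.eq, hl]
    obtain rfl | ⟨τ, i, rfl⟩ := ω.eq_nil_or_concat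
    · simp at hl
    obtain rfl | ⟨τ', j, rfl⟩ := ω'.eq_nil_or_concat
    · simp at hl'
    rw [List.concat_eq_append] at hl hl' hr hr' he
    rw [List.concat_eq_append, List.concat_eq_append]
    have hwl : cs.length (cs.wordProd (τ ++ [i])) = n + 1 := by rw [hr.eq, hl]
    simp only [List.length_append, List.length_cons, List.length_nil] at hl hl'
    have hτ : cs.IsReduced τ := by simpa using hr.take τ.length
    have hτ' : cs.IsReduced τ' := by simpa using hr'.take τ'.length
    have e1 : cs.wordProd τ = cs.wordProd (τ ++ [i]) * cs.simple i := by
      simp [cs.wordProd_append]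
    have e2 : cs.wordProd τ' = cs.wordProd (τ ++ [i]) * cs.simple j := by
      rw [he]; simp [cs.wordProd_append]
    have hdi : cs.IsRightDescent (cs.wordProd (τ ++ [i])) i := by
      rw [CoxeterSystem.IsRightDescent, ← e1, hτ.eq, hwl]; omega
    have hdj : cs.IsRightDescent (cs.wordProd (τ ++ [i])) j := by
      rw [CoxeterSystem.IsRightDescent, ← e2, hτ'.eq, hwl]; omega
    simp only [List.map_append, List.map_cons, List.map_nil, List.prod_append, List.prod_cons,
      List.prod_nil, mul_one]
    by_cases hij : i = j
    · subst hij
      rw [ih τ τ' (by omega) hτ hτ' (by rw [e1, e2])]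
    generalize cs.wordProd (τ ++ [i]) = w at *
    rcases hM i j hij with hm | hm | hm
    · obtain ⟨v, hv, hvl⟩ := two_descents_comm cs hdi hdj (hne i j hij)
      obtain ⟨ν, hν, rfl⟩ := cs.exists_isReduced v
      rw [hν.eq] at hvl
      have hc := simple_comm_of_eq_two cs hm
      have p1 : cs.wordProd (ν ++ [j]) = cs.wordProd τ := by
        rw [e1, hv, mul_assoc (cs.wordProd ν), hc]; simp [cs.wordProd_append, mul_assoc]
      have p2 : cs.wordProd (ν ++ [i]) = cs.wordProd τ' := by
        rw [e2, hv]; simp [cs.wordProd_append, mul_assoc]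
      have r1 : cs.IsReduced (ν ++ [j]) := by
        rw [CoxeterSystem.IsReduced, p1, hτ.eq]; simp; omega
      have r2 : cs.IsReduced (ν ++ [i]) := by
        rw [CoxeterSystem.IsReduced, p2, hτ'.eq]; simp; omega
      rw [ih τ _ (by omega) hτ r1 p1.symm, ih τ' _ (by omega) hτ' r2 p2.symm]
      simp [mul_assoc, h2 i j hij hm]
    · obtain ⟨v, hv, hvl⟩ := two_descents_braid cs hdi hdj (hne i j hij) (hnc i j hm)
      obtain ⟨ν, hν, rfl⟩ := cs.exists_isReduced v
      rw [hν.eq] at hvl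
      have hc := simple_braid_of_eq_three cs hm
      have p1 : cs.wordProd (ν ++ [i, j]) = cs.wordProd τ := by
        rw [e1, hv]; simp [cs.wordProd_append, cs.wordProd_cons, mul_assoc]
      have p2 : cs.wordProd (ν ++ [j, i]) = cs.wordProd τ' := by
        rw [e2, hv, mul_assoc (cs.wordProd ν), mul_assoc (cs.wordProd ν), hc]
        simp [cs.wordProd_append, cs.wordProd_cons, mul_assoc]
      have r1 : cs.IsReduced (ν ++ [i, j]) := by
        rw [CoxeterSystem.IsReduced, p1, hτ.eq]; simp; omega
      have r2 : cs.IsReduced (ν ++ [j, i]) := by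
        rw [CoxeterSystem.IsReduced, p2, hτ'.eq]; simp; omega
      rw [ih τ _ (by omega) hτ r1 p1.symm, ih τ' _ (by omega) hτ' r2 p2.symm]
      have := h3 i j hij hm
      simp only [mul_assoc] at this
      simp [mul_assoc, this]
    · exact absurd hdj (hm w hdi)

end Exchange

section Operators

variable {B W : Type*} [Group W] {M : CoxeterMatrix B} (cs : CoxeterSystem M W)

open Classical in
/-- Left multiplication by the generator `A i`, on the free module with basis `A u`:
`A i * A u` is `A (s i * u)` if this is longer than `u`, and `- A u` if it is shorter. -/
noncomputable def leftOp (i : B) : Module.End ℤ (W →₀ ℤ) :=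
  Finsupp.linearCombination ℤ fun u =>
    if cs.IsLeftDescent u i then -Finsupp.single u 1 else Finsupp.single (cs.simple i * u) 1

open Classical in
/-- Right multiplication by the generator `A j`, on the free module with basis `A u`. -/
noncomputable def rightOp (j : B) : Module.End ℤ (W →₀ ℤ) :=
  Finsupp.linearCombination ℤ fun u =>
    if cs.IsRightDescent u j then -Finsupp.single u 1 else Finsupp.single (u * cs.simple j) 1

open Classical in
theorem leftOp_single (i : B) (u : W) : leftOp cs i (Finsupp.single u 1) =
    if cs.IsLeftDescent u i then -Finsupp.single u 1 else Finsupp.single (cs.simple i * u) 1 := by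
  simp [leftOp]

open Classical in
theorem rightOp_single (j : B) (u : W) : rightOp cs j (Finsupp.single u 1) =
    if cs.IsRightDescent u j then -Finsupp.single u 1
      else Finsupp.single (u * cs.simple j) 1 := by
  simp [rightOp]

theorem leftOp_mul_self (i : B) : leftOp cs i * leftOp cs i = -leftOp cs i := by
  ext1 u
  ext1
  simp only [LinearMap.comp_apply, Module.End.mul_apply, Finsupp.lsingle_apply,
    LinearMap.neg_apply, leftOp_single]
  by_cases h : cs.IsLeftDescent u i
  · simp [h, leftOp_single]
  · have h' := cs.isLeftDescent_iff_not_isLeftDescent_mul.not_left.1 h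
    simp [h, h', leftOp_single]

theorem leftOp_mul_rightOp (i j : B) :
    leftOp cs i * rightOp cs j = rightOp cs j * leftOp cs i := by
  ext1 u
  ext1
  simp only [LinearMap.comp_apply, Module.End.mul_apply, Finsupp.lsingle_apply, leftOp_single,
    rightOp_single]
  by_cases hL : cs.IsLeftDescent u i <;> by_cases hR : cs.IsRightDescent u j
  · simp [hL, hR, leftOp_single, rightOp_single]
  · have hy : cs.IsLeftDescent (u * cs.simple j) i := by
      have h1 := cs.isLeftDescent_iff.1 hL
      have h2 := cs.not_isRightDescent_iff.1 hR
      have h3 := cs.length_mul_le (cs.simple i * u) (cs.simple j)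
      rw [cs.length_simple] at h3
      rw [CoxeterSystem.IsLeftDescent, ← mul_assoc]
      omega
    simp [hL, hR, hy, leftOp_single, rightOp_single]
  · have hx : cs.IsRightDescent (cs.simple i * u) j := by
      have h1 := cs.not_isLeftDescent_iff.1 hL
      have h2 := cs.isRightDescent_iff.1 hR
      have h3 := cs.length_mul_le (cs.simple i) (u * cs.simple j)
      rw [cs.length_simple] at h3
      rw [CoxeterSystem.IsRightDescent, mul_assoc]
      omega
    simp [hL, hR, hx, leftOp_single, rightOp_single]
  · have h1 := cs.not_isLeftDescent_iff.1 hL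
    have h2 := cs.not_isRightDescent_iff.1 hR
    by_cases hx : cs.IsRightDescent (cs.simple i * u) j
    · have he := simple_mul_eq_mul_simple cs hL hR hx
      have hy : cs.IsLeftDescent (u * cs.simple j) i := by
        rw [CoxeterSystem.IsRightDescent, mul_assoc] at hx
        rw [CoxeterSystem.IsLeftDescent]; omega
      simp [hL, hR, hy, he, leftOp_single, rightOp_single]
      rw [← he]; simp [hx]
    · have hy : ¬ cs.IsLeftDescent (u * cs.simple j) i := by
        rw [CoxeterSystem.IsRightDescent, mul_assoc] at hx
        rw [CoxeterSystem.IsLeftDescent]; omega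
      simp [hL, hR, hx, hy, leftOp_single, rightOp_single, mul_assoc]

theorem eq_of_comm_rightOp {P Q : Module.End ℤ (W →₀ ℤ)}
    (hP : ∀ j, P * rightOp cs j = rightOp cs j * P)
    (hQ : ∀ j, Q * rightOp cs j = rightOp cs j * Q)
    (h : P (Finsupp.single 1 1) = Q (Finsupp.single 1 1)) : P = Q := by
  suffices H : ∀ n, ∀ u, cs.length u = n → P (Finsupp.single u 1) = Q (Finsupp.single u 1) by
    ext1 u
    ext1
    exact H _ u rfl
  intro n
  induction n with
  | zero => intro u hu; rw [cs.length_eq_zero_iff.1 hu]; exact h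
  | succ n ih =>
    intro u hu
    have hu1 : u ≠ 1 := by rintro rfl; simp at hu
    obtain ⟨j, hj⟩ := cs.exists_rightDescent_of_ne_one hu1
    have hl := cs.isRightDescent_iff.1 hj
    have hr : Finsupp.single u (1 : ℤ) = rightOp cs j (Finsupp.single (u * cs.simple j) 1) := by
      rw [rightOp_single, if_neg (cs.isRightDescent_iff_not_isRightDescent_mul.1 hj)]
      simp
    rw [hr, ← Module.End.mul_apply, hP, ← Module.End.mul_apply, hQ, Module.End.mul_apply,
      ih _ (by omega), Module.End.mul_apply]

/-- A reduced word acts on the class of the identity by giving the element it represents. -/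
theorem prod_leftOp_single {ω : List B} (hω : cs.IsReduced ω) :
    (ω.map (leftOp cs)).prod (Finsupp.single 1 1) = Finsupp.single (cs.wordProd ω) 1 := by
  induction ω with
  | nil => simp [CoxeterSystem.wordProd]
  | cons i ω ih =>
    have hr : cs.IsReduced ω := by simpa using hω.drop 1
    have hd : ¬ cs.IsLeftDescent (cs.wordProd ω) i := by
      rw [cs.not_isLeftDescent_iff, ← cs.wordProd_cons, hω.eq, hr.eq]; simp
    simp [ih hr, leftOp_single, hd, cs.wordProd_cons]

theorem isReduced_pair {i j : B} (h : cs.simple i ≠ cs.simple j) : cs.IsReduced [i, j] := by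
  rcases cs.length_simple_mul (cs.simple j) i with h' | h'
  · rw [cs.length_simple] at h'
    simpa [CoxeterSystem.IsReduced, CoxeterSystem.wordProd] using h'
  · rw [cs.length_simple] at h'
    have := cs.length_eq_zero_iff.1 (by omega : cs.length (cs.simple i * cs.simple j) = 0)
    exfalso; apply h
    calc cs.simple i = cs.simple i * cs.simple j * cs.simple j := by simp
      _ = _ := by rw [this, one_mul]

theorem isReduced_triple {i j : B} (h : cs.simple i ≠ cs.simple j)
    (hc : cs.simple i * cs.simple j ≠ cs.simple j * cs.simple i) : cs.IsReduced [i, j, i] := by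
  have h1 := isReduced_pair cs h
  have h2 := isReduced_pair cs h.symm
  have hij : cs.length (cs.simple i * cs.simple j) = 2 := by
    simpa [CoxeterSystem.IsReduced, CoxeterSystem.wordProd] using h1
  have hji : cs.length (cs.simple j * cs.simple i) = 2 := by
    simpa [CoxeterSystem.IsReduced, CoxeterSystem.wordProd] using h2
  have hL : ¬ cs.IsLeftDescent (cs.simple j) i := by
    rw [cs.not_isLeftDescent_iff, hij, cs.length_simple]
  have hR : ¬ cs.IsRightDescent (cs.simple j) i := by
    rw [cs.not_isRightDescent_iff, hji, cs.length_simple]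
  have hx : ¬ cs.IsRightDescent (cs.simple i * cs.simple j) i :=
    fun hx => hc (simple_mul_eq_mul_simple cs hL hR hx)
  rw [cs.not_isRightDescent_iff, hij] at hx
  simpa [CoxeterSystem.IsReduced, CoxeterSystem.wordProd, mul_assoc] using hx

theorem prod_leftOp_eq {ω ω' : List B} (h : cs.IsReduced ω) (h' : cs.IsReduced ω')
    (he : cs.wordProd ω = cs.wordProd ω') :
    (ω.map (leftOp cs)).prod = (ω'.map (leftOp cs)).prod := by
  have key : ∀ τ : List B, ∀ j, (τ.map (leftOp cs)).prod * rightOp cs j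
      = rightOp cs j * (τ.map (leftOp cs)).prod := by
    intro τ j
    induction τ with
    | nil => simp
    | cons i τ ih =>
      rw [List.map_cons, List.prod_cons, mul_assoc, ih, ← mul_assoc, leftOp_mul_rightOp, mul_assoc]
  refine eq_of_comm_rightOp cs (key ω) (key ω') ?_
  rw [prod_leftOp_single cs h, prod_leftOp_single cs h', he]

end Operators

section AffineWeyl

/-- The Coxeter matrix of affine type `A` on the cyclically ordered generators `ZMod (k + 1)`:
cyclically adjacent generators have order `3` (or `∞`, encoded as `0`, when there are just two
generators), and distinct non-adjacent generators commute. -/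
def affineMatrix (k : ℕ) : CoxeterMatrix (ZMod (k + 1)) where
  M := Matrix.of fun i j =>
    if i = j then 1 else if j = i + 1 ∨ i = j + 1 then (if k = 1 then 0 else 3) else 2
  isSymm := by
    ext i j
    simp only [Matrix.transpose_apply, Matrix.of_apply, eq_comm (a := j) (b := i),
      or_comm (a := i = j + 1)]
  diagonal i := by simp
  off_diagonal i j h := by
    simp only [Matrix.of_apply, if_neg h]
    split_ifs <;> simp

/-- The affine symmetric group on `k + 1` letters: the affine Weyl group of type `A`. -/
abbrev AffineSymm (k : ℕ) : Type := (affineMatrix k).Group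

/-- The affine symmetric group with its simple reflections. -/
abbrev affineSystem (k : ℕ) : CoxeterSystem (affineMatrix k) (AffineSymm k) :=
  (affineMatrix k).toCoxeterSystem

theorem affineMatrix_apply (k : ℕ) (i j : ZMod (k + 1)) : affineMatrix k i j =
    if i = j then 1 else if j = i + 1 ∨ i = j + 1 then (if k = 1 then 0 else 3) else 2 := rfl

theorem affineMatrix_eq_two {k : ℕ} {i j : ZMod (k + 1)} (h : affineMatrix k i j = 2) :
    i ≠ j ∧ j ≠ i + 1 ∧ i ≠ j + 1 := by
  rw [affineMatrix_apply] at h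
  refine ⟨?_, ?_, ?_⟩ <;> intro h' <;> split_ifs at h <;> simp_all

theorem affineMatrix_eq_three {k : ℕ} {i j : ZMod (k + 1)} (h : affineMatrix k i j = 3) :
    2 ≤ k ∧ (j = i + 1 ∨ i = j + 1) := by
  rw [affineMatrix_apply] at h
  by_cases h1 : i = j
  · simp [h1] at h
  by_cases h2 : j = i + 1 ∨ i = j + 1
  · refine ⟨?_, h2⟩
    by_cases h3 : k = 1
    · simp [h1, h2, h3] at h
    · by_contra hc
      have : k = 0 := by omega
      subst this
      exact h1 (Subsingleton.elim (α := Fin 1) i j)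
  · simp [h1, h2] at h

theorem one_ne_zero_zmod {k : ℕ} (hk : 1 ≤ k) : (1 : ZMod (k + 1)) ≠ 0 := by
  have : Fact (1 < k + 1) := ⟨by omega⟩
  exact one_ne_zero

theorem two_ne_zero_zmod {k : ℕ} (hk : 2 ≤ k) : (1 + 1 : ZMod (k + 1)) ≠ 0 := by
  intro h
  have h' : ((2 : ℕ) : ZMod (k + 1)) = 0 := by push_cast; rw [← one_add_one_eq_two]; exact h
  rw [ZMod.natCast_eq_zero_iff] at h'
  have := Nat.le_of_dvd (by omega) h'
  omega

theorem swap_braid {k : ℕ} (hk : 2 ≤ k) (i : ZMod (k + 1)) :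
    Equiv.swap i (i + 1) * Equiv.swap (i + 1) (i + 1 + 1) * Equiv.swap i (i + 1)
      = Equiv.swap (i + 1) (i + 1 + 1) * Equiv.swap i (i + 1)
        * Equiv.swap (i + 1) (i + 1 + 1) := by
  have h1 : i ≠ i + 1 := by simpa using (one_ne_zero_zmod (by omega : 1 ≤ k))
  have h2 : i ≠ i + 1 + 1 := by
    rw [add_assoc]; simpa using (two_ne_zero_zmod hk)
  have h3 : i + 1 ≠ i + 1 + 1 := by simpa using (one_ne_zero_zmod (by omega : 1 ≤ k))
  rw [Equiv.swap_mul_swap_mul_swap h1 h2,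
    Equiv.swap_comm i (i + 1), Equiv.swap_comm (i + 1) (i + 1 + 1),
    Equiv.swap_mul_swap_mul_swap h3.symm h2.symm, Equiv.swap_comm]

theorem swap_liftable {k : ℕ} (hk : 2 ≤ k) :
    (affineMatrix k).IsLiftable fun i => Equiv.swap i (i + 1) := by
  have key : ∀ i : ZMod (k + 1),
      (Equiv.swap i (i + 1) * Equiv.swap (i + 1) (i + 1 + 1)) ^ 3 = 1 := by
    intro i
    have hb := swap_braid hk i
    set a := Equiv.swap i (i + 1) with ha
    set b := Equiv.swap (i + 1) (i + 1 + 1) with hb'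
    have haa : a * a = 1 := Equiv.swap_mul_self _ _
    have hbb : b * b = 1 := Equiv.swap_mul_self _ _
    calc (a * b) ^ 3 = (a * b * a) * (b * a * b) := by
          simp only [pow_succ, pow_zero, one_mul, mul_assoc]
      _ = (a * b * a) * (a * b * a) := by rw [hb]
      _ = a * (b * ((a * a) * (b * a))) := by simp only [mul_assoc]
      _ = a * ((b * b) * a) := by rw [haa, one_mul, mul_assoc]
      _ = 1 := by rw [hbb, one_mul, haa]
  intro i j
  show (Equiv.swap i (i + 1) * Equiv.swap j (j + 1)) ^ (affineMatrix k i j) = 1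
  rw [affineMatrix_apply]
  split_ifs with h1 h2 h3
  · subst h1; simp
  · omega
  · rcases h2 with rfl | rfl
    · exact key i
    · have := congrArg (·⁻¹) (key j)
      simpa [← inv_pow] using this
  · push Not at h2
    have hd : Equiv.swap i (i + 1) * Equiv.swap j (j + 1)
        = Equiv.swap j (j + 1) * Equiv.swap i (i + 1) := by
      refine (Equiv.Perm.disjoint_swap_swap ?_).commute
      have := one_ne_zero_zmod (by omega : 1 ≤ k)
      simp [h1, h2.2, this, Ne.symm h2.1]
    rw [pow_two]
    nth_rewrite 2 [hd]
    simp [mul_assoc]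

theorem dihedral_liftable :
    (affineMatrix 1).IsLiftable fun i =>
      if i = 0 then (DihedralGroup.sr 0 : DihedralGroup 0) else DihedralGroup.sr 1 := by
  intro i j
  show ((if i = 0 then (DihedralGroup.sr 0 : DihedralGroup 0) else DihedralGroup.sr 1) *
    (if j = 0 then (DihedralGroup.sr 0 : DihedralGroup 0) else DihedralGroup.sr 1))
      ^ (affineMatrix 1 i j) = 1
  by_cases hij : i = j
  · subst hij
    split_ifs <;> simp
  · have : j = i + 1 := by revert i j; decide
    rw [affineMatrix_apply, if_neg hij, if_pos (Or.inl this), if_pos rfl, pow_zero]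

theorem simple_ne {k : ℕ} {i j : ZMod (k + 1)} (hij : i ≠ j) :
    (affineSystem k).simple i ≠ (affineSystem k).simple j := by
  intro h
  rcases Nat.lt_or_ge k 2 with hk | hk
  · have : k = 0 ∨ k = 1 := by omega
    rcases this with rfl | rfl
    · exact hij (Subsingleton.elim (α := Fin 1) i j)
    · have h' := congrArg ((affineSystem 1).lift ⟨_, dihedral_liftable⟩) h
      rw [(affineSystem 1).lift_apply_simple, (affineSystem 1).lift_apply_simple] at h'
      have e : (i = 0 ∧ j = 1) ∨ (i = 1 ∧ j = 0) := by clear * - hij; revert i j; decide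
      rcases e with ⟨rfl, rfl⟩ | ⟨rfl, rfl⟩ <;> simp at h'
  · have h' := congrArg ((affineSystem k).lift ⟨_, swap_liftable hk⟩) h
    rw [(affineSystem k).lift_apply_simple, (affineSystem k).lift_apply_simple] at h'
    have h1 := congrArg (fun e => e i) h'
    simp only [Equiv.swap_apply_left] at h1
    have hn : i + 1 ≠ i := by simpa using one_ne_zero_zmod (by omega : 1 ≤ k)
    have hji : i = j + 1 := by
      by_contra hc
      rw [Equiv.swap_apply_of_ne_of_ne hij hc] at h1
      exact hn h1
    subst hji
    rw [Equiv.swap_apply_right, add_assoc] at h1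
    exact two_ne_zero_zmod hk (by simpa using h1)

theorem simple_not_comm {k : ℕ} {i j : ZMod (k + 1)} (h : affineMatrix k i j = 3) :
    (affineSystem k).simple i * (affineSystem k).simple j
      ≠ (affineSystem k).simple j * (affineSystem k).simple i := by
  obtain ⟨hk, h2⟩ := affineMatrix_eq_three h
  have hn (l : ZMod (k + 1)) : l + 1 ≠ l := by
    simpa using one_ne_zero_zmod (by omega : 1 ≤ k)
  have hn2 (l : ZMod (k + 1)) : l + 1 + 1 ≠ l := by
    rw [add_assoc]; simpa using two_ne_zero_zmod hk
  have key (l : ZMod (k + 1)) : (affineSystem k).simple l * (affineSystem k).simple (l + 1)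
      ≠ (affineSystem k).simple (l + 1) * (affineSystem k).simple l := by
    intro he
    have h' := congrArg ((affineSystem k).lift ⟨_, swap_liftable hk⟩) he
    rw [map_mul, map_mul, (affineSystem k).lift_apply_simple,
      (affineSystem k).lift_apply_simple] at h'
    have h1 := congrArg (fun e => e l) h'
    simp only [Equiv.Perm.mul_apply, Equiv.swap_apply_left] at h1
    rw [Equiv.swap_apply_of_ne_of_ne (hn l).symm (hn2 l).symm, Equiv.swap_apply_left] at h1
    exact hn _ h1.symm
  rcases h2 with rfl | rfl
  · exact key i
  · exact (key j).symm

/-- The integer underlying an element of `ZMod 0`. -/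
def zint (c : ZMod 0) : ℤ := c

/-- In the infinite dihedral group no element has two right descents. -/
theorem dihedral_descents (w : AffineSymm 1) {i j : ZMod 2} (hij : i ≠ j)
    (hi : (affineSystem 1).IsRightDescent w i) : ¬ (affineSystem 1).IsRightDescent w j := by
  let D : ZMod 2 → DihedralGroup 0 → Prop := fun a x =>
    match x with
    | .r c => if a = 0 then zint c < 0 else 0 < zint c
    | .sr c => if a = 0 then zint c ≤ 0 else 0 < zint c
  let φ := (affineSystem 1).lift ⟨_, dihedral_liftable⟩
  have hφ (a) : φ ((affineSystem 1).simple a)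
      = if a = 0 then (DihedralGroup.sr 0 : DihedralGroup 0) else DihedralGroup.sr 1 :=
    (affineSystem 1).lift_apply_simple dihedral_liftable a
  have key : ∀ n, ∀ u : AffineSymm 1, (affineSystem 1).length u = n → ∀ a,
      (affineSystem 1).IsRightDescent u a → D a (φ u) := by
    intro n
    induction n with
    | zero =>
      intro u hu a ha
      rw [CoxeterSystem.IsRightDescent, hu] at ha
      omega
    | succ n ih =>
      intro u hu a ha
      have hl := (affineSystem 1).isRightDescent_iff.1 ha
      have hu' : φ u = φ (u * (affineSystem 1).simple a) * φ ((affineSystem 1).simple a) := by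
        rw [← map_mul, CoxeterSystem.simple_mul_simple_cancel_right]
      by_cases h1 : u * (affineSystem 1).simple a = 1
      · rw [hu', h1, hφ, map_one, one_mul]
        by_cases ha0 : a = 0
        · simp only [D, ha0, if_true]; exact le_refl (0 : ℤ)
        · simp only [D, ha0, if_false]; exact zero_lt_one (α := ℤ)
      · obtain ⟨b, hb⟩ := (affineSystem 1).exists_rightDescent_of_ne_one h1
        have hab : b ≠ a := by
          rintro rfl
          exact (affineSystem 1).isRightDescent_iff_not_isRightDescent_mul.1 ha hb
        have hD := ih _ (by omega) b hb
        rw [hu', hφ]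
        generalize φ (u * (affineSystem 1).simple a) = x at hD
        have e : (a = 0 ∧ b = 1) ∨ (a = 1 ∧ b = 0) := by
          clear * - hab; revert a b; decide
        rcases e with ⟨rfl, rfl⟩ | ⟨rfl, rfl⟩ <;> rcases x with c | c
        · have hc : 0 < zint c := hD
          show 0 - zint c ≤ 0
          omega
        · have hc : 0 < zint c := hD
          show 0 - zint c < 0
          omega
        · have hc : zint c < 0 := hD
          show 0 < 1 - zint c
          omega
        · have hc : zint c ≤ 0 := hD
          show 0 < 1 - zint c
          omega
  intro hj
  have k1 := key _ w rfl i hi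
  have k2 := key _ w rfl j hj
  generalize φ w = x at k1 k2
  have e : (i = 0 ∧ j = 1) ∨ (i = 1 ∧ j = 0) := by
    clear * - hij; revert i j; decide
  rcases e with ⟨rfl, rfl⟩ | ⟨rfl, rfl⟩ <;> rcases x with c | c
  · have h1 : zint c < 0 := k1
    have h2 : 0 < zint c := k2
    omega
  · have h1 : zint c ≤ 0 := k1
    have h2 : 0 < zint c := k2
    omega
  · have h1 : zint c < 0 := k2
    have h2 : 0 < zint c := k1
    omega
  · have h1 : zint c ≤ 0 := k2
    have h2 : 0 < zint c := k1
    omega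

theorem affine_cases {k : ℕ} {i j : ZMod (k + 1)} (hij : i ≠ j) :
    affineMatrix k i j = 2 ∨ affineMatrix k i j = 3 ∨
      ∀ w, (affineSystem k).IsRightDescent w i → ¬ (affineSystem k).IsRightDescent w j := by
  by_cases hk : k = 1
  · subst hk
    exact Or.inr (Or.inr fun w => dihedral_descents w hij)
  · rw [affineMatrix_apply, if_neg hij, if_neg hk]
    split_ifs <;> simp

end AffineWeyl

section NilHecke

/-- The defining relations of the nil Hecke algebra of affine type `A`; the braid relation between
cyclically adjacent generators is present when there are at least three generators. -/
inductive NilHeckeRel (k : ℕ) :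
    FreeAlgebra ℤ (ZMod (k + 1)) → FreeAlgebra ℤ (ZMod (k + 1)) → Prop
  | sq (i : ZMod (k + 1)) :
      NilHeckeRel k (FreeAlgebra.ι ℤ i * FreeAlgebra.ι ℤ i) (-FreeAlgebra.ι ℤ i)
  | comm (i j : ZMod (k + 1)) (hij : i ≠ j) (h : j ≠ i + 1) (h' : i ≠ j + 1) :
      NilHeckeRel k (FreeAlgebra.ι ℤ i * FreeAlgebra.ι ℤ j)
        (FreeAlgebra.ι ℤ j * FreeAlgebra.ι ℤ i)
  | braid (hk : 2 ≤ k) (i : ZMod (k + 1)) :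
      NilHeckeRel k
        (FreeAlgebra.ι ℤ i * FreeAlgebra.ι ℤ (i + 1) * FreeAlgebra.ι ℤ i)
        (FreeAlgebra.ι ℤ (i + 1) * FreeAlgebra.ι ℤ i * FreeAlgebra.ι ℤ (i + 1))

/-- The nil Hecke algebra over `ℤ` of the affine symmetric group on `k + 1` letters. -/
abbrev NilHecke (k : ℕ) : Type := RingQuot (NilHeckeRel k)

/-- The generators `A i` of the nil Hecke algebra. -/
def gen (k : ℕ) (i : ZMod (k + 1)) : NilHecke k :=
  RingQuot.mkAlgHom ℤ (NilHeckeRel k) (FreeAlgebra.ι ℤ i)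

/-- The element `A w`: the product of the generators along a reduced word of `w`. -/
noncomputable def basisElt (k : ℕ) (w : AffineSymm k) : NilHecke k :=
  (((affineSystem k).exists_isReduced w).choose.map (gen k)).prod

theorem gen_sq (k : ℕ) (i : ZMod (k + 1)) : gen k i * gen k i = -gen k i := by
  simpa [gen] using RingQuot.mkAlgHom_rel ℤ (NilHeckeRel.sq i)

theorem gen_comm {k : ℕ} {i j : ZMod (k + 1)} (hij : i ≠ j) (h : affineMatrix k i j = 2) :
    gen k i * gen k j = gen k j * gen k i := by
  have h2 := (affineMatrix_eq_two h).2
  simpa [gen] using RingQuot.mkAlgHom_rel ℤ (NilHeckeRel.comm i j hij h2.1 h2.2)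

theorem gen_braid {k : ℕ} {i j : ZMod (k + 1)} (h : affineMatrix k i j = 3) :
    gen k i * gen k j * gen k i = gen k j * gen k i * gen k j := by
  obtain ⟨hk, h2⟩ := affineMatrix_eq_three h
  have key (l : ZMod (k + 1)) :
      gen k l * gen k (l + 1) * gen k l = gen k (l + 1) * gen k l * gen k (l + 1) := by
    simpa [gen] using RingQuot.mkAlgHom_rel ℤ (NilHeckeRel.braid hk l)
  rcases h2 with rfl | rfl
  · exact key i
  · exact (key j).symm

/-- `A w` does not depend on the reduced word. -/
theorem basisElt_wordProd {k : ℕ} {ω : List (ZMod (k + 1))} (hω : (affineSystem k).IsReduced ω) :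
    basisElt k ((affineSystem k).wordProd ω) = (ω.map (gen k)).prod := by
  have h := ((affineSystem k).exists_isReduced ((affineSystem k).wordProd ω)).choose_spec
  exact prod_eq_of_isReduced (affineSystem k) (gen k) (fun _ _ => gen_comm) (fun _ _ _ => gen_braid)
    (fun _ _ => simple_ne) (fun _ _ => simple_not_comm) (fun _ _ => affine_cases) _ _ _ rfl
    h.1 hω h.2.symm

theorem basisElt_one (k : ℕ) : basisElt k 1 = 1 := by
  have h : (affineSystem k).IsReduced [] := by simp [CoxeterSystem.IsReduced]
  simpa using basisElt_wordProd h

/-- The multiplication rule in terms of the elements `A w`. -/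
theorem gen_mul_basisElt (k : ℕ) (i : ZMod (k + 1)) (u : AffineSymm k) :
    ((affineSystem k).length u < (affineSystem k).length ((affineSystem k).simple i * u) →
      gen k i * basisElt k u = basisElt k ((affineSystem k).simple i * u)) ∧
    ((affineSystem k).length ((affineSystem k).simple i * u) < (affineSystem k).length u →
      gen k i * basisElt k u = -basisElt k u) := by
  have up : ∀ u : AffineSymm k,
      (affineSystem k).length u < (affineSystem k).length ((affineSystem k).simple i * u) →
      gen k i * basisElt k u = basisElt k ((affineSystem k).simple i * u) := by
    intro u h
    obtain ⟨ω, hω, rfl⟩ := (affineSystem k).exists_isReduced u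
    have hr : (affineSystem k).IsReduced (i :: ω) := by
      rcases (affineSystem k).length_simple_mul ((affineSystem k).wordProd ω) i with h' | h'
      · rw [CoxeterSystem.IsReduced, CoxeterSystem.wordProd_cons, h', hω.eq]; simp
      · omega
    rw [← CoxeterSystem.wordProd_cons, basisElt_wordProd hω, basisElt_wordProd hr]
    simp
  refine ⟨up u, fun h => ?_⟩
  have h' := up ((affineSystem k).simple i * u)
    (by rwa [CoxeterSystem.simple_mul_simple_cancel_left])
  rw [CoxeterSystem.simple_mul_simple_cancel_left] at h'
  rw [← h', ← mul_assoc, gen_sq]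
  exact neg_mul (gen k i) (basisElt k _)

/-- The left regular action, written on the free module with basis indexed by the group. -/
noncomputable def action (k : ℕ) : NilHecke k →ₐ[ℤ] Module.End ℤ (AffineSymm k →₀ ℤ) :=
  RingQuot.liftAlgHom ℤ ⟨FreeAlgebra.lift ℤ (leftOp (affineSystem k)), by
    intro x y h
    cases h with
    | sq i => simp [leftOp_mul_self]
    | comm i j hij h h' =>
      simp only [map_mul, FreeAlgebra.lift_ι_apply]
      have hp := isReduced_pair (affineSystem k) (simple_ne hij)
      have hp' := isReduced_pair (affineSystem k) (simple_ne hij.symm)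
      have hm : affineMatrix k i j = 2 := by
        rw [affineMatrix_apply, if_neg hij, if_neg (by tauto)]
      have he : (affineSystem k).wordProd [i, j] = (affineSystem k).wordProd [j, i] := by
        simpa [CoxeterSystem.wordProd] using simple_comm_of_eq_two (affineSystem k) hm
      simpa using prod_leftOp_eq (affineSystem k) hp hp' he
    | braid hk i =>
      simp only [map_mul, FreeAlgebra.lift_ι_apply]
      have hi : i ≠ i + 1 := by simpa using one_ne_zero_zmod (by omega : 1 ≤ k)
      have hm : affineMatrix k i (i + 1) = 3 := by
        rw [affineMatrix_apply, if_neg hi, if_pos (Or.inl rfl), if_neg (by omega)]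
      have hp := isReduced_triple (affineSystem k) (simple_ne hi) (simple_not_comm hm)
      have hp' := isReduced_triple (affineSystem k) (simple_ne hi.symm) (simple_not_comm hm).symm
      have he : (affineSystem k).wordProd [i, i + 1, i]
          = (affineSystem k).wordProd [i + 1, i, i + 1] := by
        simpa [CoxeterSystem.wordProd, mul_assoc] using
          simple_braid_of_eq_three (affineSystem k) hm
      simpa [mul_assoc] using prod_leftOp_eq (affineSystem k) hp hp' he⟩

theorem action_gen (k : ℕ) (i : ZMod (k + 1)) :
    action k (gen k i) = leftOp (affineSystem k) i := by
  simp [action, gen]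

theorem action_basisElt (k : ℕ) (w : AffineSymm k) :
    action k (basisElt k w) (Finsupp.single 1 1) = Finsupp.single w 1 := by
  obtain ⟨ω, hω, rfl⟩ := (affineSystem k).exists_isReduced w
  rw [basisElt_wordProd hω, map_list_prod, List.map_map]
  have : (⇑(action k) ∘ gen k) = leftOp (affineSystem k) := funext (action_gen k)
  rw [this, prod_leftOp_single _ hω]

theorem linearIndependent_basisElt (k : ℕ) : LinearIndependent ℤ (basisElt k) := by
  have h : LinearIndependent ℤ fun w : AffineSymm k => Finsupp.single w (1 : ℤ) := by
    have := (Finsupp.basisSingleOne (R := ℤ) (ι := AffineSymm k)).linearIndependent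
    rwa [Finsupp.coe_basisSingleOne] at this
  refine LinearIndependent.of_comp
    ((LinearMap.applyₗ (Finsupp.single 1 1)).comp (action k).toLinearMap) ?_
  convert h using 1
  funext w
  exact action_basisElt k w

theorem span_basisElt (k : ℕ) : ⊤ ≤ Submodule.span ℤ (Set.range (basisElt k)) := by
  have hgen : ∀ i, ∀ y ∈ Submodule.span ℤ (Set.range (basisElt k)),
      gen k i * y ∈ Submodule.span ℤ (Set.range (basisElt k)) := by
    intro i y hy
    induction hy using Submodule.span_induction with
    | mem y hy =>
      obtain ⟨u, rfl⟩ := hy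
      rcases (affineSystem k).length_simple_mul u i with h | h
      · rw [(gen_mul_basisElt k i u).1 (by omega)]
        exact Submodule.subset_span ⟨_, rfl⟩
      · rw [(gen_mul_basisElt k i u).2 (by omega)]
        exact Submodule.neg_mem _ (Submodule.subset_span ⟨_, rfl⟩)
    | zero => simp
    | add x y _ _ hx hy => rw [mul_add]; exact Submodule.add_mem _ hx hy
    | smul a x _ hx => rw [mul_smul_comm]; exact Submodule.smul_mem _ _ hx
  have hall : ∀ a : FreeAlgebra ℤ (ZMod (k + 1)),
      ∀ y ∈ Submodule.span ℤ (Set.range (basisElt k)),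
        RingQuot.mkAlgHom ℤ (NilHeckeRel k) a * y
          ∈ Submodule.span ℤ (Set.range (basisElt k)) := by
    intro a
    induction a using FreeAlgebra.induction with
    | grade0 r =>
      intro y hy
      rw [AlgHom.commutes, ← Algebra.smul_def]
      exact Submodule.smul_mem _ _ hy
    | grade1 i => exact hgen i
    | mul a b ha hb => intro y hy; rw [map_mul, mul_assoc]; exact ha _ (hb _ hy)
    | add a b ha hb =>
      intro y hy; rw [map_add, add_mul]; exact Submodule.add_mem _ (ha _ hy) (hb _ hy)
  intro x _
  obtain ⟨a, rfl⟩ := RingQuot.mkAlgHom_surjective ℤ (NilHeckeRel k) x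
  have h1 : (1 : NilHecke k) ∈ Submodule.span ℤ (Set.range (basisElt k)) := by
    rw [← basisElt_one]; exact Submodule.subset_span ⟨_, rfl⟩
  simpa using hall a 1 h1

/-- The basis `A w` of the nil Hecke algebra. -/
noncomputable def nilHeckeBasis (k : ℕ) : Module.Basis (AffineSymm k) ℤ (NilHecke k) :=
  Module.Basis.mk (linearIndependent_basisElt k) (span_basisElt k)

theorem nilHeckeBasis_apply (k : ℕ) (w : AffineSymm k) : nilHeckeBasis k w = basisElt k w := by
  simp [nilHeckeBasis]

end NilHecke

section Cores

/-- The residue `j - i` modulo `k + 1` of the cell in row `i` and column `j`. -/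
def residue (k : ℕ) (c : ℕ × ℕ) : ZMod (k + 1) := (c.2 : ZMod (k + 1)) - (c.1 : ZMod (k + 1))

/-- The hook length of a cell `c` of `γ`: the cells of the row of `c` weakly beyond `c` together
with the cells of its column weakly beyond `c`. -/
def hookLength (γ : YoungDiagram) (c : ℕ × ℕ) : ℕ :=
  (γ.rowLen c.1 - c.2) + (γ.colLen c.2 - c.1) - 1

/-- A `p`-core is a shape without cells of hook length `p`. -/
def IsCore (p : ℕ) (γ : YoungDiagram) : Prop := ∀ c ∈ γ, hookLength γ c ≠ p

/-- Removable corners. -/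
def IsRemovable (γ : YoungDiagram) (c : ℕ × ℕ) : Prop :=
  c ∈ γ ∧ (c.1, c.2 + 1) ∉ γ ∧ (c.1 + 1, c.2) ∉ γ

/-- Addable corners (the cells outside the quadrant count as present). -/
def IsAddable (γ : YoungDiagram) (c : ℕ × ℕ) : Prop :=
  c ∉ γ ∧ (c.1 = 0 ∨ (c.1 - 1, c.2) ∈ γ) ∧ (c.2 = 0 ∨ (c.1, c.2 - 1) ∈ γ)

instance (γ : YoungDiagram) (c : ℕ × ℕ) : Decidable (IsAddable γ c) := by
  unfold IsAddable; infer_instance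

/-- The number of cells of hook length at most `k` in each row of `γ`. On `(k + 1)`-cores this is
the bijection onto `k`-bounded partitions. -/
def boundedRows (k : ℕ) (γ : YoungDiagram) (i : ℕ) : ℕ :=
  ((Finset.range (γ.rowLen i)).filter fun j => hookLength γ (i, j) ≤ k).card

/-- The `(k + 1)`-core corresponding to a `k`-bounded partition: the inverse of `boundedRows`. -/
noncomputable def coreOf (k : ℕ) (lam : YoungDiagram) : YoungDiagram :=
  Function.invFunOn (boundedRows k) {γ | IsCore (k + 1) γ} lam.rowLen

/-- The shape obtained from `γ` by adding all its addable corners of residue `i`. -/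
def addCorners (k : ℕ) (i : ZMod (k + 1)) (γ : YoungDiagram) : YoungDiagram where
  cells := γ.cells ∪
    (Finset.range (γ.colLen 0 + 1) ×ˢ Finset.range (γ.rowLen 0 + 1)).filter
      fun c => IsAddable γ c ∧ residue k c = i
  isLowerSet := by
    rintro ⟨a, b⟩ ⟨a', b'⟩ hle hmem
    obtain ⟨h1, h2⟩ : a' ≤ a ∧ b' ≤ b := hle
    simp only [Finset.coe_union, Finset.coe_filter, Set.mem_union, Finset.mem_coe,
      YoungDiagram.mem_cells, Set.mem_ofPred_eq] at hmem ⊢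
    rcases hmem with hmem | ⟨hr, hadd, hres⟩
    · exact Or.inl (γ.up_left_mem h1 h2 hmem)
    · by_cases he : a' = a ∧ b' = b
      · obtain ⟨rfl, rfl⟩ := he
        exact Or.inr ⟨hr, hadd, hres⟩
      · left
        obtain ⟨-, hA, hB⟩ := hadd
        by_cases ha : a' = a
        · rcases hB with hB | hB
          · exact absurd ⟨ha, by simp only at hB; omega⟩ he
          · exact γ.up_left_mem h1 (by simp only; omega) hB
        · rcases hA with hA | hA
          · simp only at hA; omega
          · exact γ.up_left_mem (by simp only; omega) h2 hA

theorem mem_addCorners {k : ℕ} {i : ZMod (k + 1)} {γ : YoungDiagram} {c : ℕ × ℕ} :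
    c ∈ addCorners k i γ ↔ c ∈ γ ∨ (IsAddable γ c ∧ residue k c = i) := by
  obtain ⟨a, b⟩ := c
  have key : IsAddable γ (a, b) → a < γ.colLen 0 + 1 ∧ b < γ.rowLen 0 + 1 := by
    rintro ⟨-, hA, hB⟩
    constructor
    · rcases hA with hA | hA
      · simp only at hA; omega
      · have := YoungDiagram.mem_iff_lt_colLen.1 (γ.up_left_mem le_rfl (Nat.zero_le _) hA)
        omega
    · rcases hB with hB | hB
      · simp only at hB; omega
      · have := YoungDiagram.mem_iff_lt_rowLen.1 (γ.up_left_mem (Nat.zero_le _) le_rfl hB)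
        omega
  rw [← YoungDiagram.mem_cells, ← YoungDiagram.mem_cells]
  simp only [addCorners, Finset.mem_union, Finset.mem_filter, Finset.mem_product, Finset.mem_range]
  tauto

end Cores

section Grassmannian

/-- Grassmannian elements: the minimal length representatives of the left cosets of the finite
symmetric group generated by the simple reflections other than `s 0`. -/
def IsGrassmannian (k : ℕ) (w : AffineSymm k) : Prop :=
  ∀ v ∈ Subgroup.closure {s | ∃ i : ZMod (k + 1), i ≠ 0 ∧ s = (affineSystem k).simple i},
    (affineSystem k).length w ≤ (affineSystem k).length (w * v)

/-- The core `s_{i_ℓ} ⋯ s_{i_1} ∅` of an element with reduced word `i_ℓ ⋯ i_1`, where `s_i` adds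
all addable corners of residue `i`. On Grassmannian elements it does not depend on the word. -/
noncomputable def shapeOf (k : ℕ) (w : AffineSymm k) : YoungDiagram :=
  ((affineSystem k).exists_isReduced w).choose.foldr (addCorners k) ⊥

/-- The Grassmannian element `w_λ` of a `k`-bounded partition `λ`: the inverse image of the core of
`λ` under the bijection `shapeOf` from Grassmannian elements to cores. -/
noncomputable def grassmannianOf (k : ℕ) (lam : YoungDiagram) : AffineSymm k :=
  Function.invFunOn (shapeOf k) {w | IsGrassmannian k w} (coreOf k lam)

end Grassmannian

section Grothendieck

/-- A word without repeated letters in which `j` precedes `j - 1` whenever both occur. -/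
def IsCyclicallyDecreasingWord (k : ℕ) (l : List (ZMod (k + 1))) : Prop :=
  l.Nodup ∧ ∀ j, j ∈ l → j - 1 ∈ l → l.idxOf j < l.idxOf (j - 1)

/-- The cyclically decreasing elements of length `r`. -/
def cyclicallyDecreasing (k r : ℕ) : Set (AffineSymm k) :=
  {w | (∃ l, IsCyclicallyDecreasingWord k l ∧ (affineSystem k).wordProd l = w) ∧
    (affineSystem k).length w = r}

theorem finite_cyclicallyDecreasing (k r : ℕ) : (cyclicallyDecreasing k r).Finite := by
  have h : {l : List (ZMod (k + 1)) | l.Nodup}.Finite :=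
    Set.finite_coe_iff.1 (inferInstanceAs (Finite {l : List (ZMod (k + 1)) // l.Nodup}))
  refine (h.image (affineSystem k).wordProd).subset ?_
  rintro w ⟨⟨l, hl, rfl⟩, -⟩
  exact ⟨l, hl.1, rfl⟩

/-- The element `h r`: the sum of `A w` over the cyclically decreasing `w` of length `r`. -/
noncomputable def hElt (k r : ℕ) : NilHecke k :=
  ∑ w ∈ (finite_cyclicallyDecreasing k r).toFinset, basisElt k w

/-- The least `ℓ` such that `α x = 0` for all `x ≥ ℓ`. -/
def compLength (α : ℕ →₀ ℕ) : ℕ := α.support.sup (· + 1)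

/-- The affine stable Grothendieck polynomial of `w`: the coefficient of `x ^ α` is the coefficient
of `A w` in `h (α (ℓ - 1)) * ⋯ * h (α 1) * h (α 0)`. The variables are indexed from `0`. -/
noncomputable def affineGrothendieck (k : ℕ) (w : AffineSymm k) : MvPowerSeries ℕ ℤ := fun α =>
  (nilHeckeBasis k).repr (((List.range (compLength α)).reverse.map fun x => hElt k (α x)).prod) w

end Grothendieck

section Tableaux

/-- A standard affine set-valued tableau of degree `n`, as the function giving the set of letters in
each cell (empty outside the shape): the letters are `1, …, n`, and for each `x` the cells having a
letter at most `x` form a core `γ`, and the letter `x` lies exactly in the removable corners of `γ`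
of one residue (the residue of some removable corner `c₀`). -/
def IsStandard (k n : ℕ) (T : ℕ × ℕ → Finset ℕ) : Prop :=
  (∀ c, T c ⊆ Finset.Icc 1 n) ∧
    ∀ x ∈ Finset.Icc 1 n, ∃ γ : YoungDiagram,
      (∀ c, c ∈ γ ↔ ∃ y ∈ T c, y ≤ x) ∧ IsCore (k + 1) γ ∧
        ∃ c₀, IsRemovable γ c₀ ∧ ∀ c, x ∈ T c ↔ IsRemovable γ c ∧ residue k c = residue k c₀

/-- The letters `α 0 + ⋯ + α (x - 1) + 1, …, α 0 + ⋯ + α x`. -/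
def alphabet (α : ℕ →₀ ℕ) (x : ℕ) : Finset ℕ :=
  Finset.Ioc (∑ i ∈ Finset.range x, α i) (∑ i ∈ Finset.range (x + 1), α i)

/-- `c` is the lowest cell that contains the letter `a` (rows are numbered from bottom to top). -/
def IsLowest (T : ℕ × ℕ → Finset ℕ) (a : ℕ) (c : ℕ × ℕ) : Prop :=
  a ∈ T c ∧ ∀ d, a ∈ T d → c.1 ≤ d.1

/-- The lowest reading word in the alphabet `A` is increasing. The word reads the lowest occurrences
of the letters of `A`, rows from top to bottom, each row from left to right, and the letters of one
cell in decreasing order; it is increasing when for `a < b` the cell of `a` is read strictly before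
the cell of `b`. -/
def LowestReadingIncreasing (T : ℕ × ℕ → Finset ℕ) (A : Finset ℕ) : Prop :=
  ∀ a ∈ A, ∀ b ∈ A, a < b → ∀ c d, IsLowest T a c → IsLowest T b d →
    d.1 < c.1 ∨ (d.1 = c.1 ∧ c.2 < d.2)

/-- The cells that contain a letter of `A`. -/
def cellsOf (T : ℕ × ℕ → Finset ℕ) (A : Finset ℕ) : Set (ℕ × ℕ) := {c | ∃ a ∈ A, a ∈ T c}

/-- The affine set-valued tableaux of shape `coreOf k lam`, of any `k`-bounded weight. -/
structure AffineSVTableau (k : ℕ) (lam : YoungDiagram) where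
  /-- The weight. -/
  weight : ℕ →₀ ℕ
  /-- The set of letters in each cell. -/
  filling : ℕ × ℕ → Finset ℕ
  weight_le : ∀ x, weight x ≤ k
  standard : IsStandard k weight.degree filling
  shape : ∀ c, c ∈ coreOf k lam ↔ (filling c).Nonempty
  increasing : ∀ x, LowestReadingIncreasing filling (alphabet weight x)
  residues : ∀ x, (residue k '' cellsOf filling (alphabet weight x)).ncard = weight x
  horizontal : ∀ x, ∀ c ∈ cellsOf filling (alphabet weight x),
    ∀ d ∈ cellsOf filling (alphabet weight x), c.2 = d.2 → c = d

end Tableaux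

end AffineGroth

open scoped MvPowerSeries.WithPiTopology

/-! The coefficient of `A_w` for Grassmannian `w` can be computed on cores alone. The `A_w` with `w`
not minimal in its coset span a left ideal, and the quotient (`nilProj`) has the `(k+1)`-cores as a
basis. On it `A_i` adds all addable corners of residue `i` when there are some, multiplies by `-1`
when there are removable corners of residue `i`, and gives `0` otherwise (`nilProj_gen_mul`).

This trichotomy is proved on the abacus. A shape is encoded by the set of its beads in `ℤ`; cores
are the sets closed under the shift by `-(k+1)`, and the core of `w` is the image of `{m < 0}` under
the action of `w` on `ℤ`, where `s_i` swaps `m - 1` and `m` for every `m ≡ i`. Closure under the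
shift forbids raising and lowering beads at the same residue. The lemma `controls` shows, by
induction on length with the commutation and braid relations, that for a minimal `w` a lowerable
residue is a left descent, and that a residue which moves no bead satisfies `s_i w = w s_l` with `l
≠ 0`.

The product of the `h_r` applied to the empty core then becomes a sum over chains of cores. The
Pieri rule `sum_wordOp_single` makes this sum combinatorial. A cyclically decreasing element acts by
any of its cyclically decreasing words. These differ by commutations of non-adjacent letters, so the
cells marked by each residue do not depend on the choice (`record_eq_of_perm`). If the element does
not act by zero, exactly one arrangement of its letters has an increasing reading word
(`exists_isGood_perm`, `IsGood.eq_of_perm`). Conversely, the tableau conditions on one alphabet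
force a cyclically decreasing word (`IsGood.cyc`).

The sign comes from `shortHooks_addCorners`: a step that enlarges a core creates exactly one new
cell of hook length at most `k`, so `|λ|` steps enlarge the shape and each remaining step
contributes `-1`. Finally, words of residues correspond to standard set-valued tableaux by putting
the letter `t + 1` in the cells marked at index `t` (`exists_fillingOf_eq`, `eq_of_fillingOf_eq`).
-/

namespace AffineGroth

/-! ### The action on the integers, and words without repeated letters. -/

section Permutations

/-- The `k`-periodic involution of `ℤ` that exchanges `m - 1` and `m` for all `m ≡ i`. -/
def sw (k : ℕ) (i : ZMod (k + 1)) : Function.End ℤ := fun m =>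
  if (m : ZMod (k + 1)) = i then m - 1 else if (m : ZMod (k + 1)) = i - 1 then m + 1 else m

theorem sw_eq {k : ℕ} {i : ZMod (k + 1)} {m : ℤ} (h : (m : ZMod (k + 1)) = i) :
    sw k i m = m - 1 := if_pos h

theorem sw_pred {k : ℕ} (hk : 0 < k) {i : ZMod (k + 1)} {m : ℤ}
    (h : (m : ZMod (k + 1)) = i - 1) : sw k i m = m + 1 := by
  have h1 := one_ne_zero_zmod hk
  rw [sw, if_neg, if_pos h]
  rw [h]; intro h2; apply h1; linear_combination -h2

theorem sw_of_ne {k : ℕ} {i : ZMod (k + 1)} {m : ℤ} (h : (m : ZMod (k + 1)) ≠ i)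
    (h' : (m : ZMod (k + 1)) ≠ i - 1) : sw k i m = m := by
  rw [sw, if_neg h, if_neg h']

theorem sw_sw {k : ℕ} (hk : 0 < k) (i : ZMod (k + 1)) (m : ℤ) : sw k i (sw k i m) = m := by
  by_cases h : (m : ZMod (k + 1)) = i
  · rw [sw_eq h, sw_pred hk (by push_cast; rw [h])]; ring
  by_cases h' : (m : ZMod (k + 1)) = i - 1
  · rw [sw_pred hk h', sw_eq (by push_cast; rw [h']; ring)]; ring
  · rw [sw_of_ne h h', sw_of_ne h h']

theorem sw_comm {k : ℕ} (hk : 0 < k) {i j : ZMod (k + 1)} (hij : i ≠ j) (h1 : j ≠ i + 1)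
    (h2 : i ≠ j + 1) (m : ℤ) : sw k i (sw k j m) = sw k j (sw k i m) := by
  have h0 := one_ne_zero_zmod hk
  simp only [sw]
  split_ifs <;> push_cast at * <;> grind

/-- Both sides reverse every block of three consecutive integers with residues `i - 1, i, i + 1` and
fix all other integers. The bound `2 ≤ k` makes the three residues distinct. -/
theorem sw_braid {k : ℕ} (hk : 2 ≤ k) (i : ZMod (k + 1)) (m : ℤ) :
    sw k i (sw k (i + 1) (sw k i m)) = sw k (i + 1) (sw k i (sw k (i + 1) m)) := by
  have h0 := one_ne_zero_zmod (by omega : 1 ≤ k)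
  have h2 := two_ne_zero_zmod hk
  have e1 : i - 1 ≠ i := by intro h; apply h0; linear_combination -h
  have e2 : i - 1 ≠ i + 1 := by intro h; apply h2; linear_combination -h
  have e3 : i + 1 ≠ i := by intro h; apply h0; linear_combination h
  have e4 : i + 1 - 1 = i := by ring
  by_cases ha : (m : ZMod (k + 1)) = i
  · have c1 : ((m - 1 : ℤ) : ZMod (k + 1)) = i - 1 := by push_cast; rw [ha]
    have c2 : ((m + 1 : ℤ) : ZMod (k + 1)) = i + 1 := by push_cast; rw [ha]
    rw [sw_eq ha, sw_of_ne (i := i + 1) (by rwa [c1]) (by rwa [c1, e4]), sw_pred (by omega) c1,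
      sw_pred (i := i + 1) (m := m) (by omega) (by rw [ha, e4]), sw_of_ne (i := i) (m := m + 1) (by rwa [c2])
      (by rw [c2]; exact e2.symm), sw_eq c2]
    ring
  by_cases hb : (m : ZMod (k + 1)) = i - 1
  · have c1 : ((m + 1 : ℤ) : ZMod (k + 1)) = i := by push_cast; rw [hb]; ring
    have c2 : ((m + 1 + 1 : ℤ) : ZMod (k + 1)) = i + 1 := by push_cast; rw [hb]; ring
    rw [sw_of_ne (i := i + 1) (m := m) (by rwa [hb]) (by rwa [hb, e4]), sw_pred (by omega) hb,
      sw_pred (i := i + 1) (by omega) (by rw [c1, e4]), sw_of_ne (by rwa [c2])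
      (by rw [c2]; exact e2.symm)]
  by_cases hc : (m : ZMod (k + 1)) = i + 1
  · have c1 : ((m - 1 : ℤ) : ZMod (k + 1)) = i := by push_cast; rw [hc]; ring
    have c2 : ((m - 1 - 1 : ℤ) : ZMod (k + 1)) = i - 1 := by push_cast; rw [hc]; ring
    rw [sw_of_ne ha hb, sw_eq hc, sw_eq c1, sw_of_ne (by rwa [c2]) (by rwa [c2, e4])]
  · rw [sw_of_ne ha hb, sw_of_ne hc (by rwa [e4]), sw_of_ne ha hb,
      sw_of_ne hc (by rwa [e4])]

theorem sw_liftable {k : ℕ} (hk : 0 < k) : (affineMatrix k).IsLiftable (sw k) := by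
  have hs (i) : sw k i * sw k i = 1 := funext (sw_sw hk i)
  have key (hk : 2 ≤ k) (i : ZMod (k + 1)) : (sw k i * sw k (i + 1)) ^ 3 = 1 ∧
      (sw k (i + 1) * sw k i) ^ 3 = 1 := by
    have hb : sw k i * sw k (i + 1) * sw k i = sw k (i + 1) * sw k i * sw k (i + 1) :=
      funext (sw_braid hk i)
    have h1 := hs i
    have h2 := hs (i + 1)
    generalize sw k i = a at *
    generalize sw k (i + 1) = b at *
    constructor
    · calc (a * b) ^ 3 = (a * b * a) * (b * a * b) := by
            simp only [pow_succ, pow_zero, one_mul, mul_assoc]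
        _ = (a * b * a) * (a * b * a) := by rw [hb]
        _ = a * (b * ((a * a) * (b * a))) := by simp only [mul_assoc]
        _ = a * ((b * b) * a) := by rw [h1, one_mul, mul_assoc]
        _ = 1 := by rw [h2, one_mul, h1]
    · calc (b * a) ^ 3 = (b * a * b) * (a * b * a) := by
            simp only [pow_succ, pow_zero, one_mul, mul_assoc]
        _ = (b * a * b) * (b * a * b) := by rw [hb]
        _ = b * (a * ((b * b) * (a * b))) := by simp only [mul_assoc]
        _ = b * ((a * a) * b) := by rw [h2, one_mul, mul_assoc]
        _ = 1 := by rw [h1, one_mul, h2]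
  intro i j
  rw [affineMatrix_apply]
  split_ifs with h1 h2 h3
  · subst h1; rw [pow_one, hs]
  · rw [pow_zero]
  · have hk2 : 2 ≤ k := by omega
    rcases h2 with rfl | rfl
    · exact (key hk2 i).1
    · exact (key hk2 j).2
  · push Not at h2
    have hc : sw k i * sw k j = sw k j * sw k i := funext (sw_comm hk h1 h2.1 h2.2)
    rw [pow_two]
    nth_rewrite 2 [hc]
    rw [mul_assoc, ← mul_assoc (sw k j) (sw k j), hs, one_mul, hs]

/-- The action of the affine symmetric group on `ℤ`. -/
noncomputable def perm {k : ℕ} (hk : 0 < k) : AffineSymm k →* Function.End ℤ :=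
  (affineSystem k).lift ⟨sw k, sw_liftable hk⟩

theorem perm_simple {k : ℕ} (hk : 0 < k) (i : ZMod (k + 1)) :
    perm hk ((affineSystem k).simple i) = sw k i :=
  (affineSystem k).lift_apply_simple (sw_liftable hk) i

/-- Only the generator of the residue of `m₀` moves integers across the wall between `m₀ - 1` and
`m₀`. -/
theorem sw_lt_iff {k : ℕ} {i j : ZMod (k + 1)} (hij : i ≠ j) {m₀ : ℤ}
    (h₀ : (m₀ : ZMod (k + 1)) = i) (m : ℤ) : sw k j m < m₀ ↔ m < m₀ := by
  rw [sw]
  split_ifs with h1 h2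
  · have : m ≠ m₀ := by rintro rfl; exact hij (h₀.symm.trans h1)
    omega
  · have : m + 1 ≠ m₀ := by rintro rfl; push_cast at h₀; apply hij; rw [← h₀, h2]; ring
    omega
  · rfl

theorem perm_lt_iff {k : ℕ} (hk : 0 < k) {i : ZMod (k + 1)} {m₀ : ℤ}
    (h₀ : (m₀ : ZMod (k + 1)) = i) {l : List (ZMod (k + 1))} (hl : i ∉ l) (m : ℤ) :
    perm hk ((affineSystem k).wordProd l) m < m₀ ↔ m < m₀ := by
  induction l with
  | nil => simp [CoxeterSystem.wordProd, end_one_apply]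
  | cons j l ih =>
    rw [List.mem_cons, not_or] at hl
    rw [CoxeterSystem.wordProd_cons, map_mul, perm_simple, end_mul_apply, sw_lt_iff hl.1 h₀,
      ih hl.2]

/-- A word in which `i` occurs exactly once carries some integer across a wall of residue `i`, and
nothing in the word carries it back. A word without `i` never crosses that wall. -/
theorem mem_of_wordProd_eq {k : ℕ} (hk : 0 < k) {l l' : List (ZMod (k + 1))} (hl : l.Nodup)
    (he : (affineSystem k).wordProd l = (affineSystem k).wordProd l') {i : ZMod (k + 1)}
    (hi : i ∈ l) : i ∈ l' := by
  by_contra hi'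
  obtain ⟨m₀, h₀⟩ := ZMod.intCast_surjective i
  obtain ⟨p, q, rfl⟩ := List.append_of_mem hi
  rw [List.nodup_middle, List.nodup_cons, List.mem_append, not_or] at hl
  have hinv : perm hk ((affineSystem k).wordProd q)
      (perm hk ((affineSystem k).wordProd q)⁻¹ m₀) = m₀ := by
    show (perm hk ((affineSystem k).wordProd q) * perm hk ((affineSystem k).wordProd q)⁻¹) m₀ = m₀
    rw [← map_mul]; simp [end_one_apply]
  -- The test point is the preimage of `m₀` under the part `q` that acts before `i`, so that `i`
  -- finds it exactly at the wall.
  have h1 := perm_lt_iff hk h₀ hi' (perm hk ((affineSystem k).wordProd q)⁻¹ m₀)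
  rw [← he, CoxeterSystem.wordProd_append, CoxeterSystem.wordProd_cons, map_mul, map_mul,
    perm_simple, end_mul_apply, end_mul_apply, perm_lt_iff hk h₀ hl.1.1, hinv, sw_eq h₀] at h1
  have h2 := perm_lt_iff hk h₀ hl.1.2 (perm hk ((affineSystem k).wordProd q)⁻¹ m₀)
  rw [hinv, ← h1] at h2
  omega

/-- If prepending a new letter `i` shortened the product, exchange would rewrite it as a product of
letters of `l`, in which `i` does not occur. Words are reversed because `exchange` concerns right
descents. -/
theorem isReduced_of_nodup {k : ℕ} (hk : 0 < k) {l : List (ZMod (k + 1))} (hl : l.Nodup) :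
    (affineSystem k).IsReduced l := by
  induction l with
  | nil => simp [CoxeterSystem.IsReduced]
  | cons i l ih =>
    have hn := List.nodup_cons.1 hl
    have hr := ih hn.2
    rcases (affineSystem k).length_simple_mul ((affineSystem k).wordProd l) i with h | h
    · rw [CoxeterSystem.IsReduced, CoxeterSystem.wordProd_cons, h, hr.eq]; simp
    · exfalso
      have hd : (affineSystem k).IsRightDescent ((affineSystem k).wordProd l.reverse) i := by
        rw [CoxeterSystem.wordProd_reverse, CoxeterSystem.isRightDescent_inv_iff,
          CoxeterSystem.IsLeftDescent]
        omega
      obtain ⟨j, hj, he⟩ := exchange (affineSystem k) hd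
      rw [← CoxeterSystem.wordProd_concat, List.concat_eq_append, ← List.reverse_cons] at he
      have := mem_of_wordProd_eq hk (List.nodup_reverse.2 hl) he (i := i) (by simp)
      exact hn.1 (List.mem_reverse.1 (List.mem_of_mem_eraseIdx this))

end Permutations

/-! ### Cyclically decreasing words and commutations. -/

section CyclicallyDecreasing

/-- `b` may follow `a` in a cyclically decreasing word. -/
def CycBefore (k : ℕ) (a b : ZMod (k + 1)) : Prop := a ≠ b ∧ b ≠ a + 1

theorem isCyclicallyDecreasingWord_iff {k : ℕ} (hk : 0 < k) {l : List (ZMod (k + 1))} :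
    IsCyclicallyDecreasingWord k l ↔ l.Pairwise (CycBefore k) := by
  have h0 := one_ne_zero_zmod hk
  induction l with
  | nil => simp [IsCyclicallyDecreasingWord]
  | cons a l ih =>
    refine Iff.trans ?_ (List.pairwise_cons.trans (and_congr_right fun _ => ih.symm)).symm
    constructor
    · rintro ⟨hn, h⟩
      rw [List.nodup_cons] at hn
      refine ⟨fun b hb => ⟨by rintro rfl; exact hn.1 hb, ?_⟩, hn.2, ?_⟩
      · rintro rfl
        have := h (a + 1) (by simp [hb]) (by simp)
        simp at this
      · intro j hj hj'
        have := h j (by simp [hj]) (by simp [hj'])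
        rwa [List.idxOf_cons_ne _ (by rintro rfl; exact hn.1 hj),
          List.idxOf_cons_ne _ (by rintro rfl; exact hn.1 hj'), Nat.succ_lt_succ_iff] at this
    · rintro ⟨h1, hn, h⟩
      refine ⟨List.nodup_cons.2 ⟨fun ha => (h1 a ha).1 rfl, hn⟩, fun j hj hj' => ?_⟩
      by_cases hja : j = a
      · subst hja
        rw [List.idxOf_cons_self, List.idxOf_cons_ne _ (by intro h2; apply h0; linear_combination h2)]
        omega
      · have hjl : j ∈ l := by simpa [hja] using hj
        have hne : a ≠ j - 1 := by rintro rfl; exact (h1 j hjl).2 (by ring)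
        rw [List.idxOf_cons_ne _ (Ne.symm hja), List.idxOf_cons_ne _ hne, Nat.succ_lt_succ_iff]
        exact h j hjl (by simpa [hne.symm] using hj')

/-- If all `k + 1` residues occurred, the successor of the first letter would have to precede it.
This gives the bound on the weights of the tableaux built from words. -/
theorem CycBefore.length_le {k : ℕ} (hk : 0 < k) {l : List (ZMod (k + 1))}
    (hl : l.Pairwise (CycBefore k)) : l.length ≤ k := by
  by_contra hlt
  have hn : l.Nodup := hl.imp fun h => h.1
  have hc : Fintype.card (ZMod (k + 1)) = k + 1 := ZMod.card _
  have huniv : ∀ j, j ∈ l := by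
    have : l.toFinset = Finset.univ := by
      apply Finset.eq_univ_of_card
      have := List.toFinset_card_of_nodup hn
      have := l.toFinset.card_le_univ
      omega
    intro j
    rw [← List.mem_toFinset, this]; simp
  cases l with
  | nil => simp at hlt
  | cons a l =>
    rw [List.pairwise_cons] at hl
    rcases List.mem_cons.1 (huniv (a + 1)) with h | h
    · exact one_ne_zero_zmod hk (by linear_combination h)
    · exact (hl.1 _ h).2 rfl

/-- Two cyclically decreasing words with the same letters differ by commutations. -/
theorem prod_eq_of_cycBefore {k : ℕ} {N : Type*} [Monoid N] (f : ZMod (k + 1) → N)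
    (hf : ∀ i j, i ≠ j → j ≠ i + 1 → i ≠ j + 1 → f i * f j = f j * f i)
    {l l' : List (ZMod (k + 1))} (hl : l.Pairwise (CycBefore k)) (hl' : l'.Pairwise (CycBefore k))
    (hp : l.Perm l') : (l.map f).prod = (l'.map f).prod := by
  induction l generalizing l' with
  | nil => rw [List.nil_perm.1 hp]
  | cons x l ih =>
    obtain ⟨p, q, rfl⟩ := List.append_of_mem (hp.subset (List.mem_cons_self))
    rw [List.pairwise_cons] at hl
    have hmem : ∀ y ∈ p ++ q, y ∈ l := by
      intro y hy
      exact (List.Perm.cons_inv (hp.trans List.perm_middle)).symm.subset hy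
    rw [List.pairwise_append, List.pairwise_cons] at hl'
    have hpq : (p ++ q).Pairwise (CycBefore k) := by
      rw [List.pairwise_append]
      exact ⟨hl'.1, hl'.2.1.2, fun a ha b hb => hl'.2.2 a ha b (by simp [hb])⟩
    -- A letter of `p` comes before `x` in one word and after it in the other. Both orders being
    -- admissible, the two letters are distinct and not adjacent.
    have hcomm : (p.map f).prod * f x = f x * (p.map f).prod := by
      refine Commute.list_prod_left (p.map f) (f x) ?_
      intro y hy
      obtain ⟨z, hz, rfl⟩ := List.mem_map.1 hy
      have h1 := hl'.2.2 z hz x (by simp)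
      have h2 := hl.1 z (hmem z (by simp [hz]))
      exact hf z x h1.1 h1.2 h2.2
    rw [List.map_cons, List.prod_cons, ih hl.2 hpq (List.Perm.cons_inv (hp.trans List.perm_middle))]
    simp only [List.map_append, List.prod_append, List.map_cons, List.prod_cons]
    rw [← mul_assoc, ← mul_assoc, hcomm]

end CyclicallyDecreasing

end AffineGroth

namespace AffineGroth

/-! ### The abacus of a shape, and cores as flush abaci. -/

section Beads

/-- The content of the last cell of row `r` of `γ` (or of the position before the first one). -/
def bead (γ : YoungDiagram) (r : ℕ) : ℤ := γ.rowLen r - r - 1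

/-- The set of beads of `γ` on the abacus. -/
def beads (γ : YoungDiagram) : Set ℤ := Set.range (bead γ)

theorem bead_strictAnti (γ : YoungDiagram) : StrictAnti (bead γ) := by
  intro r s h
  have := γ.rowLen_anti r s h.le
  simp only [bead]; omega

theorem bead_lt_iff {γ : YoungDiagram} {r s : ℕ} : bead γ r < bead γ s ↔ s < r :=
  (bead_strictAnti γ).lt_iff_gt

theorem beads_injective : Function.Injective beads := by
  intro γ γ' h
  have hm (γ : YoungDiagram) : StrictMono fun r => -bead γ r :=
    fun r s hrs => neg_lt_neg (bead_strictAnti γ hrs)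
  have hr : Set.range (fun r => -bead γ r) = Set.range fun r => -bead γ' r := by
    have e (γ : YoungDiagram) : Set.range (fun r => -bead γ r) = (- ·) '' beads γ := by
      rw [beads, ← Set.range_comp]; rfl
    rw [e, e, h]
  have := ((hm γ).range_inj (hm γ')).1 hr
  ext ⟨r, c⟩
  have hc := congrFun this r
  simp only [bead] at hc
  simp only [YoungDiagram.mem_cells, YoungDiagram.mem_iff_lt_rowLen]
  omega

theorem mem_beads_bot {m : ℤ} : m ∈ beads ⊥ ↔ m < 0 := by
  have h (r : ℕ) : (⊥ : YoungDiagram).rowLen r = 0 := by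
    by_contra h
    exact YoungDiagram.notMem_bot _ (YoungDiagram.mem_iff_lt_rowLen.2 (Nat.pos_of_ne_zero h))
  constructor
  · rintro ⟨r, rfl⟩
    rw [bead, h]; omega
  · intro hm
    exact ⟨(-m - 1).toNat, by rw [bead, h]; omega⟩

/-- The steps of the boundary path of `γ` are numbered by the integers: the beads are the ends of
the rows and the gaps are the ends of the columns. A gap `m` belongs to column `m + r`, where `r` is
the first row whose bead lies weakly below `m`. -/
theorem not_mem_beads_iff {γ : YoungDiagram} {m : ℤ} :
    m ∉ beads γ ↔ ∃ j : ℕ, m = j - γ.colLen j := by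
  classical
  have hrc (r j : ℕ) : j < γ.rowLen r ↔ r < γ.colLen j := by
    rw [← YoungDiagram.mem_iff_lt_rowLen, YoungDiagram.mem_iff_lt_colLen]
  constructor
  · intro hm
    have hex : ∃ r : ℕ, (γ.rowLen r : ℤ) ≤ m + 1 + r := by
      refine ⟨(γ.rowLen 0 - m).toNat, ?_⟩
      have := γ.rowLen_anti 0 (γ.rowLen 0 - m).toNat (Nat.zero_le _)
      omega
    have h1 := Nat.find_spec hex
    have h2 := fun s (hs : s < Nat.find hex) => Nat.find_min hex hs
    generalize Nat.find hex = r at h1 h2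
    have hne : (γ.rowLen r : ℤ) ≠ m + 1 + r := by
      intro he; exact hm ⟨r, by rw [bead, he]; ring⟩
    refine ⟨(m + r).toNat, ?_⟩
    have h3 : γ.colLen (m + r).toNat = r := by
      refine le_antisymm ?_ ?_
      · rw [← not_lt, ← hrc]; omega
      · cases r with
        | zero => omega
        | succ r =>
          have h4 := h2 r (by omega)
          have : r < γ.colLen (m + (r + 1 : ℕ)).toNat := by rw [← hrc]; omega
          omega
    rw [h3]; omega
  · rintro ⟨j, rfl⟩ ⟨r, hr⟩
    have := hrc r j
    rw [bead] at hr
    omega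

theorem residue_eq (k : ℕ) (c : ℕ × ℕ) : residue k c = ((c.2 - c.1 : ℤ) : ZMod (k + 1)) := by
  simp [residue]

/-- Lengthening a row by one cell moves its bead one step up, which is possible exactly when the
next position is free. -/
theorem isAddable_iff {γ : YoungDiagram} {r c : ℕ} :
    IsAddable γ (r, c) ↔ γ.rowLen r = c ∧ bead γ r + 1 ∉ beads γ := by
  simp only [IsAddable, YoungDiagram.mem_iff_lt_rowLen]
  constructor
  · rintro ⟨h1, h2, h3⟩
    have hc : γ.rowLen r = c := by omega
    refine ⟨hc, ?_⟩
    rintro ⟨s, hs⟩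
    have hsr : s < r := by rw [← bead_lt_iff (γ := γ)]; omega
    have := γ.rowLen_anti s (r - 1) (by omega)
    simp only [bead] at hs
    omega
  · rintro ⟨rfl, h⟩
    refine ⟨by omega, ?_, by omega⟩
    by_contra hc
    push Not at hc
    apply h
    refine ⟨r - 1, ?_⟩
    have := γ.rowLen_anti (r - 1) r (by omega)
    simp only [bead]; omega

theorem isRemovable_iff {γ : YoungDiagram} {r c : ℕ} :
    IsRemovable γ (r, c) ↔ γ.rowLen r = c + 1 ∧ bead γ r - 1 ∉ beads γ := by
  simp only [IsRemovable, YoungDiagram.mem_iff_lt_rowLen]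
  constructor
  · rintro ⟨h1, h2, h3⟩
    refine ⟨by omega, ?_⟩
    rintro ⟨s, hs⟩
    have hsr : r < s := by rw [← bead_lt_iff (γ := γ)]; omega
    have := γ.rowLen_anti (r + 1) s (by omega)
    simp only [bead] at hs
    omega
  · rintro ⟨h, h'⟩
    refine ⟨by omega, by omega, ?_⟩
    intro hc
    apply h'
    refine ⟨r + 1, ?_⟩
    have := γ.rowLen_anti r (r + 1) (by omega)
    simp only [bead]; push_cast; omega

/-- `γ` has an addable corner of residue `i`. -/
def HasAddable (k : ℕ) (i : ZMod (k + 1)) (γ : YoungDiagram) : Prop :=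
  ∃ c, IsAddable γ c ∧ residue k c = i

/-- `γ` has a removable corner of residue `i`. -/
def HasRemovable (k : ℕ) (i : ZMod (k + 1)) (γ : YoungDiagram) : Prop :=
  ∃ c, IsRemovable γ c ∧ residue k c = i

/-- Some `m ≡ i` is free on the abacus `B` while `m - 1` is occupied. -/
def CanRaise (k : ℕ) (i : ZMod (k + 1)) (B : Set ℤ) : Prop :=
  ∃ m : ℤ, (m : ZMod (k + 1)) = i ∧ m - 1 ∈ B ∧ m ∉ B

/-- Some `m ≡ i` is occupied on the abacus `B` while `m - 1` is free. -/
def CanLower (k : ℕ) (i : ZMod (k + 1)) (B : Set ℤ) : Prop :=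
  ∃ m : ℤ, (m : ZMod (k + 1)) = i ∧ m ∈ B ∧ m - 1 ∉ B

theorem hasAddable_iff {k : ℕ} {i : ZMod (k + 1)} {γ : YoungDiagram} :
    HasAddable k i γ ↔ CanRaise k i (beads γ) := by
  constructor
  · rintro ⟨⟨r, c⟩, h, hi⟩
    obtain ⟨h1, h2⟩ := isAddable_iff.1 h
    refine ⟨bead γ r + 1, ?_, by simpa using ⟨r, rfl⟩, h2⟩
    rw [← hi, residue_eq, bead, h1]; congr 1; ring
  · rintro ⟨m, hm, ⟨r, hr⟩, h2⟩
    refine ⟨(r, γ.rowLen r), isAddable_iff.2 ⟨rfl, by rwa [hr, sub_add_cancel]⟩, ?_⟩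
    rw [← hm, residue_eq]
    rw [bead] at hr
    congr 1; simp only; omega

theorem hasRemovable_iff {k : ℕ} {i : ZMod (k + 1)} {γ : YoungDiagram} :
    HasRemovable k i γ ↔ CanLower k i (beads γ) := by
  constructor
  · rintro ⟨⟨r, c⟩, h, hi⟩
    obtain ⟨h1, h2⟩ := isRemovable_iff.1 h
    refine ⟨bead γ r, ?_, ⟨r, rfl⟩, h2⟩
    rw [← hi, residue_eq, bead, h1]; congr 1; push_cast; ring
  · rintro ⟨m, hm, ⟨r, rfl⟩, h2⟩
    have hpos : γ.rowLen r ≠ 0 := by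
      intro h0
      apply h2
      have := γ.rowLen_anti r (r + 1) (by omega)
      refine ⟨r + 1, ?_⟩
      simp only [bead]; push_cast; omega
    refine ⟨(r, γ.rowLen r - 1), isRemovable_iff.2 ⟨by omega, h2⟩, ?_⟩
    rw [← hm, residue_eq, bead]
    congr 1; simp only; omega

theorem hookLength_eq {γ : YoungDiagram} {r j : ℕ} (h : (r, j) ∈ γ) :
    (hookLength γ (r, j) : ℤ) = bead γ r - (j - γ.colLen j) := by
  have h1 := YoungDiagram.mem_iff_lt_rowLen.1 h
  have h2 := YoungDiagram.mem_iff_lt_colLen.1 h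
  simp only [hookLength, bead]; omega

/-- An abacus that is flush with respect to shifts by `p`. -/
def IsFlush (p : ℕ) (B : Set ℤ) : Prop := ∀ m ∈ B, m - p ∈ B

theorem mem_of_gap_lt_bead {γ : YoungDiagram} {r j : ℕ} :
    (r, j) ∈ γ ↔ (j : ℤ) - γ.colLen j < bead γ r := by
  have h1 := YoungDiagram.mem_iff_lt_rowLen (μ := γ) (i := r) (j := j)
  have h2 := YoungDiagram.mem_iff_lt_colLen (μ := γ) (i := r) (j := j)
  rw [bead]
  by_cases h : (r, j) ∈ γ
  · simp only [h, true_iff] at *; omega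
  · simp only [h, false_iff] at *; omega

/-- Cells are the pairs of a bead and a smaller gap, and the hook length is their distance. A hook
of length `p` is thus a bead `m` with a gap at `m - p`. -/
theorem isCore_iff {p : ℕ} (hp : 0 < p) {γ : YoungDiagram} :
    IsCore p γ ↔ IsFlush p (beads γ) := by
  constructor
  · rintro h m ⟨r, rfl⟩
    by_contra hm
    obtain ⟨j, hj⟩ := not_mem_beads_iff.1 hm
    have hmem : (r, j) ∈ γ := mem_of_gap_lt_bead.2 (by omega)
    have := hookLength_eq hmem
    exact h _ hmem (by omega)
  · rintro h ⟨r, j⟩ hmem he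
    have h1 := hookLength_eq hmem
    rw [he] at h1
    refine not_mem_beads_iff.2 ⟨j, ?_⟩ (h _ ⟨r, rfl⟩)
    omega

theorem IsFlush.sub_mul_mem {p : ℕ} {B : Set ℤ} (h : IsFlush p B) {m : ℤ} (hm : m ∈ B) (t : ℕ) :
    m - t * p ∈ B := by
  induction t with
  | zero => simpa using hm
  | succ t ih =>
    have := h _ ih
    rwa [sub_sub, ← add_one_mul, ← Nat.cast_succ] at this

theorem IsFlush.mem_of_le {k : ℕ} {B : Set ℤ} (h : IsFlush (k + 1) B) {m n : ℤ} (hm : m ∈ B)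
    (hle : n ≤ m) (hc : (n : ZMod (k + 1)) = m) : n ∈ B := by
  rw [ZMod.intCast_eq_intCast_iff_dvd_sub] at hc
  obtain ⟨t, ht⟩ := hc
  have ht0 : 0 ≤ t := by
    by_contra hneg
    push_cast at ht
    nlinarith
  have := h.sub_mul_mem hm t.toNat
  rw [Int.toNat_of_nonneg ht0] at this
  rwa [show n = m - t * (k + 1 : ℕ) by push_cast at *; linarith]

/-- Each residue class is filled from below. If `m` is lowerable and `n` raisable, both of residue
`i`, then `n - 1` forces `m - 1` to be occupied when `m ≤ n`, and `m` forces `n` to be occupied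
otherwise. -/
theorem IsFlush.not_canRaise {k : ℕ} {i : ZMod (k + 1)} {B : Set ℤ} (h : IsFlush (k + 1) B)
    (hl : CanLower k i B) : ¬ CanRaise k i B := by
  obtain ⟨m, hm, h1, h2⟩ := hl
  rintro ⟨n, hn, h3, h4⟩
  rcases le_total m n with hle | hle
  · exact h2 (h.mem_of_le h3 (by omega) (by push_cast; rw [hm, hn]))
  · exact h4 (h.mem_of_le h1 hle (by rw [hm, hn]))

theorem IsCore.not_hasAddable {k : ℕ} {i : ZMod (k + 1)} {γ : YoungDiagram} (h : IsCore (k + 1) γ)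
    (hl : HasRemovable k i γ) : ¬ HasAddable k i γ := by
  rw [hasAddable_iff]
  exact ((isCore_iff (by omega)).1 h).not_canRaise (hasRemovable_iff.1 hl)

theorem add_one_ne_self {k : ℕ} (hk : 0 < k) (i : ZMod (k + 1)) : i + 1 ≠ i := by
  simpa using one_ne_zero_zmod hk

theorem rowLen_addCorners (k : ℕ) (i : ZMod (k + 1)) (γ : YoungDiagram) (r : ℕ)
    [Decidable (((bead γ r + 1 : ℤ) : ZMod (k + 1)) = i ∧ bead γ r + 1 ∉ beads γ)] :
    (addCorners k i γ).rowLen r = γ.rowLen r +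
      if ((bead γ r + 1 : ℤ) : ZMod (k + 1)) = i ∧ bead γ r + 1 ∉ beads γ then 1 else 0 := by
  refine eq_of_forall_lt_iff fun c => ?_
  rw [← YoungDiagram.mem_iff_lt_rowLen, mem_addCorners, isAddable_iff,
    YoungDiagram.mem_iff_lt_rowLen]
  have hres : γ.rowLen r = c → residue k (r, c) = ((bead γ r + 1 : ℤ) : ZMod (k + 1)) := by
    intro hc
    rw [residue_eq, bead, hc]; congr 1; simp
  split_ifs with h
  · constructor
    · rintro (h1 | ⟨⟨h1, -⟩, -⟩) <;> omega
    · intro h1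
      rcases Nat.lt_or_ge c (γ.rowLen r) with h2 | h2
      · exact Or.inl h2
      · have hc : γ.rowLen r = c := by omega
        exact Or.inr ⟨⟨hc, h.2⟩, by rw [hres hc, h.1]⟩
  · constructor
    · rintro (h1 | ⟨⟨h1, h2⟩, h3⟩)
      · omega
      · exact absurd ⟨by rw [← hres h1, h3], h2⟩ h
    · intro h1; exact Or.inl (by omega)

theorem mem_beads_addCorners {k : ℕ} {i : ZMod (k + 1)} {γ : YoungDiagram} {m : ℤ} :
    m ∈ beads (addCorners k i γ) ↔
      (m ∈ beads γ ∧ (((m + 1 : ℤ) : ZMod (k + 1)) = i → m + 1 ∈ beads γ)) ∨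
        ((m : ZMod (k + 1)) = i ∧ m ∉ beads γ ∧ m - 1 ∈ beads γ) := by
  classical
  have hb (r : ℕ) : bead (addCorners k i γ) r = bead γ r +
      if ((bead γ r + 1 : ℤ) : ZMod (k + 1)) = i ∧ bead γ r + 1 ∉ beads γ then 1 else 0 := by
    rw [bead, rowLen_addCorners]
    split_ifs <;> simp only [bead] <;> push_cast <;> ring
  constructor
  · rintro ⟨r, rfl⟩
    rw [hb]
    split_ifs with h
    · exact Or.inr ⟨h.1, h.2, by simpa using ⟨r, rfl⟩⟩
    · rw [add_zero]
      exact Or.inl ⟨⟨r, rfl⟩, fun h1 => by tauto⟩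
  · rintro (⟨⟨r, rfl⟩, h⟩ | ⟨h1, h2, r, hr⟩)
    · exact ⟨r, by rw [hb, if_neg (by tauto), add_zero]⟩
    · refine ⟨r, ?_⟩
      rw [hb, hr, sub_add_cancel, if_pos ⟨h1, h2⟩, sub_add_cancel]

theorem mem_beads_addCorners_of_eq {k : ℕ} (hk : 0 < k) {i : ZMod (k + 1)} {γ : YoungDiagram}
    {m : ℤ} (hm : (m : ZMod (k + 1)) = i) :
    m ∈ beads (addCorners k i γ) ↔ m ∈ beads γ ∨ m - 1 ∈ beads γ := by
  have : ((m + 1 : ℤ) : ZMod (k + 1)) ≠ i := by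
    push_cast; rw [hm]; exact add_one_ne_self hk i
  rw [mem_beads_addCorners]; tauto

theorem mem_beads_addCorners_of_pred {k : ℕ} (hk : 0 < k) {i : ZMod (k + 1)} {γ : YoungDiagram}
    {m : ℤ} (hm : ((m + 1 : ℤ) : ZMod (k + 1)) = i) :
    m ∈ beads (addCorners k i γ) ↔ m ∈ beads γ ∧ m + 1 ∈ beads γ := by
  have : (m : ZMod (k + 1)) ≠ i := by
    rw [← hm]; push_cast; exact (add_one_ne_self hk _).symm
  rw [mem_beads_addCorners]; tauto

theorem mem_beads_addCorners_of_ne {k : ℕ} {i : ZMod (k + 1)} {γ : YoungDiagram} {m : ℤ}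
    (hm : (m : ZMod (k + 1)) ≠ i) (hm' : ((m + 1 : ℤ) : ZMod (k + 1)) ≠ i) :
    m ∈ beads (addCorners k i γ) ↔ m ∈ beads γ := by
  rw [mem_beads_addCorners]; tauto

/-- Adding corners turns a pair "bead at `m - 1`, gap at `m`" with `m ≡ i` into "gap, bead".
Swapping the two positions does the same, apart from its effect on pairs "gap, bead", and the
hypothesis says that there are none. -/
theorem beads_addCorners_of_not_canLower {k : ℕ} (hk : 0 < k) {i : ZMod (k + 1)} {γ : YoungDiagram}
    (h : ¬ CanLower k i (beads γ)) : beads (addCorners k i γ) = {m | sw k i m ∈ beads γ} := by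
  have h' : ∀ m : ℤ, (m : ZMod (k + 1)) = i → m ∈ beads γ → m - 1 ∈ beads γ := by
    intro m hm hmem; by_contra hc; exact h ⟨m, hm, hmem, hc⟩
  ext m
  show _ ↔ sw k i m ∈ beads γ
  by_cases h1 : (m : ZMod (k + 1)) = i
  · rw [mem_beads_addCorners_of_eq hk h1, sw_eq h1]
    have := h' m h1; tauto
  by_cases h2 : ((m + 1 : ℤ) : ZMod (k + 1)) = i
  · rw [mem_beads_addCorners_of_pred hk h2, sw_pred hk (by rw [← h2]; push_cast; ring)]
    have := h' (m + 1) h2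
    rw [add_sub_cancel_right] at this
    tauto
  · rw [mem_beads_addCorners_of_ne h1 h2, sw_of_ne h1 (by
      intro h3; apply h2; push_cast; rw [h3]; ring)]

theorem addCorners_eq_self {k : ℕ} {i : ZMod (k + 1)} {γ : YoungDiagram}
    (h : ¬ HasAddable k i γ) : addCorners k i γ = γ := by
  ext c
  rw [YoungDiagram.mem_cells, YoungDiagram.mem_cells, mem_addCorners]
  exact ⟨fun h' => h'.elim id fun h' => absurd ⟨c, h'⟩ h, Or.inl⟩

theorem le_addCorners (k : ℕ) (i : ZMod (k + 1)) (γ : YoungDiagram) : γ ≤ addCorners k i γ :=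
  fun _ hc => mem_addCorners.2 (Or.inl hc)

/-- In each residue class the new bead set is the old one, or a union or an intersection of the old
set with its neighbouring translate; all three inherit closure under the shift. -/
theorem IsCore.addCorners {k : ℕ} (hk : 0 < k) {γ : YoungDiagram} (h : IsCore (k + 1) γ)
    (i : ZMod (k + 1)) : IsCore (k + 1) (addCorners k i γ) := by
  rw [isCore_iff (by omega)] at h ⊢
  have h0 : ((k + 1 : ℕ) : ZMod (k + 1)) = 0 := ZMod.natCast_self _
  have hc (m : ℤ) : ((m - (k + 1 : ℕ) : ℤ) : ZMod (k + 1)) = m := by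
    rw [Int.cast_sub, Int.cast_natCast, h0, sub_zero]
  have hc' (m : ℤ) : ((m - (k + 1 : ℕ) + 1 : ℤ) : ZMod (k + 1)) = (m + 1 : ℤ) := by
    rw [← hc (m + 1)]; congr 1; ring
  intro m hm
  by_cases h1 : (m : ZMod (k + 1)) = i
  · rw [mem_beads_addCorners_of_eq hk h1] at hm
    rw [mem_beads_addCorners_of_eq hk (by rw [hc, h1])]
    refine hm.imp (h m) fun h2 => ?_
    have := h _ h2
    rwa [sub_right_comm] at this
  by_cases h2 : ((m + 1 : ℤ) : ZMod (k + 1)) = i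
  · rw [mem_beads_addCorners_of_pred hk h2] at hm
    rw [mem_beads_addCorners_of_pred hk (by rw [hc', h2])]
    refine hm.imp (h m) fun h3 => ?_
    have := h _ h3
    rwa [add_sub_right_comm] at this
  · rw [mem_beads_addCorners_of_ne h1 h2] at hm
    rw [mem_beads_addCorners_of_ne (by rwa [hc]) (by rwa [hc'])]
    exact h _ hm

theorem isCore_bot (p : ℕ) : IsCore p ⊥ := fun c hc => absurd hc (YoungDiagram.notMem_bot c)

end Beads

/-! ### Removing all corners of one residue. -/

section RemoveCorners

open Classical in
/-- The shape obtained from `γ` by removing all its removable corners of residue `i`. -/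
noncomputable def removeCorners (k : ℕ) (i : ZMod (k + 1)) (γ : YoungDiagram) : YoungDiagram where
  cells := γ.cells.filter fun c => ¬ (IsRemovable γ c ∧ residue k c = i)
  isLowerSet := by
    rintro ⟨a, b⟩ ⟨a', b'⟩ hle hmem
    obtain ⟨h1, h2⟩ : a' ≤ a ∧ b' ≤ b := hle
    simp only [Finset.coe_filter, Set.mem_ofPred_eq, YoungDiagram.mem_cells] at hmem ⊢
    refine ⟨γ.up_left_mem h1 h2 hmem.1, ?_⟩
    rintro ⟨⟨-, h3, h4⟩, h5⟩
    by_cases he : a' = a ∧ b' = b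
    · obtain ⟨rfl, rfl⟩ := he
      exact hmem.2 ⟨⟨hmem.1, h3, h4⟩, h5⟩
    · by_cases ha : a' = a
      · exact h3 (γ.up_left_mem h1 (by simp only; omega) hmem.1)
      · exact h4 (γ.up_left_mem (by simp only; omega) h2 hmem.1)

theorem mem_removeCorners {k : ℕ} {i : ZMod (k + 1)} {γ : YoungDiagram} {c : ℕ × ℕ} :
    c ∈ removeCorners k i γ ↔ c ∈ γ ∧ ¬ (IsRemovable γ c ∧ residue k c = i) := by
  rw [← YoungDiagram.mem_cells, ← YoungDiagram.mem_cells]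
  simp [removeCorners]

/-- A core with a removable corner of residue `i` has no addable one, so adding corners back
restores the removed cells and nothing else. -/
theorem addCorners_removeCorners {k : ℕ} {i : ZMod (k + 1)} {γ : YoungDiagram}
    (h : IsCore (k + 1) γ) (hr : HasRemovable k i γ) :
    addCorners k i (removeCorners k i γ) = γ := by
  have hna := h.not_hasAddable hr
  ext ⟨a, b⟩
  simp only [YoungDiagram.mem_cells, mem_addCorners]
  constructor
  · rintro (h1 | ⟨⟨h1, h2, h3⟩, h4⟩)
    · exact (mem_removeCorners.1 h1).1
    · by_contra hc
      exact hna ⟨(a, b), ⟨hc, h2.imp_right fun h => (mem_removeCorners.1 h).1,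
        h3.imp_right fun h => (mem_removeCorners.1 h).1⟩, h4⟩
  · intro h1
    by_cases h2 : IsRemovable γ (a, b) ∧ residue k (a, b) = i
    · refine Or.inr ⟨⟨fun h3 => (mem_removeCorners.1 h3).2 h2, ?_, ?_⟩, h2.2⟩
      · refine or_iff_not_imp_left.2 fun ha => mem_removeCorners.2
          ⟨γ.up_left_mem (by simp) le_rfl h1, fun h3 => h3.1.2.2 ?_⟩
        simp only at ha ⊢
        rwa [Nat.sub_add_cancel (Nat.pos_of_ne_zero ha)]
      · refine or_iff_not_imp_left.2 fun ha => mem_removeCorners.2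
          ⟨γ.up_left_mem le_rfl (by simp) h1, fun h3 => h3.1.2.1 ?_⟩
        simp only at ha ⊢
        rwa [Nat.sub_add_cancel (Nat.pos_of_ne_zero ha)]
    · exact Or.inl (mem_removeCorners.2 ⟨h1, h2⟩)

theorem residue_right (k : ℕ) (c : ℕ × ℕ) : residue k (c.1, c.2 + 1) = residue k c + 1 := by
  simp only [residue]; push_cast; ring

theorem residue_up (k : ℕ) (c : ℕ × ℕ) : residue k (c.1 + 1, c.2) = residue k c - 1 := by
  simp only [residue]; push_cast; ring

/-- The neighbours of a cell of residue `i` have residues `i ± 1`, so they are not removed. A corner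
of residue `i` left over would already have been a corner of `γ`. -/
theorem not_hasRemovable_removeCorners {k : ℕ} (hk : 0 < k) {i : ZMod (k + 1)} {γ : YoungDiagram} :
    ¬ HasRemovable k i (removeCorners k i γ) := by
  rintro ⟨c, ⟨h1, h2, h3⟩, h4⟩
  have hn := add_one_ne_self hk
  have hc := mem_removeCorners.1 h1
  refine hc.2 ⟨⟨hc.1, fun h => h2 (mem_removeCorners.2 ⟨h, fun h5 => ?_⟩),
    fun h => h3 (mem_removeCorners.2 ⟨h, fun h5 => ?_⟩)⟩, h4⟩
  · rw [residue_right, h4] at h5; exact hn i h5.2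
  · rw [residue_up, h4] at h5; exact hn i (by linear_combination -h5.2)

theorem sw_sub {k : ℕ} (i : ZMod (k + 1)) (m : ℤ) :
    sw k i (m - (k + 1 : ℕ)) = sw k i m - (k + 1 : ℕ) := by
  have h0 : ((m - (k + 1 : ℕ) : ℤ) : ZMod (k + 1)) = m := by
    rw [Int.cast_sub, Int.cast_natCast, ZMod.natCast_self, sub_zero]
  simp only [sw, h0]
  split_ifs <;> ring

theorem IsFlush.sw {k : ℕ} {B : Set ℤ} (h : IsFlush (k + 1) B) (i : ZMod (k + 1)) :
    IsFlush (k + 1) {m | sw k i m ∈ B} := by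
  intro m hm
  show AffineGroth.sw k i _ ∈ B
  rw [sw_sub]
  exact h _ hm

/-- Adding the corners back is the swap `sw k i` on the abacus, so removing them is the same
involution, which preserves flushness. -/
theorem IsCore.removeCorners {k : ℕ} (hk : 0 < k) {i : ZMod (k + 1)} {γ : YoungDiagram}
    (h : IsCore (k + 1) γ) (hr : HasRemovable k i γ) : IsCore (k + 1) (removeCorners k i γ) := by
  have h1 := beads_addCorners_of_not_canLower (i := i) (γ := AffineGroth.removeCorners k i γ) hk
    (fun hl => not_hasRemovable_removeCorners (γ := γ) hk (hasRemovable_iff.2 hl))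
  rw [addCorners_removeCorners h hr] at h1
  rw [isCore_iff (by omega)] at h ⊢
  have h2 : beads (AffineGroth.removeCorners k i γ) = {m | AffineGroth.sw k i m ∈ beads γ} := by
    ext m
    show _ ↔ AffineGroth.sw k i m ∈ beads γ
    rw [h1]
    show _ ↔ AffineGroth.sw k i (AffineGroth.sw k i m) ∈ beads (AffineGroth.removeCorners k i γ)
    rw [sw_sw hk]
  rw [h2]
  exact h.sw i

theorem removeCorners_lt {k : ℕ} {i : ZMod (k + 1)} {γ : YoungDiagram} (hr : HasRemovable k i γ) :
    (removeCorners k i γ).card < γ.card := by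
  obtain ⟨c, hc, hi⟩ := hr
  refine Finset.card_lt_card ⟨fun d hd => (mem_removeCorners.1 hd).1, fun h => ?_⟩
  exact (mem_removeCorners.1 (h (hc.1 : c ∈ γ.cells))).2 ⟨hc, hi⟩

theorem exists_hasRemovable {γ : YoungDiagram} (k : ℕ) (h : γ ≠ ⊥) : ∃ i, HasRemovable k i γ := by
  have hne : γ.cells.Nonempty := by
    rw [Finset.nonempty_iff_ne_empty]
    intro he; apply h; ext c; simp [he]
  obtain ⟨c, hc, hmax⟩ := γ.cells.exists_max_image (fun c => c.1 + c.2) hne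
  refine ⟨_, c, ⟨hc, fun h1 => ?_, fun h1 => ?_⟩, rfl⟩
  · have := hmax _ h1; simp only at this; omega
  · have := hmax _ h1; simp only at this; omega

end RemoveCorners

end AffineGroth

namespace AffineGroth

/-! ### Grassmannian elements and cores. -/

section Orbit

variable {k : ℕ} (hk : 0 < k)

/-- The abacus `w ∅`. -/
def orbitBeads (w : AffineSymm k) : Set ℤ := {m | perm hk w⁻¹ m < 0}

theorem mem_orbitBeads_simple_mul (i : ZMod (k + 1)) (w : AffineSymm k) (m : ℤ) :
    m ∈ orbitBeads hk ((affineSystem k).simple i * w) ↔ sw k i m ∈ orbitBeads hk w := by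
  show perm hk _ m < 0 ↔ perm hk _ (sw k i m) < 0
  rw [mul_inv_rev, map_mul, CoxeterSystem.inv_simple, perm_simple, end_mul_apply]

theorem orbitBeads_one (m : ℤ) : m ∈ orbitBeads hk 1 ↔ m < 0 := by
  show perm hk _ m < 0 ↔ _
  rw [inv_one, map_one, end_one_apply]

/-- Generators other than `s_0` preserve the set of negative integers, so the abacus depends only on
the coset of `w`. -/
theorem orbitBeads_mul_simple {l : ZMod (k + 1)} (hl : l ≠ 0) (w : AffineSymm k) :
    orbitBeads hk (w * (affineSystem k).simple l) = orbitBeads hk w := by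
  ext m
  show perm hk _ m < 0 ↔ perm hk _ m < 0
  rw [mul_inv_rev, map_mul, CoxeterSystem.inv_simple, perm_simple, end_mul_apply,
    sw_lt_iff hl.symm (by simp)]

theorem isFlush_orbitBeads (w : AffineSymm k) : IsFlush (k + 1) (orbitBeads hk w) := by
  obtain ⟨ω, rfl⟩ := (affineSystem k).wordProd_surjective w
  induction ω with
  | nil =>
    intro m hm
    rw [CoxeterSystem.wordProd_nil, orbitBeads_one] at *
    push_cast; omega
  | cons i ω ih =>
    have : orbitBeads hk ((affineSystem k).wordProd (i :: ω))
        = {m | sw k i m ∈ orbitBeads hk ((affineSystem k).wordProd ω)} := by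
      ext m
      rw [CoxeterSystem.wordProd_cons, mem_orbitBeads_simple_mul]; rfl
    rw [this]
    exact ih.sw i

theorem canLower_simple_mul_iff (i : ZMod (k + 1)) (w : AffineSymm k) :
    CanLower k i (orbitBeads hk ((affineSystem k).simple i * w)) ↔ CanRaise k i (orbitBeads hk w) := by
  refine exists_congr fun m => and_congr_right fun hm => ?_
  rw [mem_orbitBeads_simple_mul, mem_orbitBeads_simple_mul, sw_eq hm, sw_pred hk
    (by push_cast; rw [hm]), sub_add_cancel]

/-- Elements without right descents other than `0`. -/
def IsMinRep (w : AffineSymm k) : Prop := ∀ l, l ≠ 0 → ¬ (affineSystem k).IsRightDescent w l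

theorem IsMinRep.simple_mul {w : AffineSymm k} (h : IsMinRep w) {i : ZMod (k + 1)}
    (hi : (affineSystem k).IsLeftDescent w i) : IsMinRep ((affineSystem k).simple i * w) := by
  intro l hl hd
  apply h l hl
  have h1 := (affineSystem k).isLeftDescent_iff.1 hi
  have h2 := (affineSystem k).isRightDescent_iff.1 hd
  have h3 := (affineSystem k).length_mul_le ((affineSystem k).simple i)
    ((affineSystem k).simple i * w * (affineSystem k).simple l)
  rw [CoxeterSystem.length_simple, ← mul_assoc, ← mul_assoc,
    CoxeterSystem.simple_mul_simple_self, one_mul] at h3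
  rw [CoxeterSystem.IsRightDescent]
  omega

theorem not_isMinRep_of_eq {w : AffineSymm k} {i l : ZMod (k + 1)} (hl : l ≠ 0)
    (he : (affineSystem k).simple i * w = w * (affineSystem k).simple l)
    (hi : ¬ (affineSystem k).IsLeftDescent w i) :
    ¬ IsMinRep ((affineSystem k).simple i * w) := by
  intro h
  apply h l hl
  have := (affineSystem k).not_isLeftDescent_iff.1 hi
  rw [CoxeterSystem.IsRightDescent, he, CoxeterSystem.simple_mul_simple_cancel_right, ← he]
  omega

/-- How the residue `i` behaves on the abacus of `w` determines how `s i` acts on `w`. -/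
def Controls (w : AffineSymm k) (i : ZMod (k + 1)) : Prop :=
  (CanLower k i (orbitBeads hk w) → (affineSystem k).IsLeftDescent w i) ∧
    (¬ CanLower k i (orbitBeads hk w) → ¬ CanRaise k i (orbitBeads hk w) →
      ∃ l, l ≠ 0 ∧ (affineSystem k).simple i * w = w * (affineSystem k).simple l)

theorem mem_iff_of_fixed {i : ZMod (k + 1)} {B : Set ℤ} (h : ¬ CanLower k i B)
    (h' : ¬ CanRaise k i B) {m : ℤ} (hm : (m : ZMod (k + 1)) = i) : m ∈ B ↔ m - 1 ∈ B := by
  constructor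
  · intro h1; by_contra h2; exact h ⟨m, hm, h1, h2⟩
  · intro h1; by_contra h2; exact h' ⟨m, hm, h1, h2⟩

theorem fixed_of_mem_iff {i : ZMod (k + 1)} {B : Set ℤ}
    (h : ∀ m : ℤ, (m : ZMod (k + 1)) = i → (m ∈ B ↔ m - 1 ∈ B)) :
    ¬ CanLower k i B ∧ ¬ CanRaise k i B := by
  constructor
  · rintro ⟨m, hm, h1, h2⟩; exact h2 ((h m hm).1 h1)
  · rintro ⟨m, hm, h1, h2⟩; exact h2 ((h m hm).2 h1)

variable {hk} in
-- On the shorter element `s_j w` the residue `j` cannot be lowered, since it is not a descent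
-- there, and it cannot be inert, since then `w = s_j w · s_l` would not be minimal. Hence it can be
-- raised there, which means that it can be lowered on `w`.
theorem Controls.canLower {w : AffineSymm k} {j : ZMod (k + 1)}
    (h : Controls hk ((affineSystem k).simple j * w) j) (hw : IsMinRep w)
    (hj : (affineSystem k).IsLeftDescent w j) : CanLower k j (orbitBeads hk w) := by
  have hn := (affineSystem k).isLeftDescent_iff_not_isLeftDescent_mul.1 hj
  have hcancel : (affineSystem k).simple j * ((affineSystem k).simple j * w) = w :=
    (affineSystem k).simple_mul_simple_cancel_left j
  rw [← hcancel, canLower_simple_mul_iff]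
  by_contra hr
  by_cases hl : CanLower k j (orbitBeads hk ((affineSystem k).simple j * w))
  · exact hn (h.1 hl)
  · obtain ⟨l, hl, he⟩ := h.2 hl hr
    apply not_isMinRep_of_eq hl he hn
    rwa [hcancel]

theorem isLeftDescent_of_length {w v : AffineSymm k} {i : ZMod (k + 1)}
    (h : (affineSystem k).simple i * w = v)
    (hl : (affineSystem k).length v < (affineSystem k).length w) :
    (affineSystem k).IsLeftDescent w i := by
  rwa [CoxeterSystem.IsLeftDescent, h]

theorem simple_mul_simple_comm {i j : ZMod (k + 1)} (hij : i ≠ j) (h1 : j ≠ i + 1)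
    (h2 : i ≠ j + 1) (w : AffineSymm k) :
    (affineSystem k).simple i * ((affineSystem k).simple j * w)
      = (affineSystem k).simple j * ((affineSystem k).simple i * w) := by
  rw [← mul_assoc, ← mul_assoc, simple_comm_of_eq_two (affineSystem k) (by
    rw [affineMatrix_apply, if_neg hij, if_neg (by tauto)])]

theorem simple_braid (hk2 : 2 ≤ k) (i : ZMod (k + 1)) (w : AffineSymm k) :
    (affineSystem k).simple i * ((affineSystem k).simple (i + 1) * ((affineSystem k).simple i * w))
      = (affineSystem k).simple (i + 1) *
        ((affineSystem k).simple i * ((affineSystem k).simple (i + 1) * w)) := by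
  have h : affineMatrix k i (i + 1) = 3 := by
    rw [affineMatrix_apply, if_neg (by simpa using one_ne_zero_zmod (by omega : 1 ≤ k)),
      if_pos (Or.inl rfl), if_neg (by omega)]
  have := simple_braid_of_eq_three (affineSystem k) h
  simp only [← mul_assoc]
  rw [this]

/-- Strong induction through a left descent `j` of `w`. If `i` and `j` commute, the residue `i` sees
the same abacus on `w` and on `s_j w`. If they are adjacent, the situation of `i` on `w` is that of
`j` on `s_i s_j w`, which is shorter by two, and the braid relation transports the conclusion back.
When `i` can be raised there is nothing to prove. -/
theorem controls (n : ℕ) : ∀ w : AffineSymm k, (affineSystem k).length w = n → IsMinRep w →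
    ∀ i, Controls hk w i := by
  have h0 := one_ne_zero_zmod hk
  induction n using Nat.strong_induction_on with
  | _ n ih =>
  intro w hn hw i
  by_cases hw1 : w = 1
  · subst hw1
    constructor
    · rintro ⟨m, -, h1, h2⟩
      rw [orbitBeads_one] at h1 h2; omega
    -- On the empty abacus only the residue `0` can be raised.
    · intro _ h2
      refine ⟨i, ?_, by simp⟩
      rintro rfl
      apply h2
      exact ⟨0, by simp, by rw [orbitBeads_one]; omega, by rw [orbitBeads_one]; omega⟩
  obtain ⟨j, hj⟩ := (affineSystem k).exists_leftDescent_of_ne_one hw1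
  have hlen := (affineSystem k).isLeftDescent_iff.1 hj
  have hw' := hw.simple_mul hj
  have hjl : CanLower k j (orbitBeads hk w) := (ih _ (by omega) _ rfl hw' j).canLower hw hj
  have hfl := isFlush_orbitBeads hk w
  have hB' (m : ℤ) : m ∈ orbitBeads hk ((affineSystem k).simple j * w)
      ↔ sw k j m ∈ orbitBeads hk w := mem_orbitBeads_simple_mul hk j w m
  have hww' : w = (affineSystem k).simple j * ((affineSystem k).simple j * w) :=
    ((affineSystem k).simple_mul_simple_cancel_left j).symm
  have ih' := fun i => ih _ (by omega) _ rfl hw' i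
  by_cases hij : i = j
  · subst hij; exact ⟨fun _ => hj, fun h => absurd hjl h⟩
  by_cases hraise : CanRaise k i (orbitBeads hk w)
  · exact ⟨fun h => absurd hraise (hfl.not_canRaise h), fun _ h => absurd hraise h⟩
  have hup {m : ℤ} (hm : (m : ZMod (k + 1)) = i) (h : m - 1 ∈ orbitBeads hk w) :
      m ∈ orbitBeads hk w := by
    by_contra hc; exact hraise ⟨m, hm, h, hc⟩
  by_cases hc : j ≠ i + 1 ∧ i ≠ j + 1
  · -- commuting case
    have hs (m : ℤ) (hm : (m : ZMod (k + 1)) = i) : sw k j m = m ∧ sw k j (m - 1) = m - 1 := by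
      constructor
      · exact sw_of_ne (by rwa [hm]) (by rw [hm]; intro h; apply hc.1; rw [h]; ring)
      · refine sw_of_ne ?_ ?_
        · push_cast; rw [hm]; intro h; apply hc.2; rw [← h]; ring
        · push_cast; rw [hm]; intro h; exact hij (sub_left_injective h)
    have hB (m : ℤ) (hm : (m : ZMod (k + 1)) = i) :
        (m ∈ orbitBeads hk ((affineSystem k).simple j * w) ↔ m ∈ orbitBeads hk w) ∧
        (m - 1 ∈ orbitBeads hk ((affineSystem k).simple j * w) ↔ m - 1 ∈ orbitBeads hk w) := by
      rw [hB', hB', (hs m hm).1, (hs m hm).2]; tauto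
    have hlow : CanLower k i (orbitBeads hk ((affineSystem k).simple j * w))
        ↔ CanLower k i (orbitBeads hk w) :=
      exists_congr fun m => and_congr_right fun hm => by rw [(hB m hm).1, (hB m hm).2]
    have hraise : CanRaise k i (orbitBeads hk ((affineSystem k).simple j * w))
        ↔ CanRaise k i (orbitBeads hk w) :=
      exists_congr fun m => and_congr_right fun hm => by rw [(hB m hm).1, (hB m hm).2]
    have hcomm := simple_mul_simple_comm hij hc.1 hc.2 ((affineSystem k).simple j * w)
    rw [← hww'] at hcomm
    rw [Controls, ← hlow, ← hraise]
    constructor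
    · intro h
      have hd := (affineSystem k).isLeftDescent_iff.1 ((ih' i).1 h)
      refine isLeftDescent_of_length hcomm ?_
      have := (affineSystem k).length_mul_le ((affineSystem k).simple j)
        ((affineSystem k).simple i * ((affineSystem k).simple j * w))
      rw [CoxeterSystem.length_simple] at this
      omega
    · intro h h'
      obtain ⟨l, hl, he⟩ := (ih' i).2 h h'
      exact ⟨l, hl, by rw [hcomm, he, ← mul_assoc, ← hww']⟩
  · have hadj : i = j + 1 ∨ j = i + 1 := by tauto
    -- the two conclusions, from lowerability of `i` and then `j`
    have hbr : 2 ≤ k → (affineSystem k).simple i * ((affineSystem k).simple j *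
        ((affineSystem k).simple i * ((affineSystem k).simple i * ((affineSystem k).simple j * w))))
        = (affineSystem k).simple j * ((affineSystem k).simple i * ((affineSystem k).simple j *
        ((affineSystem k).simple i * ((affineSystem k).simple j * w)))) := by
      intro hk2
      rcases hadj with rfl | rfl
      · exact (simple_braid hk2 j _).symm
      · exact simple_braid hk2 i _
    have hB'' (m : ℤ) : m ∈ orbitBeads hk
        ((affineSystem k).simple i * ((affineSystem k).simple j * w))
        ↔ sw k j (sw k i m) ∈ orbitBeads hk w := by
      rw [mem_orbitBeads_simple_mul, hB']
    have hcan : (affineSystem k).simple i * ((affineSystem k).simple i *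
        ((affineSystem k).simple j * w)) = (affineSystem k).simple j * w :=
      (affineSystem k).simple_mul_simple_cancel_left i
    -- From here on the braid relation reads `s_i w = s_j s_i (s_j (s_i s_j w))`.
    rw [hcan, ← hww'] at hbr
    have concl (hk2 : 2 ≤ k)
        (h1 : CanLower k i (orbitBeads hk ((affineSystem k).simple j * w)))
        (h2 : (CanLower k i (orbitBeads hk w) ∧ CanLower k j (orbitBeads hk
          ((affineSystem k).simple i * ((affineSystem k).simple j * w)))) ∨
          (¬ CanLower k i (orbitBeads hk w) ∧ ¬ CanLower k j (orbitBeads hk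
          ((affineSystem k).simple i * ((affineSystem k).simple j * w))) ∧
          ¬ CanRaise k j (orbitBeads hk
          ((affineSystem k).simple i * ((affineSystem k).simple j * w))))) :
        Controls hk w i := by
      have hd1 := (ih' i).1 h1
      have hl1 := (affineSystem k).isLeftDescent_iff.1 hd1
      have ih'' := ih _ (by omega) _ rfl (hw'.simple_mul hd1) j
      rcases h2 with ⟨h2, h3⟩ | ⟨h2, h3, h4⟩
      · refine ⟨fun _ => ?_, fun h => absurd h2 h⟩
        have hl2 := (affineSystem k).isLeftDescent_iff.1 (ih''.1 h3)
        refine isLeftDescent_of_length (hbr hk2) ?_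
        have e1 := (affineSystem k).length_mul_le ((affineSystem k).simple j)
          ((affineSystem k).simple i * ((affineSystem k).simple j *
            ((affineSystem k).simple i * ((affineSystem k).simple j * w))))
        have e2 := (affineSystem k).length_mul_le ((affineSystem k).simple i)
          ((affineSystem k).simple j *
            ((affineSystem k).simple i * ((affineSystem k).simple j * w)))
        rw [CoxeterSystem.length_simple] at e1 e2
        omega
      · refine ⟨fun h => absurd h h2, fun _ _ => ?_⟩
        obtain ⟨l, hl, he⟩ := ih''.2 h3 h4
        refine ⟨l, hl, ?_⟩
        rw [hbr hk2, he, ← mul_assoc, ← mul_assoc,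
          mul_assoc _ ((affineSystem k).simple i) (_ * _), hcan, ← hww']
    -- There is no braid relation for `k = 1`. That case contradicts flushness: the two neighbours
    -- of a position are then congruent and differ by `k + 1`, while the upper one would be occupied
    -- and the lower one free.
    have hk2 : k = 1 ∨ 2 ≤ k := by omega
    rcases hadj with rfl | rfl
    · -- `i = j + 1`
      obtain ⟨m, hm, hm1, hm2⟩ := hjl
      have c1 : ((m + 1 : ℤ) : ZMod (k + 1)) = j + 1 := by push_cast; rw [hm]
      -- The residue `j` is lowerable at `m`; as `j + 1` cannot be raised, the bead at `m` must be
      -- blocked by one at `m + 1`. On `s_j w` this makes `m + 1` lowerable.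
      have hr : m + 1 ∈ orbitBeads hk w := hup c1 (by rwa [add_sub_cancel_right])
      rcases hk2 with rfl | hk2
      · exfalso
        refine hm2 (hfl.mem_of_le hr (by omega) ?_)
        push_cast
        have : (1 + 1 : ZMod (1 + 1)) = 0 := by decide
        linear_combination -this
      have h2 := two_ne_zero_zmod hk2
      have s1 (x : ℤ) (hx : (x : ZMod (k + 1)) = j) : sw k j (x + 1) = x + 1 := by
        refine sw_of_ne ?_ ?_ <;> push_cast <;> rw [hx]
        · intro h; apply h0; linear_combination h
        · intro h; apply h2; linear_combination h
      have s2 (x : ℤ) (hx : (x : ZMod (k + 1)) = j) : sw k (j + 1) (x - 1) = x - 1 := by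
        refine sw_of_ne ?_ ?_ <;> push_cast <;> rw [hx]
        · intro h; apply h2; linear_combination -h
        · intro h; apply h0; linear_combination -h
      have s3 (x : ℤ) (hx : (x : ZMod (k + 1)) = j) : sw k (j + 1) x = x + 1 :=
        sw_pred hk (by rw [hx]; ring)
      have s4 (x : ℤ) (hx : (x : ZMod (k + 1)) = j) : sw k j (x - 1) = x := by
        rw [sw_pred hk (by push_cast; rw [hx])]; ring
      refine concl hk2 ⟨m + 1, c1, ?_, ?_⟩ ?_
      · rwa [hB', s1 m hm]
      · rwa [hB', add_sub_cancel_right, sw_eq hm]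
      -- The composite of the two swaps carries the pair `x - 1, x` with `x ≡ j` to the pair `x, x +
      -- 1`, so residue `j` on `s_i s_j w` behaves as residue `i = j + 1` on `w`.
      · by_cases hl : CanLower k (j + 1) (orbitBeads hk w)
        · left
          refine ⟨hl, ?_⟩
          obtain ⟨n, hn1, hn2, hn3⟩ := hl
          have hn' : ((n - 1 : ℤ) : ZMod (k + 1)) = j := by push_cast; rw [hn1]; ring
          refine ⟨n - 1, hn', ?_, ?_⟩
          · rwa [hB'', s3 _ hn', s1 _ hn', sub_add_cancel]
          · rwa [hB'', s2 _ hn', s4 _ hn']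
        · right
          refine ⟨hl, fixed_of_mem_iff fun x hx => ?_⟩
          rw [hB'', hB'', s3 x hx, s1 x hx, s2 x hx, s4 x hx,
            mem_iff_of_fixed hl hraise (by push_cast; rw [hx]), add_sub_cancel_right]
    · -- `j = i + 1`
      obtain ⟨m, hm, hm1, hm2⟩ := hjl
      obtain ⟨x, rfl⟩ : ∃ x, m = x + 1 := ⟨m - 1, by ring⟩
      rw [add_sub_cancel_right] at hm2
      have c1 : (x : ZMod (k + 1)) = i := by
        push_cast at hm; linear_combination hm
      -- Mirror image of the previous case: the gap at `x` must be preceded by a gap at `x - 1`,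
      -- since otherwise `i` could be raised.
      have hr : x - 1 ∉ orbitBeads hk w := fun h => hm2 (hup c1 h)
      rcases hk2 with rfl | hk2
      · exfalso
        refine hr (hfl.mem_of_le hm1 (by omega) ?_)
        push_cast
        have : (1 + 1 : ZMod (1 + 1)) = 0 := by decide
        linear_combination -this
      have h2 := two_ne_zero_zmod hk2
      have s1 (x : ℤ) (hx : (x : ZMod (k + 1)) = i) : sw k (i + 1) (x - 1) = x - 1 := by
        refine sw_of_ne ?_ ?_ <;> push_cast <;> rw [hx]
        · intro h; apply h2; linear_combination -h
        · intro h; apply h0; linear_combination -h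
      have s2 (x : ℤ) (hx : (x : ZMod (k + 1)) = i) : sw k i (x + 1) = x + 1 := by
        refine sw_of_ne ?_ ?_ <;> push_cast <;> rw [hx]
        · intro h; apply h0; linear_combination h
        · intro h; apply h2; linear_combination h
      have s3 (x : ℤ) (hx : (x : ZMod (k + 1)) = i) : sw k (i + 1) x = x + 1 :=
        sw_pred hk (by rw [hx]; ring)
      have s4 (x : ℤ) (hx : (x : ZMod (k + 1)) = i) : sw k (i + 1) (x + 1) = x := by
        rw [sw_eq (by push_cast; rw [hx])]; ring
      refine concl hk2 ⟨x, c1, ?_, ?_⟩ ?_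
      · rwa [hB', s3 x c1]
      · rwa [hB', s1 x c1]
      · by_cases hl : CanLower k i (orbitBeads hk w)
        · left
          refine ⟨hl, ?_⟩
          obtain ⟨n, hn1, hn2, hn3⟩ := hl
          refine ⟨n + 1, by push_cast; rw [hn1], ?_, ?_⟩
          · rwa [hB'', s2 _ hn1, s4 _ hn1]
          · rwa [hB'', add_sub_cancel_right, sw_eq hn1, s1 _ hn1]
        · right
          refine ⟨hl, fixed_of_mem_iff fun y hy => ?_⟩
          obtain ⟨x, rfl⟩ : ∃ x, y = x + 1 := ⟨y - 1, by ring⟩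
          have hx : (x : ZMod (k + 1)) = i := by
            push_cast at hy; linear_combination hy
          rw [hB'', hB'', add_sub_cancel_right, s2 x hx, s4 x hx, sw_eq hx, s1 x hx,
            mem_iff_of_fixed hl hraise hx]

theorem isLeftDescent_of_canLower {w : AffineSymm k} (hw : IsMinRep w) {i : ZMod (k + 1)}
    (h : CanLower k i (orbitBeads hk w)) : (affineSystem k).IsLeftDescent w i :=
  (controls hk _ w rfl hw i).1 h

theorem canLower_of_isLeftDescent {w : AffineSymm k} (hw : IsMinRep w) {i : ZMod (k + 1)}
    (h : (affineSystem k).IsLeftDescent w i) : CanLower k i (orbitBeads hk w) :=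
  (controls hk _ _ rfl (hw.simple_mul h) i).canLower hw h

theorem simple_mul_eq_of_fixed {w : AffineSymm k} (hw : IsMinRep w) {i : ZMod (k + 1)}
    (h : ¬ CanLower k i (orbitBeads hk w)) (h' : ¬ CanRaise k i (orbitBeads hk w)) :
    ∃ l, l ≠ 0 ∧ (affineSystem k).simple i * w = w * (affineSystem k).simple l :=
  (controls hk _ w rfl hw i).2 h h'

theorem not_isLeftDescent_of_canRaise {w : AffineSymm k} (hw : IsMinRep w) {i : ZMod (k + 1)}
    (h : CanRaise k i (orbitBeads hk w)) : ¬ (affineSystem k).IsLeftDescent w i := fun hd =>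
  (isFlush_orbitBeads hk w).not_canRaise (canLower_of_isLeftDescent hk hw hd) h

/-- Otherwise exchange gives `s_i w = w s_l` with `l ≠ 0`, so `s_i w` and `w` have the same abacus.
But `i` can be lowered on the first and raised on the second. -/
theorem isMinRep_simple_mul_of_canRaise {w : AffineSymm k} (hw : IsMinRep w) {i : ZMod (k + 1)}
    (h : CanRaise k i (orbitBeads hk w)) : IsMinRep ((affineSystem k).simple i * w) := by
  intro l hl hd
  have hR := hw l hl
  have he := simple_mul_eq_mul_simple (affineSystem k) (not_isLeftDescent_of_canRaise hk hw h) hR hd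
  have h1 := (canLower_simple_mul_iff hk i w).2 h
  rw [he, orbitBeads_mul_simple hk hl] at h1
  exact not_isLeftDescent_of_canRaise hk hw h (isLeftDescent_of_canLower hk hw h1)

/-- Left descents of minimal representatives are visible on the abacus, so a descent of `w` can be
stripped from both elements at once. -/
theorem eq_of_orbitBeads_eq {w w' : AffineSymm k} (hw : IsMinRep w) (hw' : IsMinRep w')
    (h : orbitBeads hk w = orbitBeads hk w') : w = w' := by
  induction hn : (affineSystem k).length w using Nat.strong_induction_on generalizing w w' with
  | _ n ih =>
  have aux {w : AffineSymm k} (hw : IsMinRep w) (h : orbitBeads hk 1 = orbitBeads hk w) :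
      1 = w := by
    by_contra hne
    obtain ⟨j, hj⟩ := (affineSystem k).exists_leftDescent_of_ne_one (Ne.symm hne)
    have := canLower_of_isLeftDescent hk hw hj
    rw [← h] at this
    obtain ⟨m, -, h1, h2⟩ := this
    rw [orbitBeads_one] at h1 h2; omega
  by_cases h1 : w = 1
  · subst h1; exact aux hw' h
  obtain ⟨j, hj⟩ := (affineSystem k).exists_leftDescent_of_ne_one h1
  have hj' : (affineSystem k).IsLeftDescent w' j :=
    isLeftDescent_of_canLower hk hw' (h ▸ canLower_of_isLeftDescent hk hw hj)
  have := ih _ (hn ▸ hj) (hw.simple_mul hj) (hw'.simple_mul hj') (by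
    ext m; rw [mem_orbitBeads_simple_mul, mem_orbitBeads_simple_mul, h]) rfl
  exact mul_left_cancel this

theorem IsGrassmannian.isMinRep {w : AffineSymm k} (h : IsGrassmannian k w) : IsMinRep w := by
  intro l hl hd
  have := h _ (Subgroup.subset_closure ⟨l, hl, rfl⟩)
  rw [CoxeterSystem.IsRightDescent] at hd
  omega

theorem orbitBeads_mul_of_mem {v : AffineSymm k} (w : AffineSymm k)
    (hv : v ∈ Subgroup.closure {s | ∃ i : ZMod (k + 1), i ≠ 0 ∧ s = (affineSystem k).simple i}) :
    orbitBeads hk (w * v) = orbitBeads hk w := by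
  induction hv using Subgroup.closure_induction generalizing w with
  | mem x hx => obtain ⟨l, hl, rfl⟩ := hx; exact orbitBeads_mul_simple hk hl w
  | one => rw [mul_one]
  | mul x y _ _ hx hy => rw [← mul_assoc, hy, hx]
  | inv x _ hx => rw [← hx (w * x⁻¹), inv_mul_cancel_right]

/-- An element of least length in the coset of `w` is a minimal representative with the same abacus,
hence equal to `w`. -/
theorem IsMinRep.isGrassmannian (hk : 0 < k) {w : AffineSymm k} (h : IsMinRep w) :
    IsGrassmannian k w := by
  let W₀ := Subgroup.closure {s | ∃ i : ZMod (k + 1), i ≠ 0 ∧ s = (affineSystem k).simple i}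
  obtain ⟨v, hmin⟩ := exists_minimalFor_of_wellFoundedLT (fun v => v ∈ W₀)
    (fun v => (affineSystem k).length (w * v)) ⟨1, one_mem _⟩
  have hle (u) (hu : u ∈ W₀) : (affineSystem k).length (w * v) ≤ (affineSystem k).length (w * u) :=
    (le_total _ _).elim id fun h => hmin.2 hu h
  have hv : IsMinRep (w * v) := by
    refine IsGrassmannian.isMinRep fun u hu => ?_
    rw [mul_assoc]
    exact hle _ (mul_mem hmin.1 hu)
  have he := eq_of_orbitBeads_eq hk h hv (orbitBeads_mul_of_mem hk w hmin.1).symm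
  intro u hu
  have := hle u hu
  rwa [← he] at this

/-- The shape of a minimal representative, read off from any reduced word. -/
theorem beads_foldr {ω : List (ZMod (k + 1))} (hω : (affineSystem k).IsReduced ω)
    (hw : IsMinRep ((affineSystem k).wordProd ω)) :
    beads (ω.foldr (addCorners k) ⊥) = orbitBeads hk ((affineSystem k).wordProd ω) := by
  induction ω with
  | nil =>
    ext m
    rw [List.foldr_nil, mem_beads_bot, CoxeterSystem.wordProd_nil, orbitBeads_one]
  | cons i ω ih =>
    have hr : (affineSystem k).IsReduced ω := by simpa using hω.drop 1
    have hd : (affineSystem k).IsLeftDescent ((affineSystem k).wordProd (i :: ω)) i := by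
      rw [CoxeterSystem.IsLeftDescent, hω.eq, CoxeterSystem.wordProd_cons,
        CoxeterSystem.simple_mul_simple_cancel_left, hr.eq]
      simp
    have hm := hw.simple_mul hd
    have hl := canLower_of_isLeftDescent hk hw hd
    rw [CoxeterSystem.wordProd_cons, canLower_simple_mul_iff] at hl
    rw [CoxeterSystem.wordProd_cons, CoxeterSystem.simple_mul_simple_cancel_left] at hm
    rw [← ih hr hm] at hl
    have hfl : IsFlush (k + 1) (beads (ω.foldr (addCorners k) ⊥)) := by
      rw [ih hr hm]; exact isFlush_orbitBeads hk _
    rw [List.foldr_cons, beads_addCorners_of_not_canLower hk fun h => hfl.not_canRaise h hl]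
    ext m
    rw [CoxeterSystem.wordProd_cons, mem_orbitBeads_simple_mul, ← ih hr hm]
    rfl

theorem beads_shapeOf {w : AffineSymm k} (hw : IsMinRep w) :
    beads (shapeOf k w) = orbitBeads hk w := by
  have h := ((affineSystem k).exists_isReduced w).choose_spec
  have := beads_foldr hk h.1 (by rwa [← h.2])
  rw [← h.2] at this
  exact this

theorem isCore_shapeOf (hk : 0 < k) {w : AffineSymm k} (hw : IsMinRep w) :
    IsCore (k + 1) (shapeOf k w) := by
  rw [isCore_iff (by omega), beads_shapeOf hk hw]
  exact isFlush_orbitBeads hk w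

theorem shapeOf_injOn (hk : 0 < k) {w w' : AffineSymm k} (hw : IsMinRep w) (hw' : IsMinRep w')
    (h : shapeOf k w = shapeOf k w') : w = w' :=
  eq_of_orbitBeads_eq hk hw hw' (by rw [← beads_shapeOf hk hw, ← beads_shapeOf hk hw', h])

/-- Induction on the number of cells: remove all corners of one residue, take the element of the
smaller core, and multiply it by that generator. -/
theorem exists_shapeOf_eq (hk : 0 < k) {γ : YoungDiagram} (h : IsCore (k + 1) γ) :
    ∃ w, IsMinRep w ∧ shapeOf k w = γ := by
  induction hn : γ.card using Nat.strong_induction_on generalizing γ with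
  | _ n ih =>
  by_cases h0 : γ = ⊥
  · have h1 : IsMinRep (1 : AffineSymm k) := by
      intro l hl hd
      rw [CoxeterSystem.IsRightDescent, CoxeterSystem.length_one] at hd
      omega
    refine ⟨1, h1, beads_injective ?_⟩
    ext m
    rw [beads_shapeOf hk h1, orbitBeads_one, h0, mem_beads_bot]
  obtain ⟨i, hi⟩ := exists_hasRemovable k h0
  obtain ⟨w, hw, he⟩ := ih _ (hn ▸ removeCorners_lt hi) (h.removeCorners hk hi) rfl
  have hnl : ¬ CanLower k i (beads (removeCorners k i γ)) := fun h =>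
    not_hasRemovable_removeCorners hk (hasRemovable_iff.2 h)
  have hadd := addCorners_removeCorners h hi
  have hr : CanRaise k i (orbitBeads hk w) := by
    rw [← beads_shapeOf hk hw, he]
    by_contra hc
    rw [← hasAddable_iff] at hc
    rw [addCorners_eq_self hc] at hadd
    have := removeCorners_lt hi
    rw [hadd] at this
    exact lt_irrefl _ this
  have hw' := isMinRep_simple_mul_of_canRaise hk hw hr
  refine ⟨_, hw', beads_injective ?_⟩
  rw [beads_shapeOf hk hw', ← hadd, beads_addCorners_of_not_canLower hk hnl, ← he,
    beads_shapeOf hk hw]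
  ext m
  rw [mem_orbitBeads_simple_mul]; rfl

theorem grassmannianOf_spec (hk : 0 < k) {lam : YoungDiagram} (h : IsCore (k + 1) (coreOf k lam)) :
    IsMinRep (grassmannianOf k lam) ∧ shapeOf k (grassmannianOf k lam) = coreOf k lam := by
  obtain ⟨w, hw, he⟩ := exists_shapeOf_eq hk h
  have hex : ∃ w ∈ {w | IsGrassmannian k w}, shapeOf k w = coreOf k lam :=
    ⟨w, hw.isGrassmannian hk, he⟩
  exact ⟨IsGrassmannian.isMinRep (Function.invFunOn_mem hex), Function.invFunOn_eq hex⟩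

end Orbit

end AffineGroth

namespace AffineGroth

/-! ### Bounded partitions and cores. -/

section BoundedRows

open Classical in
/-- The number of free positions among the `k` positions before `y`. -/
noncomputable def gapCount (k : ℕ) (B : Set ℤ) (y : ℤ) : ℕ :=
  ((Finset.Ico (y - k) y).filter (· ∉ B)).card

theorem gap_strictMono (γ : YoungDiagram) : StrictMono fun j : ℕ => (j : ℤ) - γ.colLen j := by
  intro i j h
  have := γ.colLen_anti i j h.le
  simp only; omega

/-- The cells of row `r` correspond to the gaps before its bead, with distance equal to hook length.
-/
theorem boundedRows_eq (k : ℕ) (γ : YoungDiagram) (r : ℕ) :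
    boundedRows k γ r = gapCount k (beads γ) (bead γ r) := by
  classical
  refine Finset.card_bij (fun j _ => (j : ℤ) - γ.colLen j) ?_ ?_ ?_
  · intro j hj
    rw [Finset.mem_filter, Finset.mem_range, ← YoungDiagram.mem_iff_lt_rowLen] at hj
    rw [Finset.mem_filter, Finset.mem_Ico]
    have h1 := hookLength_eq hj.1
    have h2 := mem_of_gap_lt_bead.1 hj.1
    exact ⟨⟨by omega, h2⟩, not_mem_beads_iff.2 ⟨j, rfl⟩⟩
  · intro i _ j _ h
    exact (gap_strictMono γ).injective h
  · intro x hx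
    rw [Finset.mem_filter, Finset.mem_Ico] at hx
    obtain ⟨j, rfl⟩ := not_mem_beads_iff.1 hx.2
    have hmem : (r, j) ∈ γ := mem_of_gap_lt_bead.2 hx.1.2
    have h1 := hookLength_eq hmem
    refine ⟨j, ?_, rfl⟩
    rw [Finset.mem_filter, Finset.mem_range, ← YoungDiagram.mem_iff_lt_rowLen]
    exact ⟨hmem, by omega⟩

open Classical in
theorem gapCount_add_one (k : ℕ) (B : Set ℤ) (y : ℤ) :
    gapCount k B (y + 1) + (if y - k ∈ B then 0 else 1)
      = gapCount k B y + (if y ∈ B then 0 else 1) := by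
  have h1 : Finset.Ico (y - k) (y + 1) = insert y (Finset.Ico (y - k) y) := by
    ext x; simp only [Finset.mem_insert, Finset.mem_Ico]; omega
  have h2 : Finset.Ico (y - k) (y + 1) = insert (y - k) (Finset.Ico (y + 1 - k) (y + 1)) := by
    ext x; simp only [Finset.mem_insert, Finset.mem_Ico]; omega
  have e1 : ((Finset.Ico (y - k) (y + 1)).filter (· ∉ B)).card
      = gapCount k B y + (if y ∈ B then 0 else 1) := by
    rw [h1, Finset.filter_insert]
    split_ifs with h
    · rfl
    · rw [Finset.card_insert_of_notMem (by simp)]; rfl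
  have e2 : ((Finset.Ico (y - k) (y + 1)).filter (· ∉ B)).card
      = gapCount k B (y + 1) + (if y - k ∈ B then 0 else 1) := by
    rw [h2, Finset.filter_insert]
    split_ifs with h
    · rfl
    · rw [Finset.card_insert_of_notMem (by simp)]; rfl
  rw [← e1, e2]

/-- The shape obtained by inserting a new bottom row of length `L`. -/
def prependRow (L : ℕ) (γ : YoungDiagram) (h : γ.rowLen 0 ≤ L) : YoungDiagram where
  cells := (Finset.range L).image (fun j => (0, j)) ∪ γ.cells.image fun c => (c.1 + 1, c.2)
  isLowerSet := by
    rintro ⟨a, b⟩ ⟨a', b'⟩ hle hmem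
    obtain ⟨h1, h2⟩ : a' ≤ a ∧ b' ≤ b := hle
    simp only [Finset.coe_union, Finset.coe_image, Set.mem_union, Set.mem_image, Finset.mem_coe,
      Finset.mem_range, Prod.mk.injEq, YoungDiagram.mem_cells, Prod.exists] at hmem ⊢
    have hb : b < L := by
      rcases hmem with ⟨j, h3, -, h4⟩ | ⟨c, d, h3, h4, h5⟩
      · omega
      · have := YoungDiagram.mem_iff_lt_rowLen.1 (γ.up_left_mem (Nat.zero_le _) le_rfl h3)
        omega
    cases a' with
    | zero => exact Or.inl ⟨b', by omega, rfl, rfl⟩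
    | succ a' =>
      rcases hmem with ⟨j, h3, h5, h4⟩ | ⟨c, d, h3, h4, h5⟩
      · omega
      · exact Or.inr ⟨a', b', γ.up_left_mem (by omega) (by omega) h3, rfl, rfl⟩

theorem rowLen_prependRow_zero {L : ℕ} {γ : YoungDiagram} (h : γ.rowLen 0 ≤ L) :
    (prependRow L γ h).rowLen 0 = L := by
  refine eq_of_forall_lt_iff fun c => ?_
  rw [← YoungDiagram.mem_iff_lt_rowLen, ← YoungDiagram.mem_cells]
  simp [prependRow]

theorem rowLen_prependRow_succ {L : ℕ} {γ : YoungDiagram} (h : γ.rowLen 0 ≤ L) (r : ℕ) :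
    (prependRow L γ h).rowLen (r + 1) = γ.rowLen r := by
  refine eq_of_forall_lt_iff fun c => ?_
  rw [← YoungDiagram.mem_iff_lt_rowLen, ← YoungDiagram.mem_iff_lt_rowLen,
    ← YoungDiagram.mem_cells]
  simp [prependRow]

theorem mem_beads_prependRow {L : ℕ} {γ : YoungDiagram} (h : γ.rowLen 0 ≤ L) (m : ℤ) :
    m ∈ beads (prependRow L γ h) ↔ m = L - 1 ∨ m + 1 ∈ beads γ := by
  constructor
  · rintro ⟨r, rfl⟩
    cases r with
    | zero => left; rw [bead, rowLen_prependRow_zero]; simp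
    | succ r => right; exact ⟨r, by rw [bead, bead, rowLen_prependRow_succ]; push_cast; ring⟩
  · rintro (rfl | ⟨r, hr⟩)
    · exact ⟨0, by rw [bead, rowLen_prependRow_zero]; simp⟩
    · refine ⟨r + 1, ?_⟩
      rw [bead] at hr
      rw [bead, rowLen_prependRow_succ]; push_cast; omega

theorem gapCount_prependRow {k L : ℕ} {γ : YoungDiagram} (h : γ.rowLen 0 ≤ L) {y : ℤ}
    (hy : y ≤ L) : gapCount k (beads (prependRow L γ h)) (y - 1) = gapCount k (beads γ) y := by
  classical
  refine Finset.card_bij (fun x _ => x + 1) ?_ ?_ ?_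
  · intro x hx
    simp only [Finset.mem_filter, Finset.mem_Ico, mem_beads_prependRow, not_or] at hx ⊢
    exact ⟨by omega, hx.2.2⟩
  · intro x _ y _ h; omega
  · intro x hx
    simp only [Finset.mem_filter, Finset.mem_Ico] at hx
    refine ⟨x - 1, ?_, by ring⟩
    simp only [Finset.mem_filter, Finset.mem_Ico, mem_beads_prependRow, not_or, sub_add_cancel]
    exact ⟨by omega, by omega, hx.2⟩

/-- The core is built by inserting rows at the bottom. The new bead has to be placed beyond all
others so that it sees `f 0` gaps among the `k` preceding positions and flushness is kept. -/
theorem exists_boundedRows_eq {k : ℕ} (hk : 0 < k) (n : ℕ) : ∀ f : ℕ → ℕ, Antitone f → f n = 0 →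
    f 0 ≤ k → ∃ γ, IsCore (k + 1) γ ∧ boundedRows k γ = f := by
  classical
  induction n with
  | zero =>
    intro f hf h0 _
    refine ⟨⊥, isCore_bot _, funext fun r => ?_⟩
    have h1 : f r ≤ f 0 := hf (Nat.zero_le r)
    have h2 : (⊥ : YoungDiagram).rowLen r = 0 := by
      by_contra h
      exact YoungDiagram.notMem_bot _ (YoungDiagram.mem_iff_lt_rowLen.2 (Nat.pos_of_ne_zero h))
    simp [boundedRows, h2]; omega
  | succ n ih =>
    intro f hf h0 hk0
    obtain ⟨γ, hcore, hγ⟩ := ih (fun r => f (r + 1)) (fun a b h => hf (by omega)) h0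
      ((hf (Nat.zero_le 1)).trans hk0)
    have hfl := (isCore_iff (by omega)).1 hcore
    have hb0 : gapCount k (beads γ) (bead γ 0) ≤ f 0 := by
      rw [← boundedRows_eq, hγ]; exact hf (by omega)
    have hgap : ∀ y : ℤ, bead γ 0 < y → y ∉ beads γ := by
      rintro y hy ⟨r, rfl⟩
      rw [bead_lt_iff] at hy; omega
    -- The number of gaps in the window grows by at most one per step and reaches `k ≥ f 0` far out.
    -- At the first `y` where it attains `f 0`, the position that has just left the window, `y - (k
    -- + 1)`, is occupied, which is what flushness requires.
    obtain ⟨L, hL1, hL2, hL3⟩ : ∃ y : ℤ, bead γ 0 + 1 ≤ y ∧ y - (k + 1 : ℕ) ∈ beads γ ∧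
        gapCount k (beads γ) y = f 0 := by
      have hex : ∃ t : ℕ, f 0 ≤ gapCount k (beads γ) (bead γ 0 + 1 + t) := by
        refine ⟨k, ?_⟩
        rw [gapCount, Finset.filter_true_of_mem, Int.card_Ico]
        · omega
        · intro x hx
          rw [Finset.mem_Ico] at hx
          exact hgap x (by omega)
      have h1 := Nat.find_spec hex
      have h2 := fun s (hs : s < Nat.find hex) => Nat.find_min hex hs
      generalize Nat.find hex = t at h1 h2
      cases t with
      | zero =>
        -- The first step passes over the last bead and so cannot increase the count; equality with
        -- `f 0` then means that the position leaving the window is a bead.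
        have h3 := gapCount_add_one k (beads γ) (bead γ 0)
        have h5 : bead γ 0 ∈ beads γ := ⟨0, rfl⟩
        rw [if_pos h5] at h3
        rw [Nat.cast_zero, add_zero] at h1
        split_ifs at h3 with h4
        · refine ⟨bead γ 0 + 1, le_rfl, ?_, by omega⟩
          rwa [show bead γ 0 + 1 - ((k + 1 : ℕ) : ℤ) = bead γ 0 - k by push_cast; ring]
        · omega
      | succ t =>
        have h3 := gapCount_add_one k (beads γ) (bead γ 0 + 1 + t)
        have h5 := h2 t (by omega)
        have h6 := hgap (bead γ 0 + 1 + t) (by omega)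
        rw [if_neg h6] at h3
        rw [Nat.cast_succ, ← add_assoc] at h1
        split_ifs at h3 with h4
        · refine ⟨bead γ 0 + 1 + t + 1, by omega, ?_, by omega⟩
          rwa [show bead γ 0 + 1 + t + 1 - ((k + 1 : ℕ) : ℤ) = bead γ 0 + 1 + t - k by
            push_cast; ring]
        · omega
    have hbead0 : bead γ 0 + 1 = γ.rowLen 0 := by rw [bead]; simp
    lift L to ℕ using by omega
    have hle : γ.rowLen 0 ≤ L := by omega
    refine ⟨prependRow L γ hle, ?_, funext fun r => ?_⟩
    · rw [isCore_iff (by omega)]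
      intro m hm
      rw [mem_beads_prependRow] at hm ⊢
      right
      rcases hm with rfl | hm
      · rwa [show ((L : ℤ) - 1 - (k + 1 : ℕ) + 1) = L - (k + 1 : ℕ) by ring]
      · rw [show (m - (k + 1 : ℕ) + 1) = m + 1 - (k + 1 : ℕ) by ring]
        exact hfl _ hm
    · rw [boundedRows_eq]
      cases r with
      | zero =>
        rw [bead, rowLen_prependRow_zero, Nat.cast_zero, sub_zero, gapCount_prependRow hle le_rfl,
          hL3]
      | succ r =>
        have : bead (prependRow L γ hle) (r + 1) = bead γ r - 1 := by
          rw [bead, bead, rowLen_prependRow_succ]; push_cast; ring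
        rw [this, gapCount_prependRow, ← boundedRows_eq, hγ]
        have := (bead_strictAnti γ).antitone (Nat.zero_le r)
        omega

/-- Surjectivity suffices here: `coreOf` is some core with the prescribed row counts. -/
theorem coreOf_spec {k : ℕ} (hk : 0 < k) {lam : YoungDiagram} (h : lam.rowLen 0 ≤ k) :
    IsCore (k + 1) (coreOf k lam) ∧ boundedRows k (coreOf k lam) = lam.rowLen := by
  have h0 : lam.rowLen (lam.colLen 0) = 0 := by
    by_contra hc
    have := YoungDiagram.mem_iff_lt_colLen.1
      (YoungDiagram.mem_iff_lt_rowLen.2 (Nat.pos_of_ne_zero hc))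
    omega
  have hex : ∃ γ ∈ {γ | IsCore (k + 1) γ}, boundedRows k γ = lam.rowLen :=
    exists_boundedRows_eq hk _ lam.rowLen (fun a b => lam.rowLen_anti a b) h0 h
  exact ⟨Function.invFunOn_mem hex, Function.invFunOn_eq hex⟩

/-- The number of cells of hook length at most `k`. -/
def shortHooks (k : ℕ) (γ : YoungDiagram) : ℕ := (γ.cells.filter fun c => hookLength γ c ≤ k).card

theorem card_eq_shortHooks {k : ℕ} {lam γ : YoungDiagram} (h : boundedRows k γ = lam.rowLen) :
    lam.card = shortHooks k γ := by
  have key (μ : YoungDiagram) (s : Finset (ℕ × ℕ)) (hs : s ⊆ μ.cells) (N : ℕ)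
      (hN : μ.colLen 0 ≤ N) : s.card = ∑ r ∈ Finset.range N, (s.filter (·.1 = r)).card := by
    refine Finset.card_eq_sum_card_fiberwise fun c hc => ?_
    have : (c.1, c.2) ∈ μ := hs hc
    have := YoungDiagram.mem_iff_lt_colLen.1 (μ.up_left_mem le_rfl (Nat.zero_le _) this)
    simp only [Finset.coe_range, Set.mem_Iio]; omega
  rw [YoungDiagram.card, shortHooks, key lam _ subset_rfl _ (le_max_left _ (γ.colLen 0)),
    key γ _ (Finset.filter_subset _ _) _ (le_max_right (lam.colLen 0) _)]
  refine Finset.sum_congr rfl fun r _ => ?_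
  have h1 : (lam.cells.filter (·.1 = r)).card = lam.rowLen r := (lam.rowLen_eq_card).symm
  rw [h1, ← h, boundedRows]
  refine Finset.card_bij (fun j _ => (r, j)) ?_ ?_ ?_
  · intro j hj
    simp only [Finset.mem_filter, Finset.mem_range, YoungDiagram.mem_cells,
      YoungDiagram.mem_iff_lt_rowLen] at hj ⊢
    exact ⟨hj, trivial⟩
  · intro i _ j _ he; exact (Prod.mk.inj he).2
  · rintro ⟨a, j⟩ hj
    simp only [Finset.mem_filter, YoungDiagram.mem_cells,
      YoungDiagram.mem_iff_lt_rowLen] at hj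
    obtain ⟨hj, rfl⟩ := hj
    exact ⟨j, by simpa using hj, rfl⟩

end BoundedRows

/-! ### How the number of short hooks changes when corners are added. -/

section ShortPairs

/-- A bead and a gap at most `k` positions before it. -/
def shortPairs (k : ℕ) (B : Set ℤ) : Set (ℤ × ℤ) :=
  {p | p.1 ∈ B ∧ p.2 ∉ B ∧ p.2 < p.1 ∧ p.1 ≤ p.2 + k}

theorem shortPairs_beads (k : ℕ) (γ : YoungDiagram) : shortPairs k (beads γ) =
    (fun c : ℕ × ℕ => (bead γ c.1, (c.2 : ℤ) - γ.colLen c.2)) ''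
      (γ.cells.filter fun c => hookLength γ c ≤ k : Finset (ℕ × ℕ)) := by
  ext ⟨y, x⟩
  constructor
  · rintro ⟨⟨r, rfl⟩, hx, h1, h2⟩
    obtain ⟨j, rfl⟩ := not_mem_beads_iff.1 hx
    have hmem := mem_of_gap_lt_bead.2 h1
    have := hookLength_eq hmem
    simp only at h2
    refine ⟨(r, j), ?_, rfl⟩
    rw [Finset.mem_coe, Finset.mem_filter]
    exact ⟨hmem, by omega⟩
  · rintro ⟨⟨r, j⟩, h, he⟩
    rw [Finset.mem_coe, Finset.mem_filter] at h
    obtain ⟨rfl, rfl⟩ := Prod.mk.inj he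
    have h1 := mem_of_gap_lt_bead.1 h.1
    have := hookLength_eq h.1
    have h3 := h.2
    refine ⟨⟨r, rfl⟩, not_mem_beads_iff.2 ⟨j, rfl⟩, h1, ?_⟩
    simp only; omega

theorem finite_shortPairs (k : ℕ) (γ : YoungDiagram) : (shortPairs k (beads γ)).Finite := by
  rw [shortPairs_beads]; exact (Finset.finite_toSet _).image _

theorem ncard_shortPairs (k : ℕ) (γ : YoungDiagram) :
    (shortPairs k (beads γ)).ncard = shortHooks k γ := by
  rw [shortPairs_beads, Set.ncard_image_of_injective, Set.ncard_coe_finset]; rfl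
  rintro ⟨r, j⟩ ⟨r', j'⟩ h
  obtain ⟨h1, h2⟩ := Prod.mk.inj h
  exact Prod.ext ((bead_strictAnti γ).injective h1) ((gap_strictMono γ).injective h2)

theorem eq_of_cast_eq {k : ℕ} {a b : ℤ} (h : (a : ZMod (k + 1)) = b) (h1 : a < b + (k + 1))
    (h2 : b < a + (k + 1)) : a = b := by
  rw [ZMod.intCast_eq_intCast_iff_dvd_sub] at h
  have := Int.eq_zero_of_abs_lt_dvd h (by push_cast; rw [abs_lt]; constructor <;> linarith)
  omega

theorem natCast_zmod_eq_neg_one (k : ℕ) : (k : ZMod (k + 1)) = -1 := by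
  have := ZMod.natCast_self (k + 1)
  push_cast at this
  linear_combination this

/-- A swap moves each position by at most one, so shortness of the pair of a gap `x` and a bead `y`
can change only at the ends of the range. The pair with `y ≡ i - 1` and `x = y - k` is stretched to
distance `k + 2`. The non-short pair with `y ≡ i - 1` and `x = y + 1` becomes short at distance one.
The reverse changes are excluded by `hA` and `hB`. -/
theorem sw_short_iff {k : ℕ} (hk : 0 < k) {i : ZMod (k + 1)} {x y : ℤ}
    (hA : (y : ZMod (k + 1)) = i → x ≠ y - 1) (hB : (y : ZMod (k + 1)) = i → x ≠ y - (k + 2)) :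
    (x < y ∧ y ≤ x + k ∧ ¬ (((y + 1 : ℤ) : ZMod (k + 1)) = i ∧ x = y - k)) ↔
      (sw k i x < sw k i y ∧ sw k i y ≤ sw k i x + k ∧
        ¬ ((sw k i y : ZMod (k + 1)) = i ∧ sw k i x = sw k i y - 1)) := by
  have h0 := one_ne_zero_zmod hk
  have hcast := natCast_zmod_eq_neg_one k
  have hi : i - 1 ≠ i := fun h => h0 (by linear_combination -h)
  have cne {a b : ℤ} {u v : ZMod (k + 1)} (ha : (a : ZMod (k + 1)) = u)
      (hb : (b : ZMod (k + 1)) = v) (huv : u ≠ v) : a ≠ b := by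
    rintro rfl; exact huv (ha.symm.trans hb)
  by_cases y1 : (y : ZMod (k + 1)) = i
  · have N1 : ((y + 1 : ℤ) : ZMod (k + 1)) ≠ i := by
      push_cast; rw [y1]; exact add_one_ne_self hk i
    have N2 : ((y - 1 : ℤ) : ZMod (k + 1)) ≠ i := by push_cast; rw [y1]; exact hi
    simp only [sw_eq y1, N1, N2, false_and, not_false_eq_true, and_true]
    by_cases x1 : (x : ZMod (k + 1)) = i
    · rw [sw_eq x1]; omega
    by_cases x2 : (x : ZMod (k + 1)) = i - 1
    · rw [sw_pred hk x2]
      constructor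
      · rintro ⟨h1, h2⟩
        have := eq_of_cast_eq (k := k) (a := y) (b := x + 1) (by push_cast; rw [y1, x2]; ring)
          (by omega) (by omega)
        exact absurd (by omega) (hA y1)
      · rintro ⟨h1, h2⟩
        have := eq_of_cast_eq (k := k) (a := y) (b := x + k + 2)
          (by push_cast; rw [y1, x2, hcast]; ring) (by omega) (by omega)
        exact absurd (by omega) (hB y1)
    · rw [sw_of_ne x1 x2]
      have n1 : x ≠ y - 1 := fun h => x2 (by rw [h]; push_cast; rw [y1])
      have n2 : x ≠ y - k - 1 := fun h => x1 (by rw [h]; push_cast; rw [y1, hcast]; ring)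
      omega
  by_cases y2 : (y : ZMod (k + 1)) = i - 1
  · have N1 : ((y + 1 : ℤ) : ZMod (k + 1)) = i := by push_cast; rw [y2]; ring
    simp only [sw_pred hk y2, N1, true_and]
    by_cases x1 : (x : ZMod (k + 1)) = i
    · rw [sw_eq x1]
      constructor
      · rintro ⟨h1, h2, h3⟩
        have := eq_of_cast_eq (k := k) (a := y) (b := x + k)
          (by push_cast; rw [y2, x1, hcast]; ring) (by omega) (by omega)
        omega
      · rintro ⟨h1, h2, h3⟩
        have := eq_of_cast_eq (k := k) (a := y) (b := x - 1) (by push_cast; rw [y2, x1])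
          (by omega) (by omega)
        omega
    · have n1 : x ≠ y - k := fun h => x1 (by rw [h]; push_cast; rw [y2, hcast]; ring)
      by_cases x2 : (x : ZMod (k + 1)) = i - 1
      · rw [sw_pred hk x2]
        have n2 : x + 1 ≠ y := fun h => hi (by rw [← y2, ← h]; push_cast; rw [x2]; ring)
        omega
      · rw [sw_of_ne x1 x2]
        have n2 : x ≠ y := by rintro rfl; exact x2 y2
        omega
  · have N1 : ((y + 1 : ℤ) : ZMod (k + 1)) ≠ i := fun h => y2 (by rw [← h]; push_cast; ring)
    simp only [sw_of_ne y1 y2, N1, y1, false_and, not_false_eq_true, and_true]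
    by_cases x1 : (x : ZMod (k + 1)) = i
    · rw [sw_eq x1]
      have n1 : y ≠ x + k := fun h => y2 (by rw [h]; push_cast; rw [x1, hcast]; ring)
      have n2 : y ≠ x := by rintro rfl; exact y1 x1
      omega
    by_cases x2 : (x : ZMod (k + 1)) = i - 1
    · rw [sw_pred hk x2]
      have n1 : y ≠ x + 1 := fun h => y1 (by rw [h]; push_cast; rw [x2]; ring)
      have n2 : y ≠ x + k + 1 := fun h => y2 (by rw [h]; push_cast; rw [x2, hcast]; ring)
      omega
    · rw [sw_of_ne x1 x2]

/-- Raising the beads of residue `i` creates exactly one new short pair. -/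
theorem ncard_shortPairs_sw {k : ℕ} (hk : 0 < k) {i : ZMod (k + 1)} {B : Set ℤ}
    (hfl : IsFlush (k + 1) B) (hfin : (shortPairs k B).Finite)
    (hfin' : (shortPairs k {m | sw k i m ∈ B}).Finite) (hr : CanRaise k i B) :
    (shortPairs k {m | sw k i m ∈ B}).ncard = (shortPairs k B).ncard + 1 := by
  have hl : ¬ CanLower k i B := fun h => hfl.not_canRaise h hr
  have h0 := one_ne_zero_zmod hk
  have hcast := natCast_zmod_eq_neg_one k
  set B' : Set ℤ := {m | sw k i m ∈ B} with hB'
  have hm' (m : ℤ) : sw k i m ∈ B' ↔ m ∈ B := by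
    show sw k i (sw k i m) ∈ B ↔ _
    rw [sw_sw hk]
  -- `R` is the set of raisable positions. The pairs in `A` are those created by raising, one for
  -- each element of `R`. The pairs in `E` are those destroyed, one for each element of `R` except
  -- the least; hence the net gain of one.
  let R : Set ℤ := {y | (y : ZMod (k + 1)) = i ∧ y - 1 ∈ B ∧ y ∉ B}
  let A : Set (ℤ × ℤ) := {p | (p.1 : ZMod (k + 1)) = i ∧ p.2 = p.1 - 1}
  let E : Set (ℤ × ℤ) := {p | ((p.1 + 1 : ℤ) : ZMod (k + 1)) = i ∧ p.2 = p.1 - k}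
  have hAR : shortPairs k B' ∩ A = (fun y : ℤ => (y, y - 1)) '' R := by
    ext ⟨y, x⟩
    constructor
    · rintro ⟨⟨h1, h2, -, -⟩, h3, h4⟩
      simp only at h1 h2 h3 h4
      subst h4
      refine ⟨y, ⟨h3, ?_, ?_⟩, rfl⟩
      · have : sw k i y ∈ B := h1
        rwa [sw_eq h3] at this
      · have : sw k i (y - 1) ∉ B := h2
        rwa [sw_pred hk (by push_cast; rw [h3]), sub_add_cancel] at this
    · rintro ⟨z, ⟨h1, h2, h3⟩, he⟩
      obtain ⟨rfl, rfl⟩ := Prod.mk.inj he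
      refine ⟨⟨?_, ?_, by simp, by simp only; omega⟩, h1, rfl⟩
      · show sw k i z ∈ B
        rwa [sw_eq h1]
      · show sw k i (z - 1) ∉ B
        rwa [sw_pred hk (by push_cast; rw [h1]), sub_add_cancel]
  have hRfin : R.Finite := by
    refine Set.Finite.of_finite_image (f := fun y : ℤ => (y, y - 1)) ?_
      (fun a _ b _ h => (Prod.mk.inj h).1)
    rw [← hAR]; exact hfin'.inter_of_left _
  obtain ⟨y₀, hy₀, hmin⟩ := Set.exists_min_image R id hRfin hr
  have hper (y : ℤ) : ((y - (k + 1) : ℤ) : ZMod (k + 1)) = y := by push_cast; rw [hcast]; ring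
  -- Below the least raisable position the residue class is occupied, so `y₀` destroys no pair. For
  -- any other `z` in `R` the position `z - (k + 1)` is at or above the gap `y₀` of its class, hence
  -- free.
  have hmem₀ : y₀ - (k + 1) ∈ B := by
    by_contra hc
    have := hmin (y₀ - (k + 1)) ⟨by rw [hper, hy₀.1], ?_, hc⟩
    · simp only [id] at this; omega
    · have := hfl _ hy₀.2.1
      rwa [show y₀ - 1 - ((k + 1 : ℕ) : ℤ) = y₀ - (k + 1) - 1 by push_cast; ring] at this
  have hER : shortPairs k B ∩ E = (fun y : ℤ => (y - 1, y - 1 - k)) '' (R \ {y₀}) := by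
    ext ⟨y, x⟩
    constructor
    · rintro ⟨⟨h1, h2, -, -⟩, h3, h4⟩
      simp only at h1 h2 h3 h4
      subst h4
      refine ⟨y + 1, ⟨⟨h3, by simpa using h1, fun h => h2 ?_⟩, ?_⟩, by simp⟩
      · have := hfl _ h
        rwa [show y + 1 - ((k + 1 : ℕ) : ℤ) = y - k by push_cast; ring] at this
      · rintro rfl
        apply h2
        rwa [show y + 1 - ((k : ℤ) + 1) = y - k by ring] at hmem₀
    · rintro ⟨z, ⟨⟨h1, h2, h3⟩, hz⟩, he⟩
      obtain ⟨rfl, rfl⟩ := Prod.mk.inj he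
      refine ⟨⟨h2, ?_, by simp only; omega, by simp only; omega⟩, by simpa using h1, rfl⟩
      intro h4
      have h5 := hmin z ⟨h1, h2, h3⟩
      simp only [id] at h5
      have h6 : y₀ ≤ z - (k + 1) := by
        by_contra hlt
        exact hz (eq_of_cast_eq (k := k) (by rw [h1, hy₀.1]) (by omega) (by omega))
      refine hy₀.2.2 (hfl.mem_of_le h4 (by simp only; omega) ?_)
      rw [hy₀.1, ← h1, ← hper]; congr 1; simp only; ring
  have hmain : shortPairs k B' \ A = (fun p : ℤ × ℤ => (sw k i p.1, sw k i p.2)) '' (shortPairs k B \ E) := by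
    have hiff (y x : ℤ) : (y, x) ∈ shortPairs k B \ E
        ↔ (sw k i y, sw k i x) ∈ shortPairs k B' \ A := by
      simp only [shortPairs, A, E, Set.mem_sdiff, Set.mem_ofPred_eq, hm']
      by_cases hy : y ∈ B
      swap
      · simp only [hy, false_and]
      by_cases hx : x ∈ B
      · simp only [hx, not_true_eq_false, false_and, and_false]
      simp only [hy, hx, not_false_eq_true, true_and, and_assoc]
      refine sw_short_iff hk ?_ ?_
      · rintro h rfl; exact hl ⟨y, h, hy, hx⟩
      · rintro h rfl
        have := hfl _ hy
        refine hl ⟨y - (k + 1 : ℕ), ?_, this, ?_⟩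
        · push_cast; rw [h, hcast]; ring
        · rwa [show y - ((k + 1 : ℕ) : ℤ) - 1 = y - (k + 2) by push_cast; ring]
    ext ⟨y, x⟩
    have := hiff (sw k i y) (sw k i x)
    rw [sw_sw hk, sw_sw hk] at this
    rw [← this]
    constructor
    · intro h; exact ⟨_, h, Prod.ext (sw_sw hk i y) (sw_sw hk i x)⟩
    · rintro ⟨⟨a, b⟩, h, he⟩
      obtain ⟨rfl, rfl⟩ := Prod.mk.inj he
      rwa [sw_sw hk, sw_sw hk]
  have e1 := Set.ncard_inter_add_ncard_sdiff_eq_ncard (shortPairs k B') A hfin'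
  have e2 := Set.ncard_inter_add_ncard_sdiff_eq_ncard (shortPairs k B) E hfin
  rw [hAR, hmain, Set.ncard_image_of_injective, Set.ncard_image_of_injective] at e1
  rw [hER, Set.ncard_image_of_injective] at e2
  have e3 := Set.ncard_sdiff_singleton_add_one hy₀ hRfin
  omega
  · intro a b h; have := (Prod.mk.inj h).1; omega
  · rintro ⟨a, b⟩ ⟨c, d⟩ h
    obtain ⟨h1, h2⟩ := Prod.mk.inj h
    exact Prod.ext (by rw [← sw_sw hk i a, h1, sw_sw hk]) (by rw [← sw_sw hk i b, h2, sw_sw hk])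
  · intro a b h; exact (Prod.mk.inj h).1

theorem shortHooks_addCorners {k : ℕ} (hk : 0 < k) {i : ZMod (k + 1)} {γ : YoungDiagram}
    (h : IsCore (k + 1) γ) (ha : HasAddable k i γ) :
    shortHooks k (addCorners k i γ) = shortHooks k γ + 1 := by
  have hb := beads_addCorners_of_not_canLower (i := i) (γ := γ) hk fun hl =>
    h.not_hasAddable (hasRemovable_iff.2 hl) ha
  have hfin := finite_shortPairs k (addCorners k i γ)
  rw [← ncard_shortPairs, ← ncard_shortPairs]
  rw [hb] at hfin ⊢
  exact ncard_shortPairs_sw hk ((isCore_iff (by omega)).1 h) (finite_shortPairs k γ) hfin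
    (hasAddable_iff.1 ha)

end ShortPairs

end AffineGroth

namespace AffineGroth

/-! ### Words of residues acting on shapes. -/

section Words

variable {k : ℕ}

theorem mem_addCorners_of_residue_ne {i : ZMod (k + 1)} {γ : YoungDiagram} {c : ℕ × ℕ}
    (h : residue k c ≠ i) : c ∈ addCorners k i γ ↔ c ∈ γ := by
  rw [mem_addCorners]; tauto

theorem IsAddable.isRemovable_addCorners (hk : 0 < k) {i : ZMod (k + 1)} {γ : YoungDiagram}
    {c : ℕ × ℕ} (h : IsAddable γ c) (hc : residue k c = i) : IsRemovable (addCorners k i γ) c := by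
  have hn := add_one_ne_self hk
  refine ⟨mem_addCorners.2 (Or.inr ⟨h, hc⟩), fun h1 => ?_, fun h1 => ?_⟩
  · rw [mem_addCorners_of_residue_ne (by rw [residue_right, hc]; exact hn i)] at h1
    exact h.1 (γ.up_left_mem le_rfl (Nat.le_succ _) h1)
  · rw [mem_addCorners_of_residue_ne (by
      rw [residue_up, hc]; intro h2; exact hn i (by linear_combination -h2))] at h1
    exact h.1 (γ.up_left_mem (Nat.le_succ _) le_rfl h1)

theorem HasAddable.hasRemovable_addCorners (hk : 0 < k) {i : ZMod (k + 1)} {γ : YoungDiagram}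
    (h : HasAddable k i γ) : HasRemovable k i (addCorners k i γ) := by
  obtain ⟨c, h, hc⟩ := h
  exact ⟨c, h.isRemovable_addCorners hk hc, hc⟩

/-- The shape obtained by adding corners of the residues in `l`, the first letter first. -/
def addAll (k : ℕ) (γ : YoungDiagram) (l : List (ZMod (k + 1))) : YoungDiagram :=
  l.foldl (fun γ i => addCorners k i γ) γ

/-- Every letter of `l` leaves removable corners of its residue when it is applied. -/
def IsAllowed (k : ℕ) : YoungDiagram → List (ZMod (k + 1)) → Prop
  | _, [] => True
  | γ, i :: l => HasRemovable k i (addCorners k i γ) ∧ IsAllowed k (addCorners k i γ) l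

@[simp] theorem addAll_nil (γ : YoungDiagram) : addAll k γ [] = γ := rfl

@[simp] theorem addAll_cons (γ : YoungDiagram) (i : ZMod (k + 1)) (l : List (ZMod (k + 1))) :
    addAll k γ (i :: l) = addAll k (addCorners k i γ) l := rfl

theorem addAll_append (γ : YoungDiagram) (l l' : List (ZMod (k + 1))) :
    addAll k γ (l ++ l') = addAll k (addAll k γ l) l' := List.foldl_append

theorem isAllowed_append (γ : YoungDiagram) (l l' : List (ZMod (k + 1))) :
    IsAllowed k γ (l ++ l') ↔ IsAllowed k γ l ∧ IsAllowed k (addAll k γ l) l' := by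
  induction l generalizing γ with
  | nil => simp [IsAllowed]
  | cons i l ih => simp [IsAllowed, ih, and_assoc]

theorem IsCore.addAll (hk : 0 < k) {γ : YoungDiagram} (h : IsCore (k + 1) γ)
    (l : List (ZMod (k + 1))) : IsCore (k + 1) (addAll k γ l) := by
  induction l generalizing γ with
  | nil => exact h
  | cons i l ih => exact ih (h.addCorners hk i)

end Words

/-! ### The nil Hecke algebra acting on cores. -/

section Projection

variable {k : ℕ}

open Classical in
/-- The projection of the nil Hecke algebra onto the free module on shapes that keeps the minimal
representatives only. -/
noncomputable def nilProj (k : ℕ) : NilHecke k →ₗ[ℤ] (YoungDiagram →₀ ℤ) :=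
  (nilHeckeBasis k).constr ℤ fun w => if IsMinRep w then Finsupp.single (shapeOf k w) 1 else 0

open Classical in
theorem nilProj_basisElt (w : AffineSymm k) : nilProj k (basisElt k w) =
    if IsMinRep w then Finsupp.single (shapeOf k w) 1 else 0 := by
  rw [← nilHeckeBasis_apply, nilProj, Module.Basis.constr_basis]

theorem isMinRep_one : IsMinRep (1 : AffineSymm k) := by
  intro l hl hd
  rw [CoxeterSystem.IsRightDescent, CoxeterSystem.length_one] at hd
  omega

theorem shapeOf_one (hk : 0 < k) : shapeOf k 1 = ⊥ := by
  refine beads_injective ?_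
  ext m
  rw [beads_shapeOf hk isMinRep_one, orbitBeads_one, mem_beads_bot]

theorem nilProj_one (hk : 0 < k) : nilProj k 1 = Finsupp.single ⊥ 1 := by
  rw [← basisElt_one, nilProj_basisElt, if_pos isMinRep_one, shapeOf_one hk]

/-- Distinct minimal representatives have distinct shapes, so the projection does not mix their
coefficients. -/
theorem repr_eq_nilProj (hk : 0 < k) {w : AffineSymm k} (hw : IsMinRep w) (x : NilHecke k) :
    (nilHeckeBasis k).repr x w = nilProj k x (shapeOf k w) := by
  classical
  have : (Finsupp.lapply w).comp (nilHeckeBasis k).repr.toLinearMap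
      = (Finsupp.lapply (shapeOf k w)).comp (nilProj k) := by
    refine (nilHeckeBasis k).ext fun u => ?_
    simp only [LinearMap.comp_apply, LinearEquiv.coe_coe, Module.Basis.repr_self,
      Finsupp.lapply_apply]
    rw [nilHeckeBasis_apply, nilProj_basisElt, Finsupp.single_apply]
    split_ifs with h1 h2 h2
    · rw [h1, Finsupp.single_eq_same]
    · exact absurd (h1 ▸ hw) h2
    · rw [Finsupp.single_apply, if_neg fun h => h1 (shapeOf_injOn hk h2 hw h)]
    · rfl
  exact LinearMap.congr_fun this x

open Classical in
/-- The operator on shapes induced by left multiplication with `A i`. -/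
noncomputable def shapeOp (k : ℕ) (i : ZMod (k + 1)) : Module.End ℤ (YoungDiagram →₀ ℤ) :=
  Finsupp.linearCombination ℤ fun γ =>
    -- On a core there are two ways to pass this test. If corners were added, the number of short
    -- hooks grows by one and the sign is `+1`. If the corners were already there, the shape is
    -- unchanged and the sign is `-1`.
    if HasRemovable k i (addCorners k i γ) then
      Finsupp.single (addCorners k i γ)
        ((-1) ^ (1 + shortHooks k (addCorners k i γ) + shortHooks k γ)) else 0

open Classical in
theorem shapeOp_single (i : ZMod (k + 1)) (γ : YoungDiagram) (a : ℤ) :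
    shapeOp k i (Finsupp.single γ a) = if HasRemovable k i (addCorners k i γ) then
      Finsupp.single (addCorners k i γ)
        (a * (-1) ^ (1 + shortHooks k (addCorners k i γ) + shortHooks k γ)) else 0 := by
  rw [shapeOp, Finsupp.linearCombination_single]
  split_ifs <;> simp

theorem gen_mul_of_not_isLeftDescent {i : ZMod (k + 1)} {w : AffineSymm k}
    (h : ¬ (affineSystem k).IsLeftDescent w i) :
    gen k i * basisElt k w = basisElt k ((affineSystem k).simple i * w) := by
  have := (affineSystem k).not_isLeftDescent_iff.1 h
  exact (gen_mul_basisElt k i w).1 (by omega)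

theorem gen_mul_of_isLeftDescent {i : ZMod (k + 1)} {w : AffineSymm k}
    (h : (affineSystem k).IsLeftDescent w i) :
    gen k i * basisElt k w = -basisElt k w :=
  (gen_mul_basisElt k i w).2 h

/-- A right descent survives a length-increasing left multiplication. This is why the kernel of
`nilProj` is a left ideal. -/
theorem not_isMinRep_simple_mul {i : ZMod (k + 1)} {w : AffineSymm k} (hw : ¬ IsMinRep w)
    (h : ¬ (affineSystem k).IsLeftDescent w i) :
    ¬ IsMinRep ((affineSystem k).simple i * w) := by
  simp only [IsMinRep, not_forall, not_not] at hw ⊢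
  obtain ⟨l, hl, hd⟩ := hw
  refine ⟨l, hl, ?_⟩
  have h1 := (affineSystem k).not_isLeftDescent_iff.1 h
  have h2 := (affineSystem k).isRightDescent_iff.1 hd
  have h3 := (affineSystem k).length_mul_le ((affineSystem k).simple i)
    (w * (affineSystem k).simple l)
  rw [CoxeterSystem.length_simple] at h3
  rw [CoxeterSystem.IsRightDescent, mul_assoc]
  omega

/-- The three cases of the abacus: a lowerable residue is a left descent and gives `-A_w`; a
raisable one gives the minimal representative of the enlarged core; an inert one gives `s_i w = w
s_l`, which is not minimal and is projected to zero. -/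
theorem nilProj_gen_mul (hk : 0 < k) (i : ZMod (k + 1)) (x : NilHecke k) :
    nilProj k (gen k i * x) = shapeOp k i (nilProj k x) := by
  classical
  have : (nilProj k).comp (LinearMap.mulLeft ℤ (gen k i)) = (shapeOp k i).comp (nilProj k) := by
    refine (nilHeckeBasis k).ext fun w => ?_
    rw [LinearMap.comp_apply, LinearMap.comp_apply, LinearMap.mulLeft_apply, nilHeckeBasis_apply,
      nilProj_basisElt]
    by_cases hw : IsMinRep w
    swap
    · rw [if_neg hw, map_zero]
      by_cases hd : (affineSystem k).IsLeftDescent w i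
      · rw [gen_mul_of_isLeftDescent hd, map_neg, nilProj_basisElt, if_neg hw, neg_zero]
      · rw [gen_mul_of_not_isLeftDescent hd, nilProj_basisElt,
          if_neg (not_isMinRep_simple_mul hw hd)]
    rw [if_pos hw, shapeOp_single, one_mul]
    have hcore := isCore_shapeOf hk hw
    have hbeads := beads_shapeOf hk hw
    by_cases hl : CanLower k i (orbitBeads hk w)
    · have hd := isLeftDescent_of_canLower hk hw hl
      rw [← hbeads, ← hasRemovable_iff] at hl
      rw [addCorners_eq_self (hcore.not_hasAddable hl), if_pos hl, gen_mul_of_isLeftDescent hd,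
        map_neg, nilProj_basisElt, if_pos hw, ← Finsupp.single_neg]
      congr 1
      rw [add_assoc, ← two_mul, pow_add, pow_mul]; norm_num
    by_cases hr : CanRaise k i (orbitBeads hk w)
    · have hd := not_isLeftDescent_of_canRaise hk hw hr
      have hm := isMinRep_simple_mul_of_canRaise hk hw hr
      have hs : shapeOf k ((affineSystem k).simple i * w) = addCorners k i (shapeOf k w) := by
        refine beads_injective ?_
        rw [beads_addCorners_of_not_canLower hk (by rwa [hbeads]), beads_shapeOf hk hm, hbeads]
        ext m
        rw [mem_orbitBeads_simple_mul]; rfl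
      rw [← hbeads, ← hasAddable_iff] at hr
      rw [gen_mul_of_not_isLeftDescent hd, nilProj_basisElt, if_pos hm,
        if_pos (hr.hasRemovable_addCorners hk), hs, shortHooks_addCorners hk hcore hr]
      congr 1
      rw [show 1 + (shortHooks k (shapeOf k w) + 1) + shortHooks k (shapeOf k w)
        = 2 * (1 + shortHooks k (shapeOf k w)) by ring, pow_mul]
      norm_num
    · obtain ⟨l, hl0, he⟩ := simple_mul_eq_of_fixed hk hw hl hr
      have hd : ¬ (affineSystem k).IsLeftDescent w i := by
        intro hd; exact hl (canLower_of_isLeftDescent hk hw hd)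
      rw [gen_mul_of_not_isLeftDescent hd, nilProj_basisElt,
        if_neg (not_isMinRep_of_eq hl0 he hd)]
      rw [← hbeads, ← hasAddable_iff] at hr
      rw [← hbeads, ← hasRemovable_iff] at hl
      rw [addCorners_eq_self hr, if_neg hl]
  exact LinearMap.congr_fun this x

/-- The operator of a word, the first letter acting first. -/
noncomputable def wordOp (k : ℕ) (l : List (ZMod (k + 1))) : Module.End ℤ (YoungDiagram →₀ ℤ) :=
  (l.reverse.map (shapeOp k)).prod

theorem nilProj_prod_mul (hk : 0 < k) (l : List (ZMod (k + 1))) (x : NilHecke k) :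
    nilProj k ((l.map (gen k)).prod * x) = (l.map (shapeOp k)).prod (nilProj k x) := by
  induction l with
  | nil => simp
  | cons i l ih =>
    rw [List.map_cons, List.prod_cons, mul_assoc, nilProj_gen_mul hk, ih, List.map_cons,
      List.prod_cons, Module.End.mul_apply]

open Classical in
-- The short-hook counts of the intermediate shapes occur twice in the exponent, so the sign depends
-- only on the length of the word and on the two end shapes.
theorem wordOp_single (l : List (ZMod (k + 1))) (γ : YoungDiagram) (a : ℤ) :
    wordOp k l (Finsupp.single γ a) = if IsAllowed k γ l then
      Finsupp.single (addAll k γ l)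
        (a * (-1) ^ (l.length + shortHooks k (addAll k γ l) + shortHooks k γ)) else 0 := by
  induction l generalizing γ a with
  | nil =>
    simp [wordOp, IsAllowed]
  | cons i l ih =>
    have : wordOp k (i :: l) = wordOp k l * shapeOp k i := by simp [wordOp]
    rw [this, Module.End.mul_apply, shapeOp_single]
    by_cases h : HasRemovable k i (addCorners k i γ)
    · rw [if_pos h, ih]
      simp only [IsAllowed, h, true_and, addAll_cons]
      split_ifs with h'
      · congr 1
        have e : (-1 : ℤ) ^ (2 * shortHooks k (addCorners k i γ)) = 1 := by
          rw [pow_mul]; norm_num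
        rw [mul_assoc, ← pow_add, List.length_cons, show
          1 + shortHooks k (addCorners k i γ) + shortHooks k γ + (l.length +
            shortHooks k (addAll k (addCorners k i γ) l) + shortHooks k (addCorners k i γ))
          = (l.length + 1 + shortHooks k (addAll k (addCorners k i γ) l) + shortHooks k γ)
            + 2 * shortHooks k (addCorners k i γ) by ring, pow_add, e, mul_one]
      · rfl
    · rw [if_neg h, map_zero, if_neg fun h' => h h'.1]

open Classical in
/-- A cyclically decreasing word of `w`, if there is one, written backwards. -/
noncomputable def cycWord (k : ℕ) (w : AffineSymm k) : List (ZMod (k + 1)) :=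
  if h : ∃ l : List (ZMod (k + 1)), l.Pairwise (CycBefore k) ∧ (affineSystem k).wordProd l = w
  then h.choose.reverse else []

theorem cycWord_spec (hk : 0 < k) {r : ℕ} {w : AffineSymm k} (h : w ∈ cyclicallyDecreasing k r) :
    (cycWord k w).reverse.Pairwise (CycBefore k) ∧
      (affineSystem k).wordProd (cycWord k w).reverse = w ∧ (cycWord k w).length = r := by
  obtain ⟨⟨l, hl, hw⟩, hr⟩ := h
  have hex : ∃ l : List (ZMod (k + 1)), l.Pairwise (CycBefore k) ∧
      (affineSystem k).wordProd l = w := ⟨l, (isCyclicallyDecreasingWord_iff hk).1 hl, hw⟩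
  rw [cycWord, dif_pos hex, List.reverse_reverse]
  refine ⟨hex.choose_spec.1, hex.choose_spec.2, ?_⟩
  have := isReduced_of_nodup hk (hex.choose_spec.1.imp fun h => h.1)
  rw [List.length_reverse, ← this.eq, hex.choose_spec.2, hr]

theorem nilProj_hElt_mul (hk : 0 < k) (r : ℕ) (x : NilHecke k) : nilProj k (hElt k r * x) =
    ∑ w ∈ (finite_cyclicallyDecreasing k r).toFinset, wordOp k (cycWord k w) (nilProj k x) := by
  rw [hElt, Finset.sum_mul, map_sum]
  refine Finset.sum_congr rfl fun w hw => ?_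
  obtain ⟨h1, h2, -⟩ := cycWord_spec hk ((Set.Finite.mem_toFinset _).1 hw)
  rw [wordOp, ← nilProj_prod_mul hk,
    ← basisElt_wordProd (isReduced_of_nodup hk (h1.imp fun h => h.1)), h2]

end Projection

end AffineGroth

namespace AffineGroth

/-! ### The Pieri rule: cyclically decreasing elements and good words. -/

section Pieri

variable {k : ℕ}

/-- The cells marked by the letter at index `t` of the word `l` applied to `γ`. -/
def stepCells (k : ℕ) (γ : YoungDiagram) (l : List (ZMod (k + 1))) (t : ℕ) : Set (ℕ × ℕ) :=
  {c | IsRemovable (addAll k γ (l.take (t + 1))) c ∧ l[t]? = some (residue k c)}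

theorem stepCells_append_left (γ : YoungDiagram) {l l' : List (ZMod (k + 1))} {t : ℕ}
    (ht : t < l.length) : stepCells k γ (l ++ l') t = stepCells k γ l t := by
  simp only [stepCells]
  rw [List.take_append_of_le_length (by omega), List.getElem?_append_left ht]

theorem stepCells_append_right (γ : YoungDiagram) (l l' : List (ZMod (k + 1))) (t : ℕ) :
    stepCells k γ (l ++ l') (l.length + t) = stepCells k (addAll k γ l) l' t := by
  simp only [stepCells]
  rw [add_assoc, List.take_length_add_append, addAll_append, List.getElem?_append_right (by omega),
    Nat.add_sub_cancel_left]

theorem addAll_take_mono (γ : YoungDiagram) (l : List (ZMod (k + 1))) {t u : ℕ} (h : t ≤ u) :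
    addAll k γ (l.take t) ≤ addAll k γ (l.take u) := by
  induction u, h using Nat.le_induction with
  | base => exact le_rfl
  | succ u _ ih =>
    refine ih.trans ?_
    rw [List.take_add_one, addAll_append]
    cases l[u]? with
    | none => exact le_rfl
    | some i => exact le_addCorners k i _

theorem exists_step_of_mem (γ : YoungDiagram) (l : List (ZMod (k + 1))) {t u : ℕ} (h : t ≤ u)
    {c : ℕ × ℕ} (hc : c ∈ addAll k γ (l.take u)) (hc' : c ∉ addAll k γ (l.take t)) :
    ∃ z, t ≤ z ∧ z < u ∧ l[z]? = some (residue k c) := by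
  induction u, h using Nat.le_induction with
  | base => exact absurd hc hc'
  | succ u hu ih =>
    by_cases hm : c ∈ addAll k γ (l.take u)
    · obtain ⟨z, h1, h2, h3⟩ := ih hm
      exact ⟨z, h1, by omega, h3⟩
    · refine ⟨u, hu, by omega, ?_⟩
      rw [List.take_add_one, addAll_append] at hc
      cases hl : l[u]? with
      | none => rw [hl] at hc; exact absurd hc hm
      | some i =>
        rw [hl] at hc
        rcases mem_addCorners.1 hc with h | h
        · exact absurd h hm
        · rw [h.2]

theorem addAll_take_succ (γ : YoungDiagram) {l : List (ZMod (k + 1))} {t : ℕ} {i : ZMod (k + 1)}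
    (h : l[t]? = some i) :
    addAll k γ (l.take (t + 1)) = addCorners k i (addAll k γ (l.take t)) := by
  rw [List.take_add_one, addAll_append, h]; rfl

theorem isAllowed_iff (γ : YoungDiagram) (l : List (ZMod (k + 1))) :
    IsAllowed k γ l ↔ ∀ t < l.length, (stepCells k γ l t).Nonempty := by
  induction l using List.reverseRecOn with
  | nil => simp [IsAllowed]
  | append_singleton l i ih =>
    have hlast : (stepCells k γ (l ++ [i]) l.length).Nonempty ↔ IsAllowed k (addAll k γ l) [i] := by
      have := stepCells_append_right γ l [i] 0
      rw [add_zero] at this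
      rw [this]
      simp [stepCells, IsAllowed, HasRemovable, Set.Nonempty, eq_comm]
    rw [isAllowed_append, ih, ← hlast, List.length_append, List.length_singleton]
    constructor
    · rintro ⟨h1, h2⟩ t ht
      rcases Nat.lt_succ_iff_lt_or_eq.1 ht with h3 | rfl
      · rw [stepCells_append_left γ h3]; exact h1 t h3
      · exact h2
    · intro h
      refine ⟨fun t ht => ?_, h _ (by omega)⟩
      rw [← stepCells_append_left γ ht]; exact h t (by omega)

/-- `c` is a lowest cell of `R`. -/
def IsLowestIn (R : Set (ℕ × ℕ)) (c : ℕ × ℕ) : Prop := c ∈ R ∧ ∀ d ∈ R, c.1 ≤ d.1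

theorem exists_isLowestIn {R : Set (ℕ × ℕ)} (h : R.Nonempty) : ∃ c, IsLowestIn R c := by
  obtain ⟨c, hc⟩ := exists_minimalFor_of_wellFoundedLT (· ∈ R) Prod.fst h
  exact ⟨c, hc.1, fun d hd => (le_total _ _).elim id fun h' => hc.2 hd h'⟩

/-- The cell `c` is read strictly before the cell `d`. -/
def ReadBefore (c d : ℕ × ℕ) : Prop := d.1 < c.1 ∨ (d.1 = c.1 ∧ c.2 < d.2)

/-- The words whose marked cells satisfy the conditions on one alphabet of a tableau. -/
structure IsGood (k : ℕ) (γ : YoungDiagram) (l : List (ZMod (k + 1))) : Prop where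
  allowed : IsAllowed k γ l
  nodup : l.Nodup
  increasing : ∀ t u, t < u → ∀ c d, IsLowestIn (stepCells k γ l t) c →
    IsLowestIn (stepCells k γ l u) d → ReadBefore c d
  horizontal : ∀ t u c d, c ∈ stepCells k γ l t → d ∈ stepCells k γ l u → c.2 = d.2 → c = d

theorem getElem?_inj {α : Type*} {l : List α} (hl : l.Nodup) {t u : ℕ} {a : α} (ht : l[t]? = some a)
    (hu : l[u]? = some a) : t = u := by
  obtain ⟨h1, h2⟩ := List.getElem?_eq_some_iff.1 ht
  obtain ⟨h3, h4⟩ := List.getElem?_eq_some_iff.1 hu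
  exact (hl.getElem_inj_iff).1 (h2.trans h4.symm)

theorem cyc_of_lt {l : List (ZMod (k + 1))} (hl : l.reverse.Pairwise (CycBefore k)) {t u : ℕ}
    {a b : ZMod (k + 1)} (htu : t < u) (ht : l[t]? = some a) (hu : l[u]? = some b) :
    CycBefore k b a := by
  rw [List.pairwise_reverse] at hl
  obtain ⟨h1, rfl⟩ := List.getElem?_eq_some_iff.1 ht
  obtain ⟨h2, rfl⟩ := List.getElem?_eq_some_iff.1 hu
  exact List.pairwise_iff_getElem.1 hl t u h1 h2 htu

theorem nodup_of_cyc {l : List (ZMod (k + 1))} (hl : l.reverse.Pairwise (CycBefore k)) :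
    l.Nodup :=
  List.nodup_reverse.1 (hl.imp fun h => h.1)

/-- If a cell above `c` in its column were marked later, the cell directly above `c`, whose residue
is one less, would have been added after `c` was marked. In words applied from the left, no letter
`j` is followed by `j - 1`. -/
theorem horizontal_of_cyc {γ : YoungDiagram} {l : List (ZMod (k + 1))}
    (hl : l.reverse.Pairwise (CycBefore k)) {t u : ℕ} {c d : ℕ × ℕ} (hc : c ∈ stepCells k γ l t)
    (hd : d ∈ stepCells k γ l u) (hcd : c.2 = d.2) : c = d := by
  wlog htu : t ≤ u generalizing t u c d
  · exact (this hd hc hcd.symm (by omega)).symm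
  have hc1 := addAll_take_mono γ l (by omega : t + 1 ≤ u + 1) hc.1.1
  rcases lt_trichotomy c.1 d.1 with h | h | h
  · exfalso
    have he : (c.1 + 1, c.2) ∈ addAll k γ (l.take (u + 1)) :=
      (addAll k γ (l.take (u + 1))).up_left_mem (by omega) (by omega) hd.1.1
    obtain ⟨z, hz1, hz2, hz3⟩ := exists_step_of_mem γ l (by omega : t + 1 ≤ u + 1) he hc.1.2.2
    have := (cyc_of_lt hl (by omega) hc.2 hz3).2
    rw [residue_up] at this
    exact this (by ring)
  · exact Prod.ext h hcd
  · exfalso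
    exact hd.1.2.2 ((addAll k γ (l.take (u + 1))).up_left_mem (by omega) (by omega) hc1)

theorem IsRemovable.bead_eq {γ : YoungDiagram} {c : ℕ × ℕ} (h : IsRemovable γ c) :
    bead γ c.1 = c.2 - c.1 ∧ γ.rowLen c.1 = c.2 + 1 ∧ bead γ c.1 - 1 ∉ beads γ := by
  obtain ⟨h1, h2⟩ := isRemovable_iff.1 (show IsRemovable γ (c.1, c.2) from h)
  exact ⟨by rw [bead, h1]; push_cast; ring, h1, h2⟩

theorem IsRemovable.eq_of_row {γ : YoungDiagram} {c d : ℕ × ℕ} (hc : IsRemovable γ c)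
    (hd : IsRemovable γ d) (h : c.1 = d.1) : c = d := by
  have h1 := hc.bead_eq.2.1
  have h2 := hd.bead_eq.2.1
  rw [h] at h1
  exact Prod.ext h (by omega)

/-- The cell to the right of `c` has residue `j + 1`. Either it is added at step `u`, so the lowest
cell of that step is no higher, or it is blocked and `c` stays at the end of its row; flushness then
excludes marked corners of residue `j + 1` higher up. Only adjacent letters need this comparison,
because non-adjacent ones may be reordered. -/
theorem readBefore_of_cyc (hk : 0 < k) {γ : YoungDiagram} (hγ : IsCore (k + 1) γ)
    {l : List (ZMod (k + 1))} (hl : l.reverse.Pairwise (CycBefore k)) {t u : ℕ} (htu : t < u)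
    {j : ZMod (k + 1)} (ht : l[t]? = some j) (hu : l[u]? = some (j + 1)) {c d : ℕ × ℕ}
    (hc : IsLowestIn (stepCells k γ l t) c) (hd : IsLowestIn (stepCells k γ l u) d) :
    ReadBefore c d := by
  have hn := nodup_of_cyc hl
  have hcj : residue k c = j := by
    have := hc.1.2; rw [ht] at this; exact (Option.some.inj this).symm
  have hdj : residue k d = j + 1 := by
    have := hd.1.2; rw [hu] at this; exact (Option.some.inj this).symm
  have hcr := hc.1.1
  have hdr := hd.1.1
  have hle := addAll_take_mono γ l (by omega : t + 1 ≤ u + 1)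
  have hle' := addAll_take_mono γ l (by omega : t + 1 ≤ u)
  have hstep := addAll_take_succ γ hu
  have hcore : IsCore (k + 1) (addAll k γ (l.take (u + 1))) := hγ.addAll hk _
  have hf2 : (c.1, c.2 + 1) ∉ addAll k γ (l.take u) := by
    intro hf
    obtain ⟨z, h1, h2, h3⟩ := exists_step_of_mem γ l (by omega : t + 1 ≤ u) hf hcr.2.1
    rw [residue_right, hcj] at h3
    have := getElem?_inj hn h3 hu
    omega
  have hc2 : c ∈ addAll k γ (l.take u) := hle' hcr.1
  by_cases hadd : IsAddable (addAll k γ (l.take u)) (c.1, c.2 + 1)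
  · have hfr := hadd.isRemovable_addCorners hk (i := j + 1) (by rw [residue_right, hcj])
    rw [← hstep] at hfr
    have hfd : (c.1, c.2 + 1) ∈ stepCells k γ l u := ⟨hfr, by rw [hu, residue_right, hcj]⟩
    have h1 := hd.2 _ hfd
    simp only at h1
    rcases h1.lt_or_eq with h2 | h2
    · exact Or.inl h2
    · have := hdr.eq_of_row hfr h2
      rw [this]
      exact Or.inr ⟨rfl, by simp⟩
  -- The blocking cell, below and to the right of `c`, has residue `j + 2`, so step `u` cannot
  -- supply it.
  · have hc0 : c.1 ≠ 0 ∧ (c.1 - 1, c.2 + 1) ∉ addAll k γ (l.take u) := by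
      by_contra h
      rw [not_and_or, not_not, not_not] at h
      exact hadd ⟨hf2, h, Or.inr hc2⟩
    have hres : residue k (c.1 - 1, c.2 + 1) ≠ j + 1 := by
      have : residue k (c.1 - 1 + 1, c.2 + 1) = residue k (c.1 - 1, c.2 + 1) - 1 :=
        residue_up k (c.1 - 1, c.2 + 1)
      rw [Nat.sub_add_cancel (Nat.pos_of_ne_zero hc0.1), residue_right, hcj] at this
      intro h
      rw [h] at this
      exact one_ne_zero_zmod hk (by linear_combination this)
    have hnot : (c.1 - 1, c.2 + 1) ∉ addAll k γ (l.take (u + 1)) := by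
      rw [hstep, mem_addCorners_of_residue_ne hres]; exact hc0.2
    have hnot' : (c.1, c.2 + 1) ∉ addAll k γ (l.take (u + 1)) := fun h =>
      hnot ((addAll k γ (l.take (u + 1))).up_left_mem (by omega) le_rfl h)
    have hc3 : (c.1, c.2) ∈ addAll k γ (l.take (u + 1)) := hle hcr.1
    have hrow : (addAll k γ (l.take (u + 1))).rowLen c.1 = c.2 + 1 := by
      rw [YoungDiagram.mem_iff_lt_rowLen] at hnot' hc3; omega
    by_contra hnb
    rw [ReadBefore, not_or, not_and] at hnb
    obtain ⟨hd1, hd2, hd3⟩ := hdr.bead_eq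
    rcases (not_lt.1 hnb.1).eq_or_lt with h1 | h1
    · rw [← h1, hrow] at hd2
      have : c = d := Prod.ext h1 (by omega)
      rw [this, hdj] at hcj
      exact add_one_ne_self hk j hcj
    -- The position just before the bead of `d` has the residue of `c` and lies below the bead of
    -- `c`, so it is occupied; then `d` is not removable.
    · apply hd3
      have hlt := (bead_strictAnti (addAll k γ (l.take (u + 1)))) h1
      refine ((isCore_iff (by omega)).1 hcore).mem_of_le (m := bead _ c.1) ⟨c.1, rfl⟩ (by omega) ?_
      rw [hd1, bead, hrow]
      rw [residue_eq] at hcj hdj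
      rw [Int.cast_sub, hdj, Int.cast_one, add_sub_cancel_right, ← hcj]
      congr 1; push_cast; ring

/-- Suppose `j + 1` is applied before `j`, with lowest cells `c` and `d`. The cell above `c` has
residue `j`, and the reading order puts its content at most at that of `d`. By flushness it lies in
the shape after the step of `j`. It was not there before, so it is marked in that step, in the same
column as `c`, against the horizontal strip condition. -/
theorem IsGood.cyc (hk : 0 < k) {γ : YoungDiagram} (hγ : IsCore (k + 1) γ)
    {l : List (ZMod (k + 1))} (h : IsGood k γ l) : l.reverse.Pairwise (CycBefore k) := by
  rw [List.pairwise_reverse, List.pairwise_iff_getElem]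
  intro t u ht hu htu
  refine ⟨fun he => ?_, fun he => ?_⟩
  · have := (h.nodup.getElem_inj_iff).1 he; omega
  have hall := (isAllowed_iff γ l).1 h.allowed
  obtain ⟨c, hc⟩ := exists_isLowestIn (hall t ht)
  obtain ⟨d, hd⟩ := exists_isLowestIn (hall u hu)
  have hrb := h.increasing t u htu c d hc hd
  have ht' : l[t]? = some l[t] := List.getElem?_eq_getElem ht
  have hu' : l[u]? = some l[u] := List.getElem?_eq_getElem hu
  have hcj : residue k c = l[t] := by
    have := hc.1.2; rw [ht'] at this; exact (Option.some.inj this).symm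
  have hdj : residue k d = l[u] := by
    have := hd.1.2; rw [hu'] at this; exact (Option.some.inj this).symm
  have hcr := hc.1.1
  have hdr := hd.1.1
  have hle := addAll_take_mono γ l (by omega : t + 1 ≤ u + 1)
  have hcore : IsCore (k + 1) (addAll k γ (l.take (u + 1))) := hγ.addAll hk _
  have hres : residue k (c.1 + 1, c.2) = l[u] := by rw [residue_up, hcj, he]; ring
  have he3 : (c.1 + 1, c.2) ∈ addAll k γ (l.take (u + 1)) := by
    obtain ⟨hd1, hd2, -⟩ := hdr.bead_eq
    have hcm : (c.1, c.2) ∈ addAll k γ (l.take (u + 1)) := hle hcr.1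
    rw [YoungDiagram.mem_iff_lt_rowLen] at hcm
    have hcont : (c.2 - c.1 - 1 : ℤ) ≤ d.2 - d.1 := by
      rcases hrb with h1 | h1
      · have := (addAll k γ (l.take (u + 1))).rowLen_anti _ _ h1.le
        omega
      · omega
    have hmem : (c.2 - c.1 - 1 : ℤ) ∈ beads (addAll k γ (l.take (u + 1))) := by
      refine ((isCore_iff (by omega)).1 hcore).mem_of_le (m := bead _ d.1) ⟨d.1, rfl⟩ (by omega) ?_
      rw [hd1, ← residue_eq, hdj, ← hres, residue_eq]
      congr 1; push_cast; ring
    obtain ⟨r, hr⟩ := hmem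
    rw [bead] at hr
    have hrc : c.1 < r := by
      by_contra hlt
      have := (addAll k γ (l.take (u + 1))).rowLen_anti r c.1 (by omega)
      omega
    have := (addAll k γ (l.take (u + 1))).rowLen_anti (c.1 + 1) r hrc
    rw [YoungDiagram.mem_iff_lt_rowLen]; omega
  have he2 : (c.1 + 1, c.2) ∉ addAll k γ (l.take u) := by
    intro hf
    obtain ⟨z, h1, h2, h3⟩ := exists_step_of_mem γ l (by omega : t + 1 ≤ u) hf hcr.2.2
    rw [hres] at h3
    have := getElem?_inj h.nodup h3 hu'
    omega
  have hmem : (c.1 + 1, c.2) ∈ stepCells k γ l u := by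
    rw [addAll_take_succ γ hu', mem_addCorners] at he3
    have := (he3.resolve_left he2).1.isRemovable_addCorners hk hres
    rw [← addAll_take_succ γ hu'] at this
    exact ⟨this, by rw [hu', hres]⟩
  have := h.horizontal t u c _ hc.1 hmem rfl
  have := congrArg Prod.fst this
  simp only at this
  omega

/-- The cells marked by the letter `j` of the word `l` applied to `γ`. -/
def cellsAt (k : ℕ) (γ : YoungDiagram) (l : List (ZMod (k + 1))) (j : ZMod (k + 1)) :
    Set (ℕ × ℕ) := {c | residue k c = j ∧ ∃ t, c ∈ stepCells k γ l t}

theorem cellsAt_eq {γ : YoungDiagram} {l : List (ZMod (k + 1))} (hl : l.Nodup) {t : ℕ}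
    {j : ZMod (k + 1)} (ht : l[t]? = some j) : cellsAt k γ l j = stepCells k γ l t := by
  ext c
  constructor
  · rintro ⟨h1, u, hu⟩
    have h2 := hu.2
    rw [h1] at h2
    rwa [getElem?_inj hl ht h2]
  · intro h
    have h2 := h.2
    rw [ht] at h2
    exact ⟨(Option.some.inj h2).symm, t, h⟩

/-- Cells of residues `i` and `j` are never neighbours, so adding one kind does not affect the
corners of the other kind. -/
theorem addCorners_comm {i j : ZMod (k + 1)} (hij : i ≠ j) (h1 : j ≠ i + 1) (h2 : i ≠ j + 1)
    (γ : YoungDiagram) : addCorners k i (addCorners k j γ) = addCorners k j (addCorners k i γ) ∧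
    ∀ c, residue k c = j → (IsRemovable (addCorners k j (addCorners k i γ)) c ↔
      IsRemovable (addCorners k j γ) c) := by
  have near (c : ℕ × ℕ) (i j : ZMod (k + 1)) (hij : i ≠ j) (h1 : j ≠ i + 1) (h2 : i ≠ j + 1)
      (hc : residue k c = i) : IsAddable (addCorners k j γ) c ↔ IsAddable γ c := by
    simp only [IsAddable]
    rw [mem_addCorners_of_residue_ne (by rwa [hc])]
    refine and_congr_right fun _ => and_congr (or_congr_right' ?_) (or_congr_right' ?_)
    · intro h0
      rw [mem_addCorners_of_residue_ne]
      have : residue k (c.1 - 1 + 1, c.2) = residue k (c.1 - 1, c.2) - 1 :=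
        residue_up k (c.1 - 1, c.2)
      rw [Nat.sub_add_cancel (Nat.pos_of_ne_zero h0)] at this
      intro h; rw [h, hc] at this; exact h1 (by rw [this]; ring)
    · intro h0
      rw [mem_addCorners_of_residue_ne]
      have : residue k (c.1, c.2 - 1 + 1) = residue k (c.1, c.2 - 1) + 1 :=
        residue_right k (c.1, c.2 - 1)
      rw [Nat.sub_add_cancel (Nat.pos_of_ne_zero h0)] at this
      intro h; rw [h, hc] at this; exact h2 this
  have e1 : addCorners k i (addCorners k j γ) = addCorners k j (addCorners k i γ) := by
    ext c
    simp only [YoungDiagram.mem_cells, mem_addCorners]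
    have n1 := near c i j hij h1 h2
    have n2 := near c j i hij.symm h2 h1
    tauto
  refine ⟨e1, fun c hc => ?_⟩
  rw [← e1]
  simp only [IsRemovable]
  have hne {d : ℕ × ℕ} (hd : residue k d ≠ i) :
      d ∈ addCorners k i (addCorners k j γ) ↔ d ∈ addCorners k j γ :=
    mem_addCorners_of_residue_ne hd
  rw [hne (by rw [hc]; exact hij.symm), hne (by rw [residue_right, hc]; exact h2.symm),
    hne (by rw [residue_up, hc]; intro h; exact h1 (by rw [← h]; ring))]

open Classical in
/-- Adding the corners of residue `i` while recording the marked cells. -/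
noncomputable def recordStep (k : ℕ) (i : ZMod (k + 1)) :
    Function.End (YoungDiagram × (ZMod (k + 1) → Set (ℕ × ℕ))) := fun p =>
  (addCorners k i p.1,
    Function.update p.2 i {c | IsRemovable (addCorners k i p.1) c ∧ residue k c = i})

theorem recordStep_comm {i j : ZMod (k + 1)} (hij : i ≠ j) (h1 : j ≠ i + 1) (h2 : i ≠ j + 1) :
    recordStep k i * recordStep k j = recordStep k j * recordStep k i := by
  funext ⟨γ, ρ⟩
  rw [end_mul_apply, end_mul_apply]
  have hc1 := addCorners_comm hij h1 h2 γ
  have hc2 := addCorners_comm hij.symm h2 h1 γ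
  refine Prod.ext hc1.1 ?_
  simp only [recordStep]
  rw [Function.update_comm hij.symm]
  congr 1
  · congr 1
    ext c
    simp only [Set.mem_ofPred_eq]
    constructor
    · rintro ⟨h3, h4⟩; exact ⟨(hc2.2 c h4).1 h3, h4⟩
    · rintro ⟨h3, h4⟩; exact ⟨(hc2.2 c h4).2 h3, h4⟩
  · ext c
    simp only [Set.mem_ofPred_eq]
    constructor
    · rintro ⟨h3, h4⟩; exact ⟨(hc1.2 c h4).2 h3, h4⟩
    · rintro ⟨h3, h4⟩; exact ⟨(hc1.2 c h4).1 h3, h4⟩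

theorem recordStep_prod (γ : YoungDiagram) {l : List (ZMod (k + 1))} (hl : l.Nodup) :
    (l.reverse.map (recordStep k)).prod (γ, fun _ => ∅) = (addAll k γ l, cellsAt k γ l) := by
  induction l using List.reverseRecOn with
  | nil =>
    refine Prod.ext rfl (funext fun j => ?_)
    symm
    simp [cellsAt, stepCells, end_one_apply]
  | append_singleton l i ih =>
    rw [List.nodup_append] at hl
    have hi : i ∉ l := fun h => hl.2.2 i h i (by simp) rfl
    rw [List.reverse_append, List.reverse_singleton, List.singleton_append, List.map_cons,
      List.prod_cons, end_mul_apply, ih hl.1]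
    refine Prod.ext (by rw [addAll_append]; rfl) (funext fun j => ?_)
    simp only [recordStep]
    have hlast : stepCells k γ (l ++ [i]) l.length
        = {c | IsRemovable (addCorners k i (addAll k γ l)) c ∧ residue k c = i} := by
      have := stepCells_append_right γ l [i] 0
      rw [add_zero] at this
      rw [this]
      simp [stepCells, eq_comm]
    by_cases hj : j = i
    · subst hj
      rw [Function.update_self, cellsAt_eq (t := l.length) (List.nodup_append.2 hl) (by simp), hlast]
    · rw [Function.update_of_ne hj]
      ext c
      refine and_congr_right fun hc => ?_
      constructor
      · rintro ⟨t, ht⟩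
        have hlt : t < l.length := (List.getElem?_eq_some_iff.1 ht.2).1
        exact ⟨t, by rwa [stepCells_append_left γ hlt]⟩
      · rintro ⟨t, ht⟩
        have hlt : t < (l ++ [i]).length := (List.getElem?_eq_some_iff.1 ht.2).1
        rw [List.length_append, List.length_singleton] at hlt
        rcases Nat.lt_succ_iff_lt_or_eq.1 hlt with h3 | rfl
        · exact ⟨t, by rwa [stepCells_append_left γ h3] at ht⟩
        · rw [hlast] at ht
          exact absurd (hc.symm.trans ht.2) hj

/-- The final shape and the marked cells are the value of a product in the monoid of self-maps, in
which non-adjacent letters commute, so `prod_eq_of_cycBefore` applies to `recordStep`. -/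
theorem record_eq_of_perm (γ : YoungDiagram) {l l' : List (ZMod (k + 1))}
    (hl : l.reverse.Pairwise (CycBefore k)) (hl' : l'.reverse.Pairwise (CycBefore k))
    (hp : l.Perm l') :
    addAll k γ l = addAll k γ l' ∧ cellsAt k γ l = cellsAt k γ l' := by
  have h := prod_eq_of_cycBefore (recordStep k) (fun i j => recordStep_comm) hl hl'
    ((List.reverse_perm l).trans (hp.trans (List.reverse_perm l').symm))
  have h1 := recordStep_prod γ (nodup_of_cyc hl)
  rw [h, recordStep_prod γ (nodup_of_cyc hl')] at h1
  exact ⟨(Prod.mk.inj h1).1.symm, (Prod.mk.inj h1).2.symm⟩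

theorem isAllowed_iff_cellsAt (γ : YoungDiagram) {l : List (ZMod (k + 1))} (hl : l.Nodup) :
    IsAllowed k γ l ↔ ∀ j ∈ l, (cellsAt k γ l j).Nonempty := by
  rw [isAllowed_iff]
  constructor
  · intro h j hj
    obtain ⟨t, ht, rfl⟩ := List.getElem_of_mem hj
    rw [cellsAt_eq hl (List.getElem?_eq_getElem ht)]
    exact h t ht
  · intro h t ht
    rw [← cellsAt_eq hl (List.getElem?_eq_getElem ht)]
    exact h _ (List.getElem_mem ht)

theorem isAllowed_iff_of_perm (γ : YoungDiagram) {l l' : List (ZMod (k + 1))}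
    (hl : l.reverse.Pairwise (CycBefore k)) (hl' : l'.reverse.Pairwise (CycBefore k))
    (hp : l.Perm l') : IsAllowed k γ l ↔ IsAllowed k γ l' := by
  rw [isAllowed_iff_cellsAt γ (nodup_of_cyc hl), isAllowed_iff_cellsAt γ (nodup_of_cyc hl'),
    (record_eq_of_perm γ hl hl' hp).2]
  simp only [hp.mem_iff]

theorem ReadBefore.asymm {c d : ℕ × ℕ} (h : ReadBefore c d) : ¬ ReadBefore d c := by
  simp only [ReadBefore] at *; omega

/-- The lowest marked cell of each letter is the same for both words, and the order of these cells
in the reading fixes the order of the letters. -/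
theorem IsGood.eq_of_perm (hk : 0 < k) {γ : YoungDiagram} (hγ : IsCore (k + 1) γ)
    {l l' : List (ZMod (k + 1))} (h : IsGood k γ l) (h' : IsGood k γ l') (hp : l.Perm l') :
    l = l' := by
  have hrec := (record_eq_of_perm γ (h.cyc hk hγ) (h'.cyc hk hγ) hp).2
  let R : ZMod (k + 1) → ZMod (k + 1) → Prop := fun a b => ∀ c d,
    IsLowestIn (cellsAt k γ l a) c → IsLowestIn (cellsAt k γ l b) d → ReadBefore c d
  have hR {m : List (ZMod (k + 1))} (hm : IsGood k γ m) (he : cellsAt k γ l = cellsAt k γ m) :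
      m.Pairwise R := by
    rw [List.pairwise_iff_getElem]
    intro t u ht hu htu c d
    rw [he, cellsAt_eq hm.nodup (List.getElem?_eq_getElem ht),
      cellsAt_eq hm.nodup (List.getElem?_eq_getElem hu)]
    exact hm.increasing t u htu c d
  have hne := (isAllowed_iff_cellsAt γ h.nodup).1 h.allowed
  refine hp.eq_of_pairwise (le := R) ?_ (hR h rfl) (hR h' hrec)
  intro a b ha hb hab hba
  exfalso
  obtain ⟨c, hc⟩ := exists_isLowestIn (hne a ha)
  obtain ⟨d, hd⟩ := exists_isLowestIn (hne b (hp.mem_iff.2 hb))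
  exact (hab c d hc hd).asymm (hba d c hd hc)

/-- The position of a cell in the reading order. -/
def readKey (c : ℕ × ℕ) : ℕᵒᵈ ×ₗ ℕ := toLex (OrderDual.toDual c.1, c.2)

theorem readBefore_iff {c d : ℕ × ℕ} : ReadBefore c d ↔ readKey c < readKey d := by
  rw [readKey, readKey, Prod.Lex.toLex_lt_toLex, OrderDual.toDual_lt_toDual,
    OrderDual.toDual_inj, ReadBefore, eq_comm (a := d.1)]

theorem readKey_injective : Function.Injective readKey := by
  intro c d h
  have := toLex.injective h
  exact Prod.ext (OrderDual.toDual.injective (Prod.mk.inj this).1) (Prod.mk.inj this).2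

theorem IsLowestIn.unique {γ : YoungDiagram} {l : List (ZMod (k + 1))} {t : ℕ} {c d : ℕ × ℕ}
    (hc : IsLowestIn (stepCells k γ l t) c) (hd : IsLowestIn (stepCells k γ l t) d) : c = d :=
  hc.1.1.eq_of_row hd.1.1 (le_antisymm (hc.2 d hd.1) (hd.2 c hc.1))

/-- Sort the letters by the reading position of their lowest marked cells. By `readBefore_of_cyc`,
sorting leaves adjacent letters in their original order, so the word stays cyclically decreasing and
marks the same cells. -/
theorem exists_isGood_perm (hk : 0 < k) {γ : YoungDiagram} (hγ : IsCore (k + 1) γ)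
    {l : List (ZMod (k + 1))} (hl : l.reverse.Pairwise (CycBefore k)) (ha : IsAllowed k γ l) :
    ∃ l', IsGood k γ l' ∧ l.Perm l' := by
  classical
  have hn := nodup_of_cyc hl
  have hex : ∀ j, ∃ c, j ∈ l → IsLowestIn (cellsAt k γ l j) c := by
    intro j
    by_cases hj : j ∈ l
    · obtain ⟨c, hc⟩ := exists_isLowestIn ((isAllowed_iff_cellsAt γ hn).1 ha j hj)
      exact ⟨c, fun _ => hc⟩
    · exact ⟨(0, 0), fun h => absurd h hj⟩
  choose low hlow using hex
  let le : ZMod (k + 1) → ZMod (k + 1) → Prop := fun a b => readKey (low a) ≤ readKey (low b)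
  have htot : Std.Total le := ⟨fun a b => le_total _ _⟩
  have htrans : IsTrans _ le := ⟨fun a b c => le_trans⟩
  have hp : l.Perm (l.insertionSort le) := (List.perm_insertionSort le l).symm
  have hs := List.pairwise_insertionSort le l
  generalize l.insertionSort le = l' at hp hs
  have hn' : l'.Nodup := hp.nodup_iff.1 hn
  have hs' : ∀ {t u : ℕ} {a b : ZMod (k + 1)}, t < u → l'[t]? = some a → l'[u]? = some b →
      readKey (low a) ≤ readKey (low b) := by
    intro t u a b htu ht hu
    obtain ⟨h1, rfl⟩ := List.getElem?_eq_some_iff.1 ht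
    obtain ⟨h2, rfl⟩ := List.getElem?_eq_some_iff.1 hu
    exact List.pairwise_iff_getElem.1 hs t u h1 h2 htu
  have hcyc : l'.reverse.Pairwise (CycBefore k) := by
    rw [List.pairwise_reverse, List.pairwise_iff_getElem]
    intro t u ht hu htu
    refine ⟨fun he => ?_, fun he => ?_⟩
    · have := (hn'.getElem_inj_iff).1 he; omega
    have hle := hs' htu (List.getElem?_eq_getElem ht) (List.getElem?_eq_getElem hu)
    have hal := hp.mem_iff.2 (List.getElem_mem ht)
    have hbl := hp.mem_iff.2 (List.getElem_mem hu)
    rw [he] at hle hal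
    generalize l'[u] = b at hle hal hbl
    obtain ⟨p, hpl⟩ := List.getElem?_of_mem hal
    obtain ⟨q, hql⟩ := List.getElem?_of_mem hbl
    have hqp : q < p := by
      rcases lt_trichotomy p q with h | h | h
      · exact absurd rfl (cyc_of_lt hl h hpl hql).2
      · subst h; rw [hpl] at hql
        exact absurd (Option.some.inj hql) (add_one_ne_self hk b)
      · exact h
    have h1 := hlow _ hal
    have h2 := hlow _ hbl
    rw [cellsAt_eq hn hpl] at h1
    rw [cellsAt_eq hn hql] at h2
    have := readBefore_of_cyc hk hγ hl hqp hql hpl h2 h1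
    rw [readBefore_iff] at this
    exact absurd hle (not_le.2 this)
  have hrec := (record_eq_of_perm γ hl hcyc hp).2
  refine ⟨l', ⟨(isAllowed_iff_of_perm γ hl hcyc hp).1 ha, hn', ?_,
    fun t u c d hc hd => horizontal_of_cyc hcyc hc hd⟩, hp⟩
  intro t u htu c d hc hd
  have ht := hc.1.2
  have hu := hd.1.2
  have key : ∀ {t : ℕ} {c : ℕ × ℕ}, IsLowestIn (stepCells k γ l' t) c → low (residue k c) = c := by
    intro t c hc
    have ht := hc.1.2
    have := hlow (residue k c) (hp.mem_iff.2 (List.mem_of_getElem? ht))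
    rw [hrec, cellsAt_eq hn' ht] at this
    exact this.unique hc
  have hle := hs' htu ht hu
  rw [key hc, key hd] at hle
  rw [readBefore_iff]
  refine lt_of_le_of_ne hle fun he => ?_
  rw [readKey_injective he] at ht
  have := getElem?_inj hn' ht hu
  omega

/-- The words of length `r` that satisfy the conditions on one alphabet of a tableau. -/
noncomputable def goodWords (k : ℕ) (γ : YoungDiagram) (r : ℕ) : Finset (List (ZMod (k + 1))) :=
  ((List.finite_length_eq (ZMod (k + 1)) r).inter_of_left {l | IsGood k γ l}).toFinset

theorem mem_goodWords {γ : YoungDiagram} {r : ℕ} {l : List (ZMod (k + 1))} :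
    l ∈ goodWords k γ r ↔ l.length = r ∧ IsGood k γ l := by
  rw [goodWords, Set.Finite.mem_toFinset]; rfl

theorem wordProd_eq_of_perm {l l' : List (ZMod (k + 1))}
    (hl : l.reverse.Pairwise (CycBefore k)) (hl' : l'.reverse.Pairwise (CycBefore k))
    (hp : l.Perm l') :
    (affineSystem k).wordProd l.reverse = (affineSystem k).wordProd l'.reverse :=
  prod_eq_of_cycBefore (affineSystem k).simple (fun i j hij h1 h2 =>
    simple_comm_of_eq_two (affineSystem k) (by rw [affineMatrix_apply, if_neg hij, if_neg (by tauto)]))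
    hl hl' ((List.reverse_perm l).trans (hp.trans (List.reverse_perm l').symm))

theorem perm_of_wordProd_eq (hk : 0 < k) {l l' : List (ZMod (k + 1))} (hl : l.Nodup)
    (hl' : l'.Nodup)
    (he : (affineSystem k).wordProd l.reverse = (affineSystem k).wordProd l'.reverse) :
    l.Perm l' := by
  rw [List.perm_ext_iff_of_nodup hl hl']
  intro a
  have h1 := fun h => mem_of_wordProd_eq hk (List.nodup_reverse.2 hl) he (i := a) h
  have h2 := fun h => mem_of_wordProd_eq hk (List.nodup_reverse.2 hl') he.symm (i := a) h
  simp only [List.mem_reverse] at h1 h2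
  exact ⟨h1, h2⟩

/-- The Pieri rule. -/
theorem sum_wordOp_single (hk : 0 < k) {γ : YoungDiagram} (hγ : IsCore (k + 1) γ) (r : ℕ) (a : ℤ) :
    ∑ w ∈ (finite_cyclicallyDecreasing k r).toFinset,
      wordOp k (cycWord k w) (Finsupp.single γ a) =
    ∑ l ∈ goodWords k γ r, Finsupp.single (addAll k γ l)
      (a * (-1) ^ (r + shortHooks k (addAll k γ l) + shortHooks k γ)) := by
  classical
  simp only [wordOp_single]
  rw [← Finset.sum_filter]
  symm
  have hw {l : List (ZMod (k + 1))} (hl : l ∈ goodWords k γ r) :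
      (affineSystem k).wordProd l.reverse ∈ cyclicallyDecreasing k r := by
    obtain ⟨h1, h2⟩ := mem_goodWords.1 hl
    have hc := h2.cyc hk hγ
    refine ⟨⟨_, (isCyclicallyDecreasingWord_iff hk).2 hc, rfl⟩, ?_⟩
    rw [(isReduced_of_nodup hk (List.nodup_reverse.2 h2.nodup)).eq, List.length_reverse, h1]
  have hperm {l : List (ZMod (k + 1))} (hl : l ∈ goodWords k γ r) :
      l.Perm (cycWord k ((affineSystem k).wordProd l.reverse)) := by
    obtain ⟨c1, c2, -⟩ := cycWord_spec hk (hw hl)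
    exact perm_of_wordProd_eq hk (mem_goodWords.1 hl).2.nodup (nodup_of_cyc c1) c2.symm
  -- Good words correspond to the elements whose operator does not vanish on `γ`. The word is
  -- reversed because its first letter acts first.
  refine Finset.sum_bij (fun l _ => (affineSystem k).wordProd l.reverse) ?_ ?_ ?_ ?_
  · intro l hl
    rw [Finset.mem_filter, Set.Finite.mem_toFinset]
    refine ⟨hw hl, ?_⟩
    have h2 := (mem_goodWords.1 hl).2
    exact (isAllowed_iff_of_perm γ (h2.cyc hk hγ) (cycWord_spec hk (hw hl)).1 (hperm hl)).1
      h2.allowed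
  · intro l hl l' hl' he
    have h2 := (mem_goodWords.1 hl).2
    have h2' := (mem_goodWords.1 hl').2
    exact h2.eq_of_perm hk hγ h2' (perm_of_wordProd_eq hk h2.nodup h2'.nodup he)
  · intro w hw
    rw [Finset.mem_filter, Set.Finite.mem_toFinset] at hw
    obtain ⟨c1, c2, c3⟩ := cycWord_spec hk hw.1
    obtain ⟨l, hl, hp⟩ := exists_isGood_perm hk hγ c1 hw.2
    refine ⟨l, mem_goodWords.2 ⟨hp.length_eq.symm.trans c3, hl⟩, ?_⟩
    rw [← c2]
    exact wordProd_eq_of_perm (hl.cyc hk hγ) c1 hp.symm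
  · intro l hl
    obtain ⟨h1, h2⟩ := mem_goodWords.1 hl
    obtain ⟨c1, -, c3⟩ := cycWord_spec hk (hw hl)
    rw [(record_eq_of_perm γ (h2.cyc hk hγ) c1 (hperm hl)).1, c3]

end Pieri

end AffineGroth

namespace AffineGroth

/-! ### Concatenating good words, one for each alphabet. -/

section TableauWords

variable {k : ℕ}

/-- The number of letters in the first `m` alphabets. -/
def weightSum (α : ℕ →₀ ℕ) (m : ℕ) : ℕ := ∑ i ∈ Finset.range m, α i

theorem weightSum_succ (α : ℕ →₀ ℕ) (m : ℕ) : weightSum α (m + 1) = weightSum α m + α m :=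
  Finset.sum_range_succ _ _

theorem weightSum_mono (α : ℕ →₀ ℕ) : Monotone (weightSum α) :=
  monotone_nat_of_le_succ fun m => by rw [weightSum_succ]; omega

theorem eq_zero_of_compLength_le {α : ℕ →₀ ℕ} {x : ℕ} (h : compLength α ≤ x) : α x = 0 := by
  by_contra hx
  have : x + 1 ≤ compLength α :=
    Finset.le_sup (f := (· + 1)) (Finsupp.mem_support_iff.2 hx)
  omega

theorem weightSum_compLength (α : ℕ →₀ ℕ) : weightSum α (compLength α) = α.degree := by
  symm
  refine Finset.sum_subset (fun x hx => ?_) fun x _ hx => by simpa using hx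
  rw [Finset.mem_range]
  by_contra h
  exact Finsupp.mem_support_iff.1 hx (eq_zero_of_compLength_le (not_lt.1 h))

theorem weightSum_le_degree (α : ℕ →₀ ℕ) (x : ℕ) : weightSum α x ≤ α.degree := by
  rw [← weightSum_compLength]
  rcases le_total x (compLength α) with h | h
  · exact weightSum_mono α h
  · refine le_of_eq (Finset.sum_subset (by simpa using h) fun i _ hi => ?_).symm
    exact eq_zero_of_compLength_le (by simpa using hi)

/-- The part of the word `l` belonging to the alphabet `x`. -/
def segment (α : ℕ →₀ ℕ) (l : List (ZMod (k + 1))) (x : ℕ) : List (ZMod (k + 1)) :=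
  (l.take (weightSum α (x + 1))).drop (weightSum α x)

theorem take_append_segment (α : ℕ →₀ ℕ) (l : List (ZMod (k + 1))) (x : ℕ) :
    l.take (weightSum α x) ++ segment α l x = l.take (weightSum α (x + 1)) := by
  have := List.take_append_drop (weightSum α x) (l.take (weightSum α (x + 1)))
  rwa [List.take_take, min_eq_left (weightSum_mono α (Nat.le_succ x))] at this

theorem length_segment {α : ℕ →₀ ℕ} {l : List (ZMod (k + 1))} {x : ℕ}
    (h : weightSum α (x + 1) ≤ l.length) : (segment α l x).length = α x := by
  rw [segment, List.length_drop, List.length_take, weightSum_succ] at *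
  omega

theorem stepCells_segment (γ : YoungDiagram) {α : ℕ →₀ ℕ} (l : List (ZMod (k + 1))) {x t : ℕ}
    (ht : t < α x) : stepCells k γ l (weightSum α x + t)
      = stepCells k (addAll k γ (l.take (weightSum α x))) (segment α l x) t := by
  have h1 : l.take (weightSum α x + t + 1)
      = l.take (weightSum α x) ++ (segment α l x).take (t + 1) := by
    have := List.take_append_drop (weightSum α x) (l.take (weightSum α x + t + 1))
    rw [List.take_take, min_eq_left (by omega)] at this
    rw [← this, segment, List.drop_take, List.drop_take, List.take_take, weightSum_succ]
    congr 2
    omega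
  have h2 : l[weightSum α x + t]? = (segment α l x)[t]? := by
    rw [segment, List.getElem?_drop, List.getElem?_take_of_lt]
    rw [weightSum_succ]; omega
  simp only [stepCells]
  rw [h1, h2, addAll_append]

/-- Each of the first `m` alphabets satisfies the conditions on a tableau. -/
def IsTabWord (k : ℕ) (α : ℕ →₀ ℕ) (m : ℕ) (l : List (ZMod (k + 1))) : Prop :=
  ∀ x < m, IsGood k (addAll k ⊥ (l.take (weightSum α x))) (segment α l x)

/-- The words of the tableaux with `m` alphabets. -/
noncomputable def tabWords (k : ℕ) (α : ℕ →₀ ℕ) (m : ℕ) : Finset (List (ZMod (k + 1))) :=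
  ((List.finite_length_eq (ZMod (k + 1)) (weightSum α m)).inter_of_left
    {l | IsTabWord k α m l}).toFinset

theorem mem_tabWords {α : ℕ →₀ ℕ} {m : ℕ} {l : List (ZMod (k + 1))} :
    l ∈ tabWords k α m ↔ l.length = weightSum α m ∧ IsTabWord k α m l := by
  rw [tabWords, Set.Finite.mem_toFinset]; rfl

theorem isTabWord_append {α : ℕ →₀ ℕ} {m : ℕ} {l l' : List (ZMod (k + 1))}
    (hl : l.length = weightSum α m) (hl' : l'.length = α m) :
    IsTabWord k α (m + 1) (l ++ l') ↔ IsTabWord k α m l ∧ IsGood k (addAll k ⊥ l) l' := by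
  have h1 {x : ℕ} (hx : x ≤ m) : (l ++ l').take (weightSum α x) = l.take (weightSum α x) :=
    List.take_append_of_le_length (by rw [hl]; exact weightSum_mono α hx)
  have h2 {x : ℕ} (hx : x < m) : segment α (l ++ l') x = segment α l x := by
    rw [segment, h1 hx, segment]
  have h3 : segment α (l ++ l') m = l' := by
    rw [segment, List.take_of_length_le (by rw [List.length_append, weightSum_succ, hl, hl']),
      ← hl, List.drop_left]
  constructor
  · intro h
    refine ⟨fun x hx => ?_, ?_⟩
    · have := h x (by omega)
      rwa [h1 hx.le, h2 hx] at this
    · have := h m (by omega)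
      rwa [h1 le_rfl, h3, ← hl, List.take_length] at this
  · rintro ⟨h4, h5⟩ x hx
    rcases Nat.lt_succ_iff_lt_or_eq.1 hx with h6 | rfl
    · rw [h1 h6.le, h2 h6]; exact h4 x h6
    · rwa [h1 le_rfl, h3, ← hl, List.take_length]

theorem sum_tabWords_succ {M : Type*} [AddCommMonoid M] (α : ℕ →₀ ℕ) (m : ℕ)
    (f : List (ZMod (k + 1)) → M) : ∑ l ∈ tabWords k α (m + 1), f l =
      ∑ l ∈ tabWords k α m, ∑ l' ∈ goodWords k (addAll k ⊥ l) (α m), f (l ++ l') := by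
  rw [Finset.sum_sigma']
  symm
  refine Finset.sum_bij' (fun p _ => p.1 ++ p.2)
    (fun l _ => ⟨l.take (weightSum α m), l.drop (weightSum α m)⟩) ?_ ?_ ?_ ?_ ?_
  · rintro ⟨l, l'⟩ h
    rw [Finset.mem_sigma, mem_tabWords, mem_goodWords] at h
    rw [mem_tabWords, isTabWord_append h.1.1 h.2.1, List.length_append, weightSum_succ]
    exact ⟨by rw [h.1.1, h.2.1], h.1.2, h.2.2⟩
  · intro l h
    rw [mem_tabWords, weightSum_succ] at h
    have h1 : (l.take (weightSum α m)).length = weightSum α m := by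
      rw [List.length_take]; omega
    have h2 : (l.drop (weightSum α m)).length = α m := by
      rw [List.length_drop]; omega
    rw [Finset.mem_sigma, mem_tabWords, mem_goodWords]
    have h3 := h.2
    rw [← List.take_append_drop (weightSum α m) l, isTabWord_append h1 h2] at h3
    exact ⟨⟨h1, h3.1⟩, h2, h3.2⟩
  · rintro ⟨l, l'⟩ h
    rw [Finset.mem_sigma, mem_tabWords, mem_goodWords] at h
    simp only [← h.1.1, List.take_left, List.drop_left]
  · intro l _
    exact List.take_append_drop _ l
  · intro p _; rfl

theorem shortHooks_bot : shortHooks k ⊥ = 0 := by simp [shortHooks]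

/-- The Pieri rule iterated from the empty core. The short-hook counts of the intermediate cores
again cancel modulo two. -/
theorem nilProj_prod_hElt (hk : 0 < k) (α : ℕ →₀ ℕ) (m : ℕ) :
    nilProj k ((List.range m).reverse.map fun x => hElt k (α x)).prod =
      ∑ l ∈ tabWords k α m, Finsupp.single (addAll k ⊥ l)
        ((-1) ^ (weightSum α m + shortHooks k (addAll k ⊥ l))) := by
  induction m with
  | zero =>
    have : tabWords k α 0 = {[]} := by
      ext l
      rw [mem_tabWords, Finset.mem_singleton]
      constructor
      · rintro ⟨h, -⟩; exact List.length_eq_zero_iff.1 h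
      · rintro rfl; exact ⟨rfl, fun x hx => absurd hx (by omega)⟩
    rw [this, Finset.sum_singleton]
    simp [nilProj_one hk, weightSum, shortHooks_bot]
  | succ m ih =>
    rw [List.range_succ, List.reverse_append, List.reverse_singleton, List.singleton_append,
      List.map_cons, List.prod_cons, nilProj_hElt_mul hk, ih, sum_tabWords_succ]
    simp only [map_sum]
    rw [Finset.sum_comm]
    refine Finset.sum_congr rfl fun l _ => ?_
    rw [sum_wordOp_single hk ((isCore_bot _).addAll hk l)]
    refine Finset.sum_congr rfl fun l' _ => ?_
    rw [addAll_append, ← pow_add, weightSum_succ]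
    congr 1
    have e : (-1 : ℤ) ^ (2 * shortHooks k (addAll k ⊥ l)) = 1 := by rw [pow_mul]; norm_num
    rw [show weightSum α m + shortHooks k (addAll k ⊥ l) +
      (α m + shortHooks k (addAll k (addAll k ⊥ l) l') + shortHooks k (addAll k ⊥ l))
      = (weightSum α m + α m + shortHooks k (addAll k (addAll k ⊥ l) l'))
        + 2 * shortHooks k (addAll k ⊥ l) by ring, pow_add, e, mul_one]

theorem IsTabWord.isAllowed_take {α : ℕ →₀ ℕ} {m : ℕ} {l : List (ZMod (k + 1))}
    (h : IsTabWord k α m l) {x : ℕ} (hx : x ≤ m) :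
    IsAllowed k ⊥ (l.take (weightSum α x)) := by
  induction x with
  | zero => simp [weightSum, IsAllowed]
  | succ x ih =>
    rw [← take_append_segment, isAllowed_append]
    exact ⟨ih (by omega), (h x hx).allowed⟩

theorem isGood_nil (γ : YoungDiagram) : IsGood k γ [] where
  allowed := trivial
  nodup := List.nodup_nil
  increasing t u _ c d hc := by simpa [stepCells] using hc.1
  horizontal t u c d hc := by simp [stepCells] at hc

theorem IsTabWord.isGood {α : ℕ →₀ ℕ} {l : List (ZMod (k + 1))}
    (h : IsTabWord k α (compLength α) l) (hl : l.length = α.degree) (x : ℕ) :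
    IsGood k (addAll k ⊥ (l.take (weightSum α x))) (segment α l x) := by
  rcases Nat.lt_or_ge x (compLength α) with hx | hx
  · exact h x hx
  · have := length_segment (l := l) (x := x) (hl ▸ weightSum_le_degree α _)
    rw [eq_zero_of_compLength_le hx, List.length_eq_zero_iff] at this
    rw [this]
    exact isGood_nil _

end TableauWords

/-! ### Words of residues and set-valued tableaux. -/

section Fillings

variable {k : ℕ}

open Classical in
/-- The filling of a word: the letter `t + 1` is placed in the cells marked at index `t`. -/
noncomputable def fillingOf (k : ℕ) (l : List (ZMod (k + 1))) (c : ℕ × ℕ) : Finset ℕ :=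
  (Finset.Icc 1 l.length).filter fun x => c ∈ stepCells k ⊥ l (x - 1)

theorem mem_fillingOf {l : List (ZMod (k + 1))} {c : ℕ × ℕ} {x : ℕ} :
    x ∈ fillingOf k l c ↔ ∃ t, x = t + 1 ∧ c ∈ stepCells k ⊥ l t := by
  simp only [fillingOf, Finset.mem_filter, Finset.mem_Icc]
  constructor
  · rintro ⟨h, h'⟩; exact ⟨x - 1, by omega, h'⟩
  · rintro ⟨t, rfl, h⟩
    have : t < l.length := (List.getElem?_eq_some_iff.1 h.2).1
    exact ⟨by omega, h⟩

theorem succ_mem_fillingOf {l : List (ZMod (k + 1))} {c : ℕ × ℕ} {t : ℕ} :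
    t + 1 ∈ fillingOf k l c ↔ c ∈ stepCells k ⊥ l t := by
  rw [mem_fillingOf]
  constructor
  · rintro ⟨u, h, h'⟩; rwa [show t = u by omega]
  · intro h; exact ⟨t, rfl, h⟩

/-- A cell is a removable corner at the moment it is added, so it receives the letter of that step.
-/
theorem mem_addAll_take_iff (hk : 0 < k) {l : List (ZMod (k + 1))} {c : ℕ × ℕ} {x : ℕ} :
    c ∈ addAll k ⊥ (l.take x) ↔ ∃ y ∈ fillingOf k l c, y ≤ x := by
  constructor
  · intro h
    induction x with
    | zero => exact absurd h (YoungDiagram.notMem_bot c)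
    | succ x ih =>
      by_cases hc : c ∈ addAll k ⊥ (l.take x)
      · obtain ⟨y, h1, h2⟩ := ih hc
        exact ⟨y, h1, by omega⟩
      · cases hl : l[x]? with
        | none =>
          rw [List.take_add_one, hl, Option.toList_none, List.append_nil] at h
          exact absurd h hc
        | some i =>
          have h1 := h
          rw [addAll_take_succ ⊥ hl, mem_addCorners] at h1
          obtain ⟨h2, h3⟩ := h1.resolve_left hc
          refine ⟨x + 1, succ_mem_fillingOf.2 ⟨?_, by rw [hl, h3]⟩, le_rfl⟩
          rw [addAll_take_succ ⊥ hl]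
          exact h2.isRemovable_addCorners hk h3
  · rintro ⟨y, hy, hyx⟩
    obtain ⟨t, rfl, h⟩ := mem_fillingOf.1 hy
    exact addAll_take_mono ⊥ l hyx h.1.1

theorem isStandard_fillingOf (hk : 0 < k) {l : List (ZMod (k + 1))} (h : IsAllowed k ⊥ l) :
    IsStandard k l.length (fillingOf k l) := by
  refine ⟨fun c x hx => ?_, fun x hx => ?_⟩
  · simp only [fillingOf, Finset.mem_filter] at hx
    exact hx.1
  rw [Finset.mem_Icc] at hx
  obtain ⟨t, rfl⟩ : ∃ t, x = t + 1 := ⟨x - 1, by omega⟩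
  obtain ⟨c₀, hc₀⟩ := (isAllowed_iff ⊥ l).1 h t (by omega)
  refine ⟨addAll k ⊥ (l.take (t + 1)), fun c => mem_addAll_take_iff hk,
    (isCore_bot _).addAll hk _, c₀, hc₀.1, fun c => ?_⟩
  rw [succ_mem_fillingOf, stepCells, Set.mem_ofPred_eq, hc₀.2, Option.some_inj]
  exact and_congr_right fun _ => eq_comm

theorem isLowest_fillingOf {l : List (ZMod (k + 1))} {t : ℕ} {c : ℕ × ℕ} :
    IsLowest (fillingOf k l) (t + 1) c ↔ IsLowestIn (stepCells k ⊥ l t) c := by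
  simp only [IsLowest, succ_mem_fillingOf, IsLowestIn]

theorem mem_alphabet {α : ℕ →₀ ℕ} {x a : ℕ} :
    a ∈ alphabet α x ↔ ∃ t < α x, a = weightSum α x + t + 1 := by
  rw [alphabet, Finset.mem_Ioc]
  change weightSum α x < a ∧ a ≤ weightSum α (x + 1) ↔ _
  rw [weightSum_succ]
  constructor
  · intro h; exact ⟨a - weightSum α x - 1, by omega, by omega⟩
  · rintro ⟨t, h, rfl⟩; omega

/-- Every letter of an allowed word marks at least one cell, of its own residue. Hence the condition
of having `α x` distinct residues says precisely that the `α x` letters of the segment are distinct.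
-/
theorem isGood_segment_iff {α : ℕ →₀ ℕ} {l : List (ZMod (k + 1))} (h : IsAllowed k ⊥ l) {x : ℕ}
    (hl : weightSum α (x + 1) ≤ l.length) :
    IsGood k (addAll k ⊥ (l.take (weightSum α x))) (segment α l x) ↔
      LowestReadingIncreasing (fillingOf k l) (alphabet α x) ∧
      (residue k '' cellsOf (fillingOf k l) (alphabet α x)).ncard = α x ∧
      ∀ c ∈ cellsOf (fillingOf k l) (alphabet α x),
        ∀ d ∈ cellsOf (fillingOf k l) (alphabet α x), c.2 = d.2 → c = d := by
  classical
  set γ := addAll k ⊥ (l.take (weightSum α x)) with hγ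
  have hlen := length_segment hl
  have hall : IsAllowed k γ (segment α l x) := by
    rw [← List.take_append_drop (weightSum α (x + 1)) l, isAllowed_append, ← take_append_segment,
      isAllowed_append] at h
    exact h.1.2
  have hcells {c : ℕ × ℕ} : c ∈ cellsOf (fillingOf k l) (alphabet α x) ↔
      ∃ t, c ∈ stepCells k γ (segment α l x) t := by
    constructor
    · rintro ⟨a, ha, hc⟩
      obtain ⟨t, ht, rfl⟩ := mem_alphabet.1 ha
      rw [succ_mem_fillingOf, stepCells_segment ⊥ l ht] at hc
      exact ⟨t, hc⟩
    · rintro ⟨t, hc⟩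
      have ht : t < α x := by rw [← hlen]; exact (List.getElem?_eq_some_iff.1 hc.2).1
      rw [← stepCells_segment ⊥ l ht] at hc
      exact ⟨_, mem_alphabet.2 ⟨t, ht, rfl⟩, succ_mem_fillingOf.2 hc⟩
  have hres : residue k '' cellsOf (fillingOf k l) (alphabet α x)
      = ((segment α l x).toFinset : Set (ZMod (k + 1))) := by
    ext j
    rw [Finset.mem_coe, List.mem_toFinset]
    constructor
    · rintro ⟨c, hc, rfl⟩
      obtain ⟨t, ht⟩ := hcells.1 hc
      exact List.mem_of_getElem? ht.2
    · intro hj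
      obtain ⟨t, ht, rfl⟩ := List.getElem_of_mem hj
      obtain ⟨c, hc⟩ := (isAllowed_iff _ _).1 hall t ht
      refine ⟨c, hcells.2 ⟨t, hc⟩, ?_⟩
      have := hc.2
      rw [List.getElem?_eq_getElem ht] at this
      exact (Option.some.inj this).symm
  have hnd : (segment α l x).toFinset.card = α x ↔ (segment α l x).Nodup := by
    rw [← hlen]
    exact Multiset.toFinset_card_eq_card_iff_nodup (m := (segment α l x : Multiset (ZMod (k + 1))))
  rw [hres, Set.ncard_coe_finset, hnd]
  constructor
  · intro hg
    refine ⟨?_, hg.nodup, ?_⟩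
    · intro a ha b hb hab c d hc hd
      obtain ⟨t, ht, rfl⟩ := mem_alphabet.1 ha
      obtain ⟨u, hu, rfl⟩ := mem_alphabet.1 hb
      rw [isLowest_fillingOf, stepCells_segment ⊥ l ht] at hc
      rw [isLowest_fillingOf, stepCells_segment ⊥ l hu] at hd
      exact hg.increasing t u (by omega) c d hc hd
    · intro c hc d hd hcd
      obtain ⟨t, ht⟩ := hcells.1 hc
      obtain ⟨u, hu⟩ := hcells.1 hd
      exact hg.horizontal t u c d ht hu hcd
  · rintro ⟨h1, h2, h3⟩
    refine ⟨hall, h2, ?_, fun t u c d hc hd => h3 c (hcells.2 ⟨t, hc⟩) d (hcells.2 ⟨u, hd⟩)⟩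
    intro t u htu c d hc hd
    have ht : t < α x := by rw [← hlen]; exact (List.getElem?_eq_some_iff.1 hc.1.2).1
    have hu : u < α x := by rw [← hlen]; exact (List.getElem?_eq_some_iff.1 hd.1.2).1
    rw [← stepCells_segment ⊥ l ht, ← isLowest_fillingOf] at hc
    rw [← stepCells_segment ⊥ l hu, ← isLowest_fillingOf] at hd
    exact h1 _ (mem_alphabet.2 ⟨t, ht, rfl⟩) _ (mem_alphabet.2 ⟨u, hu, rfl⟩) (by omega) c d hc hd

/-- Each letter is recovered as the residue of any cell that it marks. -/
theorem eq_of_fillingOf_eq {l l' : List (ZMod (k + 1))} (h : IsAllowed k ⊥ l)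
    (hlen : l.length = l'.length) (he : fillingOf k l = fillingOf k l') : l = l' := by
  refine List.ext_getElem hlen fun t ht ht' => ?_
  obtain ⟨c, hc⟩ := (isAllowed_iff ⊥ l).1 h t ht
  have hc' := hc
  rw [← succ_mem_fillingOf, he, succ_mem_fillingOf] at hc'
  have := hc.2.trans hc'.2.symm
  rwa [List.getElem?_eq_getElem ht, List.getElem?_eq_getElem ht', Option.some_inj] at this

/-- Two successive cores of a standard tableau differ by adding all corners of one residue. -/
theorem eq_addCorners_of_le {i : ZMod (k + 1)} {γ γ' : YoungDiagram}
    (hγ' : IsCore (k + 1) γ') (hle : γ ≤ γ') (hr : HasRemovable k i γ')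
    (h : ∀ c ∈ γ', c ∉ γ → IsRemovable γ' c ∧ residue k c = i) : γ' = addCorners k i γ := by
  have hna := hγ'.not_hasAddable hr
  have hadd : ∀ c ∈ γ', c ∉ γ → IsAddable γ c := by
    intro c hc hc'
    refine ⟨hc', or_iff_not_imp_left.2 fun h0 => ?_, or_iff_not_imp_left.2 fun h0 => ?_⟩
    · by_contra hn
      have := (h _ (γ'.up_left_mem (Nat.sub_le _ _) le_rfl hc) hn).1.2.2
      simp only [Nat.sub_add_cancel (Nat.pos_of_ne_zero h0)] at this
      exact this hc
    · by_contra hn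
      have := (h _ (γ'.up_left_mem le_rfl (Nat.sub_le _ _) hc) hn).1.2.1
      simp only [Nat.sub_add_cancel (Nat.pos_of_ne_zero h0)] at this
      exact this hc
  ext c
  rw [YoungDiagram.mem_cells, YoungDiagram.mem_cells, mem_addCorners]
  constructor
  · intro hc
    by_cases hc' : c ∈ γ
    · exact Or.inl hc'
    · exact Or.inr ⟨hadd c hc hc', (h c hc hc').2⟩
  · rintro (hc | ⟨⟨h1, h2, h3⟩, h4⟩)
    · exact hle hc
    · by_contra hc
      exact hna ⟨c, ⟨hc, h2.imp_right fun h => hle h, h3.imp_right fun h => hle h⟩, h4⟩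

/-- The word lists the residues of the letters `1, …, n`. By `eq_addCorners_of_le` the cores of the
tableau are those obtained by applying the word, so the marked cells agree as well. -/
theorem exists_fillingOf_eq {n : ℕ} {T : ℕ × ℕ → Finset ℕ} (hT : IsStandard k n T) :
    ∃ l : List (ZMod (k + 1)), l.length = n ∧ IsAllowed k ⊥ l ∧ fillingOf k l = T ∧
      ∀ c, c ∈ addAll k ⊥ l ↔ (T c).Nonempty := by
  have hT0 : ∀ {c y}, y ∈ T c → 1 ≤ y ∧ y ≤ n := fun h => Finset.mem_Icc.1 (hT.1 _ h)
  have hex : ∀ t, ∃ p : YoungDiagram × ZMod (k + 1), t < n →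
      (∀ c, c ∈ p.1 ↔ ∃ y ∈ T c, y ≤ t + 1) ∧ IsCore (k + 1) p.1 ∧ HasRemovable k p.2 p.1 ∧
        ∀ c, t + 1 ∈ T c ↔ IsRemovable p.1 c ∧ residue k c = p.2 := by
    intro t
    by_cases ht : t < n
    · obtain ⟨γ, h1, h2, c₀, h3, h4⟩ := hT.2 (t + 1) (Finset.mem_Icc.2 ⟨by omega, ht⟩)
      exact ⟨(γ, residue k c₀), fun _ => ⟨h1, h2, ⟨c₀, h3, rfl⟩, h4⟩⟩
    -- An arbitrary value for indices beyond the degree.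
    · exact ⟨(⊥, 0), fun h => absurd h ht⟩
  choose p hp using hex
  let l : List (ZMod (k + 1)) := (List.range n).map fun t => (p t).2
  have hl : l.length = n := by simp [l]
  have hget {t : ℕ} (ht : t < n) : l[t]? = some (p t).2 := by simp [l, ht]
  have hmem : ∀ x ≤ n, ∀ c, c ∈ addAll k ⊥ (l.take x) ↔ ∃ y ∈ T c, y ≤ x := by
    intro x hx
    induction x with
    | zero =>
      intro c
      refine ⟨fun h => absurd h (YoungDiagram.notMem_bot c), ?_⟩
      rintro ⟨y, h1, h2⟩
      have := (hT0 h1).1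
      omega
    | succ x ih =>
      obtain ⟨h1, h2, h3, h4⟩ := hp x hx
      have ih := ih (by omega)
      have he : (p x).1 = addAll k ⊥ (l.take (x + 1)) := by
        rw [addAll_take_succ ⊥ (hget hx)]
        refine eq_addCorners_of_le h2 (fun c hc => ?_) h3 fun c hc hc' => ?_
        · obtain ⟨y, hy, hyx⟩ := (ih c).1 hc
          exact (h1 c).2 ⟨y, hy, by omega⟩
        · obtain ⟨y, hy, hyx⟩ := (h1 c).1 hc
          have : ¬ y ≤ x := fun hle => hc' ((ih c).2 ⟨y, hy, hle⟩)
          obtain rfl : y = x + 1 := by omega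
          exact (h4 c).1 hy
      rw [← he]
      exact h1
  have hstep {t : ℕ} (ht : t < n) (c : ℕ × ℕ) : c ∈ stepCells k ⊥ l t ↔ t + 1 ∈ T c := by
    obtain ⟨h1, -, -, h4⟩ := hp t ht
    have he : addAll k ⊥ (l.take (t + 1)) = (p t).1 := by
      ext c
      rw [YoungDiagram.mem_cells, YoungDiagram.mem_cells, hmem _ ht, h1]
    rw [h4, stepCells, Set.mem_ofPred_eq, he, hget ht, Option.some_inj, eq_comm (a := (p t).2)]
  refine ⟨l, hl, (isAllowed_iff ⊥ l).2 fun t ht => ?_, ?_, fun c => ?_⟩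
  · rw [hl] at ht
    obtain ⟨-, -, ⟨c, hc⟩, h4⟩ := hp t ht
    exact ⟨c, (hstep ht c).2 ((h4 c).2 hc)⟩
  · funext c
    ext y
    rw [mem_fillingOf]
    constructor
    · rintro ⟨t, rfl, h⟩
      exact (hstep (by rw [← hl]; exact (List.getElem?_eq_some_iff.1 h.2).1) c).1 h
    · intro h
      obtain ⟨h1, h2⟩ := hT0 h
      obtain ⟨t, rfl⟩ : ∃ t, y = t + 1 := ⟨y - 1, by omega⟩
      exact ⟨t, rfl, (hstep h2 c).2 h⟩
  · have := hmem n le_rfl c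
    rw [← hl, List.take_length] at this
    rw [this, hl]
    exact ⟨fun ⟨y, h, _⟩ => ⟨y, h⟩, fun ⟨y, h⟩ => ⟨y, h, (hT0 h).2⟩⟩

end Fillings

/-! ### Coefficients and the sum over tableaux. -/

section MainTheorem

variable {k : ℕ}

theorem isAllowed_of_mem_tabWords {α : ℕ →₀ ℕ} {l : List (ZMod (k + 1))}
    (hl : l ∈ tabWords k α (compLength α)) : IsAllowed k ⊥ l := by
  have := (mem_tabWords.1 hl).2.isAllowed_take le_rfl
  rwa [← (mem_tabWords.1 hl).1, List.take_length] at this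

/-- The tableau of a word. -/
noncomputable def tableauOf (hk : 0 < k) {lam : YoungDiagram} {α : ℕ →₀ ℕ}
    {l : List (ZMod (k + 1))} (hl : l ∈ tabWords k α (compLength α))
    (hs : addAll k ⊥ l = coreOf k lam) : AffineSVTableau k lam :=
  have hlen : l.length = α.degree := by rw [(mem_tabWords.1 hl).1, weightSum_compLength]
  have hgood := (mem_tabWords.1 hl).2.isGood hlen
  have hle (x : ℕ) : weightSum α x ≤ l.length := hlen ▸ weightSum_le_degree α x
  have hall := isAllowed_of_mem_tabWords hl
  { weight := α
    filling := fillingOf k l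
    weight_le := fun x => by
      have := CycBefore.length_le hk ((hgood x).cyc hk ((isCore_bot _).addAll hk _))
      rwa [List.length_reverse, length_segment (hle _)] at this
    standard := hlen ▸ isStandard_fillingOf hk hall
    shape := fun c => by
      rw [← hs]
      nth_rw 1 [← List.take_length (l := l)]
      rw [mem_addAll_take_iff hk]
      refine ⟨fun ⟨y, h, _⟩ => ⟨y, h⟩, fun ⟨y, h⟩ => ⟨y, h, ?_⟩⟩
      exact (Finset.mem_Icc.1 ((isStandard_fillingOf hk hall).1 c h)).2
    increasing := fun x => ((isGood_segment_iff hall (hle _)).1 (hgood x)).1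
    residues := fun x => ((isGood_segment_iff hall (hle _)).1 (hgood x)).2.1
    horizontal := fun x => ((isGood_segment_iff hall (hle _)).1 (hgood x)).2.2 }

theorem AffineSVTableau.eq_of_filling_eq {lam : YoungDiagram} {T T' : AffineSVTableau k lam}
    (hw : T.weight = T'.weight) (hf : T.filling = T'.filling) : T = T' := by
  cases T
  cases T'
  cases hw
  cases hf
  rfl

theorem AffineSVTableau.exists_tableauOf_eq (hk : 0 < k) {lam : YoungDiagram}
    (T : AffineSVTableau k lam) :
    ∃ l, ∃ (hl : l ∈ tabWords k T.weight (compLength T.weight))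
      (hs : addAll k ⊥ l = coreOf k lam), tableauOf hk hl hs = T := by
  obtain ⟨l, h1, h2, h3, h4⟩ := exists_fillingOf_eq T.standard
  have hs : addAll k ⊥ l = coreOf k lam := by
    ext c
    rw [YoungDiagram.mem_cells, YoungDiagram.mem_cells, h4, T.shape]
  refine ⟨l, mem_tabWords.2 ⟨by rw [h1, weightSum_compLength], fun x _ => ?_⟩, hs, ?_⟩
  · rw [isGood_segment_iff h2 (h1 ▸ weightSum_le_degree _ _), h3]
    exact ⟨T.increasing x, T.residues x, T.horizontal x⟩
  · exact AffineSVTableau.eq_of_filling_eq rfl h3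

/-- Only words ending at the core of `lam` contribute, and the number of short hooks of that core is
the size of `lam`, which turns the sign into a constant. -/
theorem coeff_affineGrothendieck (hk : 0 < k) {lam : YoungDiagram} (hlam : lam.rowLen 0 ≤ k)
    (α : ℕ →₀ ℕ) [DecidablePred fun l => addAll k ⊥ l = coreOf k lam] :
    MvPowerSeries.coeff α (affineGrothendieck k (grassmannianOf k lam)) =
      ∑ _l ∈ (tabWords k α (compLength α)).filter fun l => addAll k ⊥ l = coreOf k lam,
        (-1) ^ (lam.card + α.degree) := by
  obtain ⟨h1, h2⟩ := coreOf_spec hk hlam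
  obtain ⟨h3, h4⟩ := grassmannianOf_spec hk h1
  change (nilHeckeBasis k).repr _ _ = _
  rw [repr_eq_nilProj hk h3, h4, nilProj_prod_hElt hk, Finsupp.finsetSum_apply, Finset.sum_filter]
  refine Finset.sum_congr rfl fun l _ => ?_
  classical
  rw [Finsupp.single_apply]
  refine ite_congr rfl (fun h => ?_) fun _ => rfl
  rw [h, weightSum_compLength, ← card_eq_shortHooks h2, add_comm]

/-- For fixed `α` the tableaux of weight `α` are the injective image of a finite set of words, and
tableaux of any other weight contribute zero. -/
theorem hasSum_monomial_weight (hk : 0 < k) (lam : YoungDiagram) (hlam : lam.rowLen 0 ≤ k)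
    (α : ℕ →₀ ℕ) :
    HasSum (fun T : AffineSVTableau k lam => MvPowerSeries.coeff α
        (MvPowerSeries.monomial T.weight ((-1 : ℤ) ^ (lam.card + T.weight.degree))))
      (MvPowerSeries.coeff α (affineGrothendieck k (grassmannianOf k lam))) := by
  classical
  rw [coeff_affineGrothendieck hk hlam]
  set F := (tabWords k α (compLength α)).filter fun l => addAll k ⊥ l = coreOf k lam with hF
  let g (l : F) : AffineSVTableau k lam :=
    tableauOf hk (Finset.mem_filter.1 l.2).1 (Finset.mem_filter.1 l.2).2
  have hg : Function.Injective g := by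
    intro l l' h
    have h1 := (Finset.mem_filter.1 l.2).1
    have h2 := (Finset.mem_filter.1 l'.2).1
    exact Subtype.ext (eq_of_fillingOf_eq (isAllowed_of_mem_tabWords h1)
      ((mem_tabWords.1 h1).1.trans (mem_tabWords.1 h2).1.symm)
      (congrArg AffineSVTableau.filling h))
  rw [← hg.hasSum_iff, ← Finset.sum_coe_sort]
  · convert hasSum_fintype _ using 1
    refine Finset.sum_congr rfl fun l _ => ?_
    exact (MvPowerSeries.coeff_monomial_same α _).symm
  · intro T hT
    rw [MvPowerSeries.coeff_monomial, if_neg]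
    rintro rfl
    obtain ⟨l, hl, hs, h⟩ := T.exists_tableauOf_eq hk
    exact hT ⟨⟨l, Finset.mem_filter.2 ⟨hl, hs⟩⟩, h⟩

end MainTheorem

end AffineGroth

open scoped MvPowerSeries.WithPiTopology

theorem mainTheorem1 (k : ℕ) (hk : 0 < k) (lam : YoungDiagram) (hlam : lam.rowLen 0 ≤ k) :
    HasSum
      (fun T : AffineGroth.AffineSVTableau k lam =>
        MvPowerSeries.monomial T.weight ((-1 : ℤ) ^ (lam.card + T.weight.degree)))
      (AffineGroth.affineGrothendieck k (AffineGroth.grassmannianOf k lam)) := by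
  rw [MvPowerSeries.WithPiTopology.hasSum_iff_hasSum_coeff]
  exact AffineGroth.hasSum_monomial_weight hk lam hlam
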